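/- **Theorem (Asymptotic optimality of LB-SDA).** Let $\rho\neq 0$ be a measure on $\mathbb{R}$ and let $\nu_1,\dots,\nu_K$ ($K\ge 1$) be members of the one-parameter exponential family generated by $\rho$: $d\nu_k(x)=e^{\theta_k x-\Psi(\theta_k)}\,d\rho(x)$ with $\Psi(\theta)=\log\int e^{\theta x}\,d\rho(x)$, where $\int e^{\theta_k x}d\rho(x)<\infty$ and $\nu_k$ has a finite mean $\mu_k$. Let $\mu^\star=\max_k\mu_k$ (possibly attained by several arms), and let $\mathrm{kl}(\mu_k,\mu^\star)$ be the Kullback–Leibler divergence $\mathrm{KL}(\nu_k\,\|\,\nu_{k^\star})$ for an optimal arm $k^\star$. Let $(Y_{k,s})_{s\ge1}$ be the rewards of arm $k$, i.i.d. with law $\nu_k$ and independent across arms. The algorithm LB-SDA proceeds in rounds $r=1,2,\dots$. In round $1$ every arm is pulled once. In round $r\ge2$, let $N_k$ be the number of pulls of arm $k$ so far; the leader $\ell$ is an arm with maximal $N_k$, ties being broken by the largest sum of rewards and then uniformly at random, independently of the rewards. Let $\mathcal A$ be the set of arms $k\neq\ell$ such that $$N_k\le\sqrt{\log r}\qquad\text{or}\qquad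 \frac1{N_k}\sum_{s=1}^{N_k}Y_{k,s}\ \ge\ \frac1{N_k}\sum_{s=N_\ell-N_k+1}^{N_\ell}Y_{\ell,s}.$$ All arms of $\mathcal A$ are pulled once (in increasing order of index); if $\mathcal A=\emptyset$, only $\ell$ is pulled. Let $A_1,A_2,\dots$ be the successive pulls and $\mathcal R(T)=\mathbb E\big[\sum_{t=1}^T(\mu^\star-\mu_{A_t})\big]$. Then for every $\varepsilon>0$ there is a constant $C(\nu,\varepsilon)$, depending only on $\nu=(\nu_1,\dots,\nu_K)$ and $\varepsilon$, such that for all $T\geq 1$ $$\mathcal R(T)\ \le\ \sum_{k:\,\mu_k<\mu^\star}\frac{(1+\varepsilon)(\mu^\star-\mu_k)}{\mathrm{kl}(\mu_k,\mu^\star)}\,\log T\;+\;C(\nu,\varepsilon).$$ The same bound holds for the regret accumulated over the first $T$ rounds, $\sum_k(\mu^\star-\mu_k)\,\mathbb E[N_k(T)]$, where $N_k(T)$ is the number of pulls of arm $k$ in rounds $1,\dots,T$. -/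

import Mathlib

open MeasureTheory ProbabilityTheory

universe u

noncomputable section

namespace LBSDA

/-- The member with natural parameter `θ` of the one-parameter exponential family with base
measure `ρ`: it has density `x ↦ exp (θ x - Ψ(θ))` with respect to `ρ`, where
`Ψ(θ) = log ∫ exp (θ x) dρ(x)`. -/
def expFamily (ρ : Measure ℝ) (θ : ℝ) : Measure ℝ := ρ.tilted (fun x => θ * x)

/-- The mean of a distribution on the real line. -/
def mean (ν : Measure ℝ) : ℝ := ∫ x, x ∂ν

/-- The Kullback-Leibler divergence as a real number (members with finite mean of one exponential
family have a finite divergence). -/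
def kl (ν ν' : Measure ℝ) : ℝ := (InformationTheory.klDiv ν ν').toReal

/-- The elements of `s` at which `f` attains its maximum over `s`. -/
def argmaxOn {ι α : Type*} [LinearOrder α] (s : Finset ι) (f : ι → α) : Finset ι :=
  s.filter (fun i => ∀ j ∈ s, f j ≤ f i)

theorem argmaxOn_nonempty {ι α : Type*} [LinearOrder α] {s : Finset ι} (hs : s.Nonempty)
    (f : ι → α) : (argmaxOn s f).Nonempty := by
  obtain ⟨i, hi, h⟩ := s.exists_max_image f hs
  exact ⟨i, Finset.mem_filter.2 ⟨hi, h⟩⟩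

/-- The leader: an arm with the largest number `N k` of pulls; among these, one with the largest
sum `S k` of rewards; among these, the one with the largest tie-breaking mark `u k`. For independent
uniform marks on `[0, 1]` the last step is a uniformly random choice (the marks are
almost surely distinct; `min'` only serves to have a definite value on a null set). -/
def leader {K : ℕ} [NeZero K] (N : Fin K → ℕ) (S u : Fin K → ℝ) : Fin K :=
  (argmaxOn (argmaxOn (argmaxOn Finset.univ N) S) u).min'
    (argmaxOn_nonempty (argmaxOn_nonempty (argmaxOn_nonempty Finset.univ_nonempty N) S) u)

/-- Average of the entries `x a, …, x (b - 1)`. -/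
def blockMean (x : ℕ → ℝ) (a b : ℕ) : ℝ := (∑ i ∈ Finset.Ico a b, x i) / ((b - a : ℕ) : ℝ)

/-- The challengers pulled in round `r` when `ℓ` is the leader and arm `k` has been pulled `N k`
times so far: those with at most `√(log r)` pulls, and those whose empirical mean is at least the
mean of the last `N k` observations of the leader. Here `y k i` is the reward of the `(i+1)`-th pull
of arm `k`. -/
def challengers {K : ℕ} (y : Fin K → ℕ → ℝ) (N : Fin K → ℕ) (r : ℕ) (ℓ : Fin K) :
    Finset (Fin K) :=
  open Classical in
  Finset.univ.filter (fun k => k ≠ ℓ ∧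
    ((N k : ℝ) ≤ Real.sqrt (Real.log r) ∨
      blockMean (y ℓ) (N ℓ - N k) (N ℓ) ≤ blockMean (y k) 0 (N k)))

/-- The set of arms that LB-SDA pulls in round `r ≥ 1`, given the rewards `y`, the pull counts `N`
before that round and the tie-breaking marks `u` of that round. -/
def selection {K : ℕ} [NeZero K] (y : Fin K → ℕ → ℝ) (N : Fin K → ℕ) (u : Fin K → ℝ) (r : ℕ) :
    Finset (Fin K) :=
  if r = 1 then Finset.univ
  else
    let ℓ := leader N (fun k => ∑ i ∈ Finset.range (N k), y k i) u
    if challengers y N r ℓ = ∅ then {ℓ} else challengers y N r ℓ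

/-- `pullCount y u r k` is the number of pulls of arm `k` in the rounds `1, …, r` of LB-SDA. -/
def pullCount {K : ℕ} [NeZero K] (y : Fin K → ℕ → ℝ) (u : ℕ → Fin K → ℝ) : ℕ → Fin K → ℕ
  | 0 => fun _ => 0
  | r + 1 => fun k => pullCount y u r k +
      if k ∈ selection y (pullCount y u r) (u (r + 1)) (r + 1) then 1 else 0

/-- The set of arms pulled by LB-SDA in round `r ≥ 1`. -/
def pulled {K : ℕ} [NeZero K] (y : Fin K → ℕ → ℝ) (u : ℕ → Fin K → ℝ) (r : ℕ) : Finset (Fin K) :=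
  selection y (pullCount y u (r - 1)) (u r) r

/-- The arms pulled in the rounds `1, …, n`, in chronological order (within a round, by increasing
index). -/
def history {K : ℕ} [NeZero K] (y : Fin K → ℕ → ℝ) (u : ℕ → Fin K → ℝ) (n : ℕ) : List (Fin K) :=
  (List.range n).flatMap (fun i => (pulled y u (i + 1)).sort (· ≤ ·))

/-- The sum `∑_{t=1}^T (μ* - μ_{A_t})` along a trajectory, where `gap k = μ* - μ_k` and
`A_1, …, A_T` are the first `T` pulls (they take place in the first `T` rounds, as every round has
at least one pull). -/
def timeRegret {K : ℕ} [NeZero K] (gap : Fin K → ℝ)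
    (y : Fin K → ℕ → ℝ) (u : ℕ → Fin K → ℝ) (T : ℕ) : ℝ :=
  (((history y u T).take T).map gap).sum

/-- The sum of `gap A = μ* - μ_A` over all pulls `A` in the rounds `1, …, T` along a trajectory. -/
def roundRegret {K : ℕ} [NeZero K] (gap : Fin K → ℝ)
    (y : Fin K → ℕ → ℝ) (u : ℕ → Fin K → ℝ) (T : ℕ) : ℝ :=
  ∑ k, gap k * (pullCount y u T k : ℝ)

/-- A stationary bandit with arms `ν k` on a probability space: `Y k i` is the reward of the
`(i+1)`-th pull of arm `k`, `U r k` the tie-breaking mark of arm `k` in round `r`. -/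
structure IsBandit {K : ℕ} {Ω : Type u} [MeasurableSpace Ω] (P : Measure Ω)
    (ν : Fin K → Measure ℝ) (Y : Fin K → ℕ → Ω → ℝ) (U : ℕ → Fin K → Ω → ℝ) : Prop where
  measurable_reward : ∀ k i, Measurable (Y k i)
  measurable_mark : ∀ r k, Measurable (U r k)
  law_reward : ∀ k i, P.map (Y k i) = ν k
  law_mark : ∀ r k, P.map (U r k) = volume.restrict (Set.Icc (0 : ℝ) 1)
  indep : iIndepFun (Sum.elim (fun p : Fin K × ℕ => Y p.1 p.2)
    (fun q : ℕ × Fin K => U q.1 q.2)) P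

end LBSDA

end

/-! Two laws of the family are exponential tilts of each other. For a suboptimal law `ν` and the
optimal law, its tilt by `lam > 0`, compare rewards with a line of slope `d` slightly above the mean
of `ν`. The choice in `exists_pair` gives `log E_ν exp (lam (X - d)) = kl / (1 + ε)`, so by change
of measure `n` consecutive optimal rewards have mean at most `d` with probability at most `exp (-n
kl / (1 + ε))`, while the first `n` rewards of the suboptimal arm have mean at least `d` with
geometrically small probability. If an optimal arm leads and the suboptimal arm is pulled at count
`n` without being forced, one of these deviations has occurred. The leader's block has at most `T +
1` positions, so from `n ≈ (1 + ε) log T / kl` on such pulls have bounded expected number; forced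
pulls stop earlier, up to a constant. This is `exists_integral_pullCount_le`.

The difficulty is to bound the expected number of rounds with a suboptimal leader. By
`exists_measure_lead_le`, the probability that a round in `[4^k, 4^(k+1))` is led by an arm worse
than `s` is `O(k⁻² 4⁻ᵏ)`, which is summable against the number of rounds. Time is measured by the
level, the pull count of the leader. Outside events of small probability, reward sums beyond level
`2^k` are ordered like the means, so the mean of the leader never decreases (`lead_mono`), and `s`
wins every duel with a worse leader once it has `J ≈ k` pulls. If a worse arm leads at a time at
least `4^k`, it follows that `s` had fewer than `J` pulls at an earlier time of order `4^k`:
otherwise `s` would have been pulled in all rounds in between and would have caught up with a leader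
that is never pulled (`pullCount_lt_of_lead`). Cutting the levels up to then into `O(k)` windows,
one of them is clean (`exists_clean`): `s` stays at some count `j` with `√(log 2^k) < j < J`, all
leaders have one common law `ν₀`, and no pull is forced.

A clean window is improbable (`exists_measure_clean_le`). It is cut into `n ≈ 4^k / k²` cells. In
each cell, up to a constant probability of avoiding ties (`exists_noTie`), there is a moment when
the leader has no challenger. If its next rewards keep its walk above the line of slope `d`, those
of its rivals stay below, and its last `j` rewards add up to no more than those of `s`, then it
keeps the lead and `s` wins a duel, so the window is not clean (`psum_lt_of_clean`). Suppose that
the centred sum of the `j` rewards of `s` is `v ∈ [-t, -t + 1)`. The leader can first climb to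
height `t` while staying nonnegative, with probability at least a constant times `exp (-lam t)`
(`exists_boost_level`), and then make `j` steps ending in `[-t, v]` without going below `-t`; a
cyclic rotation costs only a factor `j + 1` (`measure_walk_le_rotation`). So a cell fails to be
clean with probability `h` of order `exp (-lam t) F(v) / (j + 1)`, where `F(v)` is the
`ν₀`-probability of ending in `[-t, v]`. Conversely `s` has a tilted law, so a slice of values with
`F` of a given size has probability at most `exp (lam (1 - t)) r^j F`, for some `r < 1`. In `(1 -
h)^n ≤ 1 / (n h)` times this probability, both `exp (-lam t)` and `F` cancel, and `(j + 1) r^j / n`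
remains. Since `j² ≥ (k + 1) / 3`, thanks to forced exploration, `r^j` beats every power of `k`. -/

noncomputable section
namespace LBSDA

/-! ### Independence for events that depend on part of the coordinates -/

/-- Membership in `A` is decided by the coordinates in `I`. -/
def DecidedBy {ι α : Type*} (I : Set ι) (A : Set (ι → α)) : Prop :=
  ∀ z z' : ι → α, (∀ i ∈ I, z i = z' i) → (z ∈ A → z' ∈ A)

theorem DecidedBy.iff {ι α : Type*} {I : Set ι} {A : Set (ι → α)} (h : DecidedBy I A)
    {z z' : ι → α} (hz : ∀ i ∈ I, z i = z' i) : z ∈ A ↔ z' ∈ A :=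
  ⟨h z z' hz, h z' z fun i hi => (hz i hi).symm⟩

/-- Setting the coordinates outside `I` to zero does not affect membership, which turns the event
into a preimage under a map measurable with respect to the coordinates in `I`. -/
theorem measurableSet_of_decidedBy {ι Ω : Type*} {Z : ι → Ω → ℝ} {I : Set ι} {A : Set (ι → ℝ)}
    (hA : MeasurableSet A) (hI : DecidedBy I A) :
    MeasurableSet[⨆ i ∈ I, MeasurableSpace.comap (Z i) inferInstance]
      {ω | (fun i => Z i ω) ∈ A} := by
  classical
  let _ : MeasurableSpace Ω := ⨆ i ∈ I, MeasurableSpace.comap (Z i) inferInstance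
  have key : {ω | (fun i => Z i ω) ∈ A} =
      (fun ω i => if i ∈ I then Z i ω else 0) ⁻¹' A := by
    ext ω
    exact hI.iff fun i hi => by simp [hi]
  rw [key]
  refine (measurable_pi_iff.2 fun i => ?_) hA
  by_cases hi : i ∈ I
  · simp only [hi, if_true]
    exact (comap_measurable (Z i)).mono
      (le_iSup₂ (f := fun i (_ : i ∈ I) => MeasurableSpace.comap (Z i) inferInstance) i hi) le_rfl
  · simp only [hi, if_false]
    exact measurable_const

section Indep

variable {ι Ω : Type*} [MeasurableSpace Ω] {P : Measure Ω} {Z : ι → Ω → ℝ}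

theorem measure_inter_of_decidedBy (hZ : ∀ i, Measurable (Z i)) (hind : iIndepFun Z P)
    {I J : Set ι} (hIJ : Disjoint I J) {A B : Set (ι → ℝ)} (hA : MeasurableSet A)
    (hB : MeasurableSet B) (hI : DecidedBy I A) (hJ : DecidedBy J B) :
    P {ω | (fun i => Z i ω) ∈ A ∧ (fun i => Z i ω) ∈ B} =
      P {ω | (fun i => Z i ω) ∈ A} * P {ω | (fun i => Z i ω) ∈ B} := by
  have h := indep_iSup_of_disjoint (fun i => (hZ i).comap_le) hind hIJ
  exact (Indep_iff _ _ _).1 h _ _ (measurableSet_of_decidedBy hA hI)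
    (measurableSet_of_decidedBy hB hJ)

theorem map_comp_injective {ν : Measure ℝ} (hZ : ∀ i, Measurable (Z i)) (hind : iIndepFun Z P)
    (e : ℕ → ι) (he : Function.Injective e) (hlaw : ∀ n, P.map (Z (e n)) = ν) :
    P.map (fun ω n => Z (e n) ω) = Measure.infinitePi (fun _ : ℕ => ν) := by
  have h := (hind.precomp he).map_fun_eq_infinitePi_map (fun n => hZ (e n))
  simp only [hlaw] at h
  exact h

end Indep

/-- The law of a sequence of independent variables with law `ν`. -/
def seqLaw (ν : Measure ℝ) : Measure (ℕ → ℝ) := Measure.infinitePi (fun _ : ℕ => ν)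

/-- The sequence without its first `n` entries. -/
def shift (n : ℕ) (x : ℕ → ℝ) : ℕ → ℝ := fun i => x (n + i)

theorem measurable_shift (n : ℕ) : Measurable (shift n) :=
  measurable_pi_iff.2 fun i => measurable_pi_apply (n + i)

section Seq

variable {ν : Measure ℝ} [IsProbabilityMeasure ν]

instance : IsProbabilityMeasure (seqLaw ν) := by unfold seqLaw; infer_instance

theorem iIndepFun_seqLaw : iIndepFun (fun (i : ℕ) (x : ℕ → ℝ) => x i) (seqLaw ν) :=
  iIndepFun_infinitePi (X := fun (_ : ℕ) (x : ℝ) => x) (fun _ => measurable_id)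

theorem map_eval_seqLaw (i : ℕ) : (seqLaw ν).map (fun x => x i) = ν :=
  Measure.infinitePi_map_eval (fun _ : ℕ => ν) i

theorem map_comp_injective_seqLaw {e : ℕ → ℕ} (he : Function.Injective e) :
    (seqLaw ν).map (fun x i => x (e i)) = seqLaw ν :=
  map_comp_injective (Z := fun (i : ℕ) (x : ℕ → ℝ) => x i) (fun i => measurable_pi_apply i)
    iIndepFun_seqLaw e he (fun i => map_eval_seqLaw (e i))

theorem map_shift_seqLaw (n : ℕ) : (seqLaw ν).map (shift n) = seqLaw ν :=
  map_comp_injective_seqLaw (add_right_injective n)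

theorem seqLaw_shift_preimage (n : ℕ) {T : Set (ℕ → ℝ)} (hT : MeasurableSet T) :
    (seqLaw ν).real {x | shift n x ∈ T} = (seqLaw ν).real T := by
  conv_rhs => rw [← map_shift_seqLaw (ν := ν) n]
  rw [measureReal_def, measureReal_def, Measure.map_apply (measurable_shift n) hT]
  rfl

theorem seqLaw_inter_shift {n : ℕ} {A T : Set (ℕ → ℝ)} (hA : MeasurableSet A)
    (hI : DecidedBy (Set.Iio n) A) (hT : MeasurableSet T) :
    (seqLaw ν).real {x | x ∈ A ∧ shift n x ∈ T} = (seqLaw ν).real A * (seqLaw ν).real T := by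
  rw [← seqLaw_shift_preimage n hT, measureReal_def, measureReal_def, measureReal_def,
    ← ENNReal.toReal_mul]
  congr 1
  refine measure_inter_of_decidedBy (Z := fun (i : ℕ) (x : ℕ → ℝ) => x i)
    (fun i => measurable_pi_apply i) iIndepFun_seqLaw (I := Set.Iio n) (J := Set.Ici n)
    (B := shift n ⁻¹' T) (Set.disjoint_left.2 fun i hi hj => absurd (Set.mem_Iio.1 hi)
        (not_lt.2 (Set.mem_Ici.1 hj))) hA
    (measurable_shift n hT) hI ?_
  intro z z' h hz
  have : shift n z = shift n z' := funext fun i => h (n + i) (Nat.le_add_right n i)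
  simpa [Set.mem_preimage, this] using hz

end Seq

/-! ### Bandit environments and fresh windows of rewards -/

section Bandit

variable {K : ℕ} {Ω : Type u} [MeasurableSpace Ω] {P : Measure Ω}
    {ν : Fin K → Measure ℝ} {Y : Fin K → ℕ → Ω → ℝ} {U : ℕ → Fin K → Ω → ℝ}

/-- A realisation of the rewards and of the tie-breaking marks. -/
abbrev Env (K : ℕ) := (Fin K → ℕ → ℝ) × (ℕ → Fin K → ℝ)

/-- The environment seen at `ω`. -/
def env (Y : Fin K → ℕ → Ω → ℝ) (U : ℕ → Fin K → Ω → ℝ) (ω : Ω) : Env K :=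
  (fun k i => Y k i ω, fun r k => U r k ω)

/-- Membership in `A` is decided by the marks and by the rewards with index in `I`. -/
def Local (I : Set (Fin K × ℕ)) (A : Set (Env K)) : Prop :=
  ∀ (y y' : Fin K → ℕ → ℝ) (u : ℕ → Fin K → ℝ), (∀ p ∈ I, y p.1 p.2 = y' p.1 p.2) →
    (y, u) ∈ A → (y', u) ∈ A

theorem Local.mono {I J : Set (Fin K × ℕ)} {A : Set (Env K)} (h : Local I A) (hIJ : I ⊆ J) :
    Local J A :=
  fun y y' u hy => h y y' u fun p hp => hy p (hIJ hp)

theorem Local.inter {I : Set (Fin K × ℕ)} {A B : Set (Env K)} (hA : Local I A) (hB : Local I B) :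
    Local I (A ∩ B) :=
  fun y y' u hy h => ⟨hA y y' u hy h.1, hB y y' u hy h.2⟩

theorem measurable_env (hB : IsBandit P ν Y U) : Measurable (env Y U) := by
  refine Measurable.prodMk ?_ ?_
  · exact measurable_pi_iff.2 fun k => measurable_pi_iff.2 fun i => hB.measurable_reward k i
  · exact measurable_pi_iff.2 fun k => measurable_pi_iff.2 fun i => hB.measurable_mark k i

/-- The rewards of arm `k` from index `n` on. -/
def window (k : Fin K) (n : ℕ) (e : Env K) : ℕ → ℝ := shift n (e.1 k)

theorem measurable_window (k : Fin K) (n : ℕ) : Measurable (window k n) :=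
  (measurable_shift n).comp ((measurable_pi_apply k).comp measurable_fst)

theorem measure_window (hB : IsBandit P ν Y U) (k : Fin K) (n : ℕ) {T : Set (ℕ → ℝ)}
    (hT : MeasurableSet T) :
    P.real {ω | window k n (env Y U ω) ∈ T} = (seqLaw (ν k)).real T := by
  have hZ : ∀ i, Measurable (Sum.elim (fun p : Fin K × ℕ => Y p.1 p.2)
      (fun q : ℕ × Fin K => U q.1 q.2) i) := by
    rintro (p | q)
    · exact hB.measurable_reward _ _
    · exact hB.measurable_mark _ _
  have h := map_comp_injective hZ hB.indep (fun i => Sum.inl (k, n + i))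
    (fun a b hab => by simpa using hab) (fun i => hB.law_reward k (n + i))
  have hm : Measurable (fun ω => window k n (env Y U ω)) :=
    (measurable_window k n).comp (measurable_env hB)
  rw [measureReal_def, measureReal_def, seqLaw, ← h, Measure.map_apply ?_ hT]
  · rfl
  · exact hm

/-- Rewards and marks form one independent family. The event `A` uses the marks and the rewards in
`I`, the window uses rewards outside `I`, so the two sets of coordinates are disjoint. -/
theorem measure_inter_window (hB : IsBandit P ν Y U) {I : Set (Fin K × ℕ)} {A : Set (Env K)}
    (hA : MeasurableSet A) (hI : Local I A) {k : Fin K} {n : ℕ} (hk : ∀ i, n ≤ i → (k, i) ∉ I)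
    {T : Set (ℕ → ℝ)} (hT : MeasurableSet T) :
    P.real {ω | env Y U ω ∈ A ∧ window k n (env Y U ω) ∈ T} =
      P.real {ω | env Y U ω ∈ A} * (seqLaw (ν k)).real T := by
  have hZ : ∀ i, Measurable (Sum.elim (fun p : Fin K × ℕ => Y p.1 p.2)
      (fun q : ℕ × Fin K => U q.1 q.2) i) := by
    rintro (p | q)
    · exact hB.measurable_reward _ _
    · exact hB.measurable_mark _ _
  set dec : (Fin K × ℕ ⊕ ℕ × Fin K → ℝ) → Env K :=
    fun z => (fun k i => z (Sum.inl (k, i)), fun r k => z (Sum.inr (r, k))) with hdec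
  have hdm : Measurable dec := by
    refine Measurable.prodMk ?_ ?_
    · exact measurable_pi_iff.2 fun k => measurable_pi_iff.2 fun i => measurable_pi_apply _
    · exact measurable_pi_iff.2 fun k => measurable_pi_iff.2 fun i => measurable_pi_apply _
  rw [← measure_window hB k n hT, measureReal_def, measureReal_def, measureReal_def,
    ← ENNReal.toReal_mul]
  congr 1
  refine measure_inter_of_decidedBy hZ hB.indep (I := Sum.inl '' I ∪ Set.range Sum.inr)
    (J := {c | ∃ i, n ≤ i ∧ c = Sum.inl (k, i)}) (A := dec ⁻¹' A)
    (B := (fun z => window k n (dec z)) ⁻¹' T) ?_ (hdm hA)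
    (((measurable_window k n).comp hdm) hT) ?_ ?_
  · rw [Set.disjoint_left]
    rintro c (⟨p, hp, rfl⟩ | ⟨q, rfl⟩) ⟨i, hi, h⟩
    · rw [Sum.inl.inj h] at hp
      exact hk i hi hp
    · simp at h
  · intro z z' h hz
    have hu : (dec z).2 = (dec z').2 := by
      ext r k
      exact h _ (Or.inr ⟨_, rfl⟩)
    have : ((dec z').1, (dec z).2) ∈ A :=
      hI _ _ _ (fun p hp => h (Sum.inl p) (Or.inl ⟨p, hp, rfl⟩)) hz
    rw [hu] at this
    exact this
  · intro z z' h hz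
    have : window k n (dec z) = window k n (dec z') :=
      funext fun i => h _ ⟨n + i, Nat.le_add_right n i, rfl⟩
    simpa [Set.mem_preimage, this] using hz

end Bandit

/-! ### Deterministic behaviour of the algorithm -/

section Dynamics

variable {K : ℕ} [NeZero K] (y : Fin K → ℕ → ℝ) (u : ℕ → Fin K → ℝ)

/-- The sum of the first `n` rewards of arm `k`. -/
def psum (k : Fin K) (n : ℕ) : ℝ := ∑ i ∈ Finset.range n, y k i

/-- The leader after `t` rounds. -/
def lead (t : ℕ) : Fin K :=
  leader (pullCount y u t) (fun k => psum y k (pullCount y u t k)) (u (t + 1))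

/-- The arms pulled in round `t + 1`. -/
def sel (t : ℕ) : Finset (Fin K) := selection y (pullCount y u t) (u (t + 1)) (t + 1)

/-- The number of pulls of the leader after `t` rounds. -/
def top (t : ℕ) : ℕ := Finset.univ.sup (pullCount y u t)

/-- Arm `k` is entitled to a pull in round `t + 1` if it is not the leader. -/
def Chal (t : ℕ) (k : Fin K) : Prop :=
  (pullCount y u t k : ℝ) ≤ Real.sqrt (Real.log (t + 1 : ℕ)) ∨
    blockMean (y (lead y u t)) (pullCount y u t (lead y u t) - pullCount y u t k)
      (pullCount y u t (lead y u t)) ≤ blockMean (y k) 0 (pullCount y u t k)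

theorem mem_argmaxOn {ι α : Type*} [LinearOrder α] {s : Finset ι} {f : ι → α} {i : ι} :
    i ∈ argmaxOn s f ↔ i ∈ s ∧ ∀ j ∈ s, f j ≤ f i := Finset.mem_filter

theorem leader_mem (N : Fin K → ℕ) (S v : Fin K → ℝ) :
    leader N S v ∈ argmaxOn (argmaxOn (argmaxOn Finset.univ N) S) v := Finset.min'_mem _ _

variable {y u} {t : ℕ} {k : Fin K}

theorem pullCount_succ : pullCount y u (t + 1) k = pullCount y u t k +
    if k ∈ sel y u t then 1 else 0 := rfl

theorem pullCount_le_top : pullCount y u t k ≤ top y u t :=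
  Finset.le_sup (f := pullCount y u t) (Finset.mem_univ k)

theorem top_le {n : ℕ} (h : ∀ k, pullCount y u t k ≤ n) : top y u t ≤ n :=
  Finset.sup_le fun k _ => h k

theorem pullCount_lead : pullCount y u t (lead y u t) = top y u t := by
  refine le_antisymm pullCount_le_top (top_le fun k => ?_)
  have h := leader_mem (pullCount y u t) (fun k => psum y k (pullCount y u t k)) (u (t + 1))
  exact (mem_argmaxOn.1 (mem_argmaxOn.1 (mem_argmaxOn.1 h).1).1).2 k (Finset.mem_univ k)

theorem psum_le_lead (hk : pullCount y u t k = top y u t) :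
    psum y k (top y u t) ≤ psum y (lead y u t) (top y u t) := by
  have h := leader_mem (pullCount y u t) (fun k => psum y k (pullCount y u t k)) (u (t + 1))
  have h2 := (mem_argmaxOn.1 (mem_argmaxOn.1 h).1).2 k
    (mem_argmaxOn.2 ⟨Finset.mem_univ k, fun j _ => hk ▸ pullCount_le_top⟩)
  rw [← pullCount_lead]
  have h3 : pullCount y u t k = pullCount y u t (lead y u t) := by rw [hk, pullCount_lead]
  simp only [h3] at h2
  exact h2

theorem sel_zero : sel y u 0 = Finset.univ := by simp [sel, selection]

theorem mem_sel (ht : 1 ≤ t) : k ∈ sel y u t ↔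
    (k = lead y u t ∧ ∀ j, j ≠ lead y u t → ¬ Chal y u t j) ∨
      (k ≠ lead y u t ∧ Chal y u t k) := by
  classical
  have hmem : ∀ j, j ∈ challengers y (pullCount y u t) (t + 1) (lead y u t) ↔
      j ≠ lead y u t ∧ Chal y u t j := by
    intro j
    simp only [challengers, Finset.mem_filter, Finset.mem_univ, true_and, Chal]
  have hs : sel y u t = if challengers y (pullCount y u t) (t + 1) (lead y u t) = ∅
      then {lead y u t} else challengers y (pullCount y u t) (t + 1) (lead y u t) := by
    simp only [sel, selection, show ¬ (t + 1 = 1) by omega, if_false]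
    rfl
  rw [hs]
  split_ifs with h
  · have h' : ∀ j, ¬ (j ≠ lead y u t ∧ Chal y u t j) := by
      intro j hj
      have := (hmem j).2 hj
      rw [h] at this
      simp at this
    simp only [Finset.mem_singleton]
    constructor
    · rintro rfl
      exact Or.inl ⟨rfl, fun j hj hc => h' j ⟨hj, hc⟩⟩
    · rintro (⟨h1, -⟩ | h1)
      · exact h1
      · exact absurd h1 (h' k)
  · rw [hmem]
    constructor
    · exact Or.inr
    · rintro (⟨-, h1⟩ | h1)
      · obtain ⟨j, hj⟩ := Finset.nonempty_iff_ne_empty.2 h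
        exact absurd ((hmem j).1 hj).2 (h1 j ((hmem j).1 hj).1)
      · exact h1

theorem sel_nonempty : (sel y u t).Nonempty := by
  rcases Nat.eq_zero_or_pos t with rfl | ht
  · rw [sel_zero]; exact Finset.univ_nonempty
  · by_cases h : ∃ j, j ≠ lead y u t ∧ Chal y u t j
    · obtain ⟨j, hj⟩ := h
      exact ⟨j, (mem_sel ht).2 (Or.inr hj)⟩
    · push Not at h
      exact ⟨_, (mem_sel ht).2 (Or.inl ⟨rfl, h⟩)⟩

theorem pullCount_mono {t' : ℕ} (h : t ≤ t') : pullCount y u t k ≤ pullCount y u t' k := by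
  induction h with
  | refl => exact le_rfl
  | step _ ih => exact ih.trans (by rw [pullCount_succ]; exact Nat.le_add_right _ _)

theorem pullCount_succ_le : pullCount y u (t + 1) k ≤ pullCount y u t k + 1 := by
  rw [pullCount_succ]; split_ifs <;> omega

theorem pullCount_le : pullCount y u t k ≤ t := by
  induction t with
  | zero => exact le_rfl
  | succ t ih => exact pullCount_succ_le.trans (Nat.succ_le_succ ih)

theorem one_le_pullCount (ht : 1 ≤ t) : 1 ≤ pullCount y u t k := by
  refine le_trans ?_ (pullCount_mono ht)
  rw [pullCount_succ, sel_zero]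
  simp

theorem le_sum_pullCount : t ≤ ∑ k, pullCount y u t k := by
  induction t with
  | zero => exact Nat.zero_le _
  | succ t ih =>
    simp only [pullCount_succ, Finset.sum_add_distrib]
    have : 1 ≤ ∑ k, if k ∈ sel y u t then 1 else 0 := by
      rw [Finset.sum_boole]
      have := (sel_nonempty (y := y) (u := u) (t := t)).card_pos
      simpa using this
    omega

/-- Every round contains a pull, so time and level agree up to the factor `K`. This is what allows
the later arguments to be indexed by levels. -/
theorem le_mul_top : t ≤ K * top y u t :=
  le_sum_pullCount.trans <| by
    refine (Finset.sum_le_card_nsmul Finset.univ _ (top y u t) fun k _ => pullCount_le_top).trans ?_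
    simp

theorem top_le_self : top y u t ≤ t := top_le fun _ => pullCount_le

theorem top_mono {t' : ℕ} (h : t ≤ t') : top y u t ≤ top y u t' :=
  top_le fun _ => (pullCount_mono h).trans pullCount_le_top

theorem top_succ_le : top y u (t + 1) ≤ top y u t + 1 :=
  top_le fun _ => pullCount_succ_le.trans (Nat.succ_le_succ pullCount_le_top)

theorem one_le_of_one_le_top (h : 1 ≤ top y u t) : 1 ≤ t := h.trans top_le_self

/-- Every level is visited, and there is a last visit. -/
theorem exists_top_eq (y : Fin K → ℕ → ℝ) (u : ℕ → Fin K → ℝ) (m : ℕ) :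
    ∃ t, top y u t = m ∧ top y u (t + 1) = m + 1 := by
  have hex : ∃ t, m < top y u t := by
    refine ⟨K * m + 1, ?_⟩
    have h := le_mul_top (y := y) (u := u) (t := K * m + 1)
    by_contra hc
    have := Nat.mul_le_mul_left K (not_lt.1 hc)
    omega
  classical
  have h1 := Nat.find_spec hex
  have h0 : Nat.find hex ≠ 0 := by
    intro h
    rw [h] at h1
    have := top_le_self (y := y) (u := u) (t := 0)
    omega
  obtain ⟨t, ht⟩ := Nat.exists_eq_succ_of_ne_zero h0
  have h2 : ¬ m < top y u t := Nat.find_min hex (by omega)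
  have h3 := top_succ_le (y := y) (u := u) (t := t)
  rw [ht, Nat.succ_eq_add_one] at h1
  exact ⟨t, by omega, by omega⟩

omit [NeZero K] in
theorem blockMean_le_iff {ℓ k : Fin K} {n m : ℕ} (hn : 1 ≤ n) (hm : n ≤ m) :
    blockMean (y ℓ) (m - n) m ≤ blockMean (y k) 0 n ↔
      psum y ℓ m - psum y ℓ (m - n) ≤ psum y k n := by
  have h0 : (0 : ℝ) < n := by exact_mod_cast hn
  have h1 : m - (m - n) = n := by omega
  have h2 : ∑ i ∈ Finset.Ico (m - n) m, y ℓ i = psum y ℓ m - psum y ℓ (m - n) :=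
    Finset.sum_Ico_eq_sub _ (Nat.sub_le m n)
  have h3 : ∑ i ∈ Finset.Ico 0 n, y k i = psum y k n := by simp [psum]
  rw [blockMean, blockMean, h1, h2, h3, Nat.sub_zero, div_le_div_iff_of_pos_right h0]

theorem chal_iff (ht : 1 ≤ t) : Chal y u t k ↔
    (pullCount y u t k : ℝ) ≤ Real.sqrt (Real.log (t + 1 : ℕ)) ∨
      psum y (lead y u t) (top y u t) -
        psum y (lead y u t) (top y u t - pullCount y u t k) ≤ psum y k (pullCount y u t k) := by
  rw [Chal, pullCount_lead, blockMean_le_iff (one_le_pullCount ht) pullCount_le_top]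

/-- When the leadership changes, the new leader has at least the reward sum of the old one. -/
theorem psum_le_of_lead_ne (ht : 1 ≤ t)
    (hlog : Real.sqrt (Real.log (t + 1 : ℕ)) < top y u t) :
    psum y (lead y u t) (top y u t) ≤ psum y (lead y u (t + 1)) (top y u t) := by
  set i := lead y u t with hi
  set k := lead y u (t + 1) with hk
  by_cases hne : k = i
  · rw [hne]
  have hkt : pullCount y u (t + 1) k = top y u (t + 1) := pullCount_lead
  have hit : pullCount y u t i = top y u t := pullCount_lead
  have hmono := top_mono (y := y) (u := u) (Nat.le_add_right t 1)
  have hkle : pullCount y u t k ≤ top y u t := pullCount_le_top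
  have hile : pullCount y u (t + 1) i ≤ top y u (t + 1) := pullCount_le_top
  by_cases hks : k ∈ sel y u t
  · have hc : Chal y u t k := by
      rcases (mem_sel ht).1 hks with h | h
      · exact absurd h.1 hne
      · exact h.2
    have hk1 : pullCount y u (t + 1) k = pullCount y u t k + 1 := by rw [pullCount_succ]; simp [hks]
    have his : i ∉ sel y u t := by
      intro h
      rcases (mem_sel ht).1 h with h | h
      · exact h.2 k hne hc
      · exact h.1 rfl
    have hi1 : pullCount y u (t + 1) i = pullCount y u t i := by rw [pullCount_succ]; simp [his]
    rcases Nat.lt_or_ge (pullCount y u t k) (top y u t) with h | h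
    · have he : top y u (t + 1) = top y u t := by omega
      rw [← he]
      exact psum_le_lead (by omega)
    -- The challenger already has as many pulls as the leader. Its pull is not forced by `hlog`, and
    -- the duel compares the two complete samples.
    · have he : pullCount y u t k = top y u t := by omega
      rcases (chal_iff ht).1 hc with h' | h'
      · rw [he] at h'
        exact absurd h' (not_le.2 hlog)
      · rw [he] at h'
        simpa [psum] using h'
  · have hk1 : pullCount y u (t + 1) k = pullCount y u t k := by rw [pullCount_succ]; simp [hks]
    have he : top y u (t + 1) = top y u t := by omega
    have : pullCount y u (t + 1) i = top y u (t + 1) := by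
      have := pullCount_mono (y := y) (u := u) (k := i) (Nat.le_add_right t 1)
      omega
    rw [← he]
    exact psum_le_lead this

/-- As long as the leader is not pulled, its number of pulls grows at rate at most `1 - 1/K`. -/
theorem mul_top_succ_le (h : lead y u t ∉ sel y u t) :
    K * top y u (t + 1) + (Finset.univ.filter
        fun k => pullCount y u (t + 1) k = top y u (t + 1)).card + 1 ≤
      K + K * top y u t +
        (Finset.univ.filter fun k => pullCount y u t k = top y u t).card := by
  have hpos : 1 ≤ (Finset.univ.filter fun k => pullCount y u t k = top y u t).card :=
    Finset.card_pos.2 ⟨lead y u t, Finset.mem_filter.2 ⟨Finset.mem_univ _, pullCount_lead⟩⟩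
  have hle : (Finset.univ.filter
      fun k => pullCount y u (t + 1) k = top y u (t + 1)).card ≤ K := by
    refine (Finset.card_le_univ _).trans ?_
    simp
  have hmono := top_mono (y := y) (u := u) (Nat.le_add_right t 1)
  have hsucc := top_succ_le (y := y) (u := u) (t := t)
  rcases Nat.lt_or_ge (top y u t) (top y u (t + 1)) with h1 | h1
  · have h2 : top y u (t + 1) = top y u t + 1 := by omega
    -- Arms at the new top were at the old top and have been pulled; the old leader is not among
    -- them. The drop in their number compensates for one of the `K` units gained by the first term.
    have hlt : (Finset.univ.filter
        fun k => pullCount y u (t + 1) k = top y u (t + 1)).card <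
        (Finset.univ.filter fun k => pullCount y u t k = top y u t).card := by
      refine Finset.card_lt_card ⟨?_, ?_⟩
      · intro k hk
        simp only [Finset.mem_filter, Finset.mem_univ, true_and] at hk ⊢
        have a := pullCount_succ_le (y := y) (u := u) (t := t) (k := k)
        have b := pullCount_le_top (y := y) (u := u) (t := t) (k := k)
        omega
      · intro hsub
        have hmem := hsub (Finset.mem_filter.2
          ⟨Finset.mem_univ (lead y u t), pullCount_lead⟩)
        simp only [Finset.mem_filter, Finset.mem_univ, true_and] at hmem
        rw [pullCount_succ, if_neg h, pullCount_lead] at hmem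
        omega
    have h3 : K * top y u (t + 1) = K * top y u t + K := by rw [h2, Nat.mul_add, mul_one]
    omega
  · have h2 : top y u (t + 1) = top y u t := by
      omega
    have h3 : K * top y u (t + 1) = K * top y u t := by rw [h2]
    omega

/-- In round `t + 1`, the arm `s` stays at `j` pulls, the leader belongs to `𝒦`, and no pull is
forced. -/
def CleanAt (y : Fin K → ℕ → ℝ) (u : ℕ → Fin K → ℝ) (s : Fin K) (j : ℕ)
    (𝒦 : Finset (Fin K)) (t : ℕ) : Prop :=
  pullCount y u t s = j ∧ s ∉ sel y u t ∧ lead y u t ∈ 𝒦 ∧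
    ∀ k, k ≠ lead y u t → Real.sqrt (Real.log (t + 1 : ℕ)) < pullCount y u t k

/-- The rounds in which the leader has at least `lo` and less than `hi` pulls are clean. -/
def Clean (y : Fin K → ℕ → ℝ) (u : ℕ → Fin K → ℝ) (s : Fin K) (j : ℕ)
    (𝒦 : Finset (Fin K)) (lo hi : ℕ) : Prop :=
  ∀ t, lo ≤ top y u t → top y u t < hi → CleanAt y u s j 𝒦 t

theorem Clean.mono {s : Fin K} {j lo hi hi' : ℕ} {𝒦 : Finset (Fin K)}
    (h : Clean y u s j 𝒦 lo hi) (hh : hi' ≤ hi) : Clean y u s j 𝒦 lo hi' :=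
  fun t h1 h2 => h t h1 (h2.trans_le hh)

/-- A leader that has just beaten all its challengers stays in the lead while its own future
rewards dominate those of its rivals; so the arm `s` must lose against its last rewards. -/
theorem psum_lt_of_clean {s : Fin K} {j lo m ℓ : ℕ} {𝒦 : Finset (Fin K)} {d : ℝ}
    (hs : s ∉ 𝒦) (hlo : 1 ≤ lo) (hm : lo ≤ m) (hℓ : 1 ≤ ℓ)
    (hclean : Clean y u s j 𝒦 lo (m + ℓ + 1)) {t₀ : ℕ} (ht₀ : top y u t₀ = m)
    (hno : ∀ k, k ≠ lead y u t₀ → ¬ Chal y u t₀ k)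
    (hb : ∀ b ∈ 𝒦, b ≠ lead y u t₀ → ∀ i ≤ ℓ,
      psum y b (pullCount y u t₀ b + i) - psum y b (pullCount y u t₀ b) ≤ d * i)
    (ha : ∀ i ≤ ℓ, d * i ≤ psum y (lead y u t₀) (m + i) - psum y (lead y u t₀) m) :
    psum y s j < psum y (lead y u t₀) (m + ℓ) - psum y (lead y u t₀) (m + ℓ - j) := by
  set a := lead y u t₀ with ha'
  have ht₀1 : 1 ≤ t₀ := one_le_of_one_le_top (y := y) (u := u) (by omega)
  -- A rival that lost its duel at `t₀` and then receives `i` further rewards is compared with the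
  -- leader's last `pullCount y u t₀ b + i` rewards at level `m + i`. This block is the old one
  -- extended by `i` new rewards, which dominate those of the rival.
  have hcmp : ∀ b ∈ 𝒦, b ≠ a → ∀ i ≤ ℓ, psum y b (pullCount y u t₀ b + i) <
      psum y a (m + i) - psum y a (m - pullCount y u t₀ b) := by
    intro b hbK hba i hi
    have h1 := hno b hba
    rw [chal_iff ht₀1, not_or, ht₀] at h1
    have h2 := hb b hbK hba i hi
    have h3 := ha i hi
    have h4 := not_le.1 h1.2
    linarith
  have hb0 : ∀ b, pullCount y u t₀ b ≤ m := fun b => ht₀ ▸ pullCount_le_top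
  -- Invariant: `a` leads, and no rival has received more new pulls than `a` since `t₀`. A rival
  -- with equally many new pulls loses its duel by `hcmp` and cannot overtake. The induction starts
  -- at `t₀ + 1` because the pull at `t₀` makes `a` the unique arm at the top.
  have claim : ∀ t, t₀ + 1 ≤ t → top y u t ≤ m + ℓ → m + 1 ≤ top y u t ∧
      lead y u t = a ∧ ∀ b ∈ 𝒦, b ≠ a → m + pullCount y u t b ≤
        top y u t + pullCount y u t₀ b := by
    intro t ht
    induction t, ht using Nat.le_induction with
    | base =>
      intro _
      have hsel : ∀ k, k ∈ sel y u t₀ ↔ k = a := by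
        intro k
        rw [mem_sel ht₀1]
        constructor
        · rintro (h | h)
          · exact h.1
          · exact absurd h.2 (hno k h.1)
        · intro h
          exact Or.inl ⟨h, hno⟩
      have hca : pullCount y u (t₀ + 1) a = m + 1 := by
        rw [pullCount_succ, if_pos ((hsel a).2 rfl), ha', pullCount_lead, ht₀]
      have hck : ∀ k, k ≠ a → pullCount y u (t₀ + 1) k = pullCount y u t₀ k := by
        intro k hk
        rw [pullCount_succ, if_neg (fun h => hk ((hsel k).1 h)), add_zero]
      have htop : top y u (t₀ + 1) = m + 1 := by
        refine le_antisymm (ht₀ ▸ top_succ_le) (hca ▸ pullCount_le_top)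
      refine ⟨htop.ge, ?_, ?_⟩
      · by_contra hne
        have h1 : pullCount y u (t₀ + 1) (lead y u (t₀ + 1)) = top y u (t₀ + 1) := pullCount_lead
        rw [hck _ hne, htop] at h1
        have := hb0 (lead y u (t₀ + 1))
        omega
      · intro b _ hba
        rw [hck b hba, htop]
        omega
    | succ t ht ih =>
      intro htop
      have hmono := top_mono (y := y) (u := u) (Nat.le_add_right t 1)
      obtain ⟨ih1, ih2, ih3⟩ := ih (by omega)
      have ht1 : 1 ≤ t := by omega
      have hcl := hclean t (by omega) (by omega)
      have hcl' := hclean (t + 1) (by omega) (by omega)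
      have hat : pullCount y u t a = top y u t := ih2 ▸ pullCount_lead
      have hnot : ∀ b ∈ 𝒦, b ≠ a → m + pullCount y u t b = top y u t + pullCount y u t₀ b →
          b ∉ sel y u t := by
        intro b hbK hba heq hmem
        have hc : Chal y u t b := by
          rcases (mem_sel ht1).1 hmem with h | h
          · exact absurd (h.1.trans ih2) hba
          · exact h.2
        rcases (chal_iff ht1).1 hc with h | h
        · exact absurd h (not_le.2 (hcl.2.2.2 b (by rw [ih2]; exact hba)))
        · obtain ⟨i, hi⟩ := Nat.exists_eq_add_of_le (show m ≤ top y u t by omega)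
          have hbi : pullCount y u t b = pullCount y u t₀ b + i := by omega
          have := hcmp b hbK hba i (by omega)
          have hb0' := hb0 b
          rw [ih2, hi, hbi, show m + i - (pullCount y u t₀ b + i) = m - pullCount y u t₀ b by omega]
            at h
          linarith
      by_cases has : a ∈ sel y u t
      · have hoth : ∀ k, k ≠ a → pullCount y u (t + 1) k = pullCount y u t k := by
          intro k hk
          rw [pullCount_succ, if_neg, add_zero]
          intro h
          rcases (mem_sel ht1).1 has with h' | h'
          · rcases (mem_sel ht1).1 h with h'' | h''
            · exact hk (h''.1.trans ih2)
            · exact h'.2 k h''.1 h''.2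
          · exact h'.1 ih2.symm
        have hca : pullCount y u (t + 1) a = top y u t + 1 := by
          rw [pullCount_succ, if_pos has, hat]
        have htop' : top y u (t + 1) = top y u t + 1 :=
          le_antisymm top_succ_le (hca ▸ pullCount_le_top)
        refine ⟨by omega, ?_, ?_⟩
        · by_contra hne
          have h1 : pullCount y u (t + 1) (lead y u (t + 1)) = top y u (t + 1) := pullCount_lead
          rw [hoth _ hne] at h1
          have := pullCount_le_top (y := y) (u := u) (t := t) (k := lead y u (t + 1))
          omega
        · intro b hbK hba
          have := ih3 b hbK hba
          rw [hoth b hba]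
          omega
      · have hca : pullCount y u (t + 1) a = top y u t := by
          rw [pullCount_succ, if_neg has, hat, add_zero]
        have hlag : ∀ b ∈ 𝒦, b ≠ a →
            m + pullCount y u (t + 1) b ≤ top y u t + pullCount y u t₀ b := by
          intro b hbK hba
          have h1 := ih3 b hbK hba
          by_cases hbs : b ∈ sel y u t
          · have h2 : m + pullCount y u t b ≠ top y u t + pullCount y u t₀ b :=
              fun h => hnot b hbK hba h hbs
            rw [pullCount_succ, if_pos hbs]
            omega
          · rw [pullCount_succ, if_neg hbs]
            omega
        refine ⟨by omega, ?_, fun b hbK hba => (hlag b hbK hba).trans (by omega)⟩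
        by_contra hne
        set b := lead y u (t + 1) with hbdef
        have hbK : b ∈ 𝒦 := hcl'.2.2.1
        have h1 : pullCount y u (t + 1) b = top y u (t + 1) := pullCount_lead
        have h2 := hlag b hbK hne
        have h3 := hb0 b
        have h4 : pullCount y u t₀ b = m := by omega
        have h5 : top y u (t + 1) = top y u t := by omega
        have h6 := psum_le_lead (y := y) (u := u) (t := t + 1) (k := a) (by omega)
        obtain ⟨i, hi⟩ := Nat.exists_eq_add_of_le (show m ≤ top y u t by omega)
        have h7 := hcmp b hbK hne i (by omega)
        rw [← hbdef, h5, hi] at h6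
        rw [h4, Nat.sub_self] at h7
        simp only [psum, Finset.range_zero, Finset.sum_empty] at h6 h7
        linarith
  -- At level `m + ℓ` the leader is still `a`. As the level is clean, `s` is not pulled there, so it
  -- must lose the duel with the last `j` rewards of `a`.
  obtain ⟨t, ht, -⟩ := exists_top_eq y u (m + ℓ)
  have htt : t₀ + 1 ≤ t := by
    by_contra hc
    have := top_mono (y := y) (u := u) (show t ≤ t₀ by omega)
    omega
  obtain ⟨-, hla, -⟩ := claim t htt ht.le
  obtain ⟨c1, c2, c3, c4⟩ := hclean t (by omega) (by omega)
  have ht1 : 1 ≤ t := by omega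
  have hsl : s ≠ lead y u t := fun h => hs (h ▸ c3)
  by_contra hcon
  refine c2 ((mem_sel ht1).2 (Or.inr ⟨hsl, (chal_iff ht1).2 (Or.inr ?_)⟩))
  rw [hla, ht, c1]
  exact not_lt.1 hcon

/-- A clean level at which the reward sums of the arms of `𝒦` are distinct is left by a pull of
the leader. -/
theorem exists_no_chal {s : Fin K} {j lo m : ℕ} {𝒦 : Finset (Fin K)} (hlo : 1 ≤ lo)
    (hm : lo ≤ m) (hclean : Clean y u s j 𝒦 lo (m + 2))
    (hne : ∀ a ∈ 𝒦, ∀ b ∈ 𝒦, a ≠ b → psum y a m ≠ psum y b m) :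
    ∃ t, top y u t = m ∧ ∀ k, k ≠ lead y u t → ¬ Chal y u t k := by
  obtain ⟨t, ht, ht'⟩ := exists_top_eq y u m
  have ht1 : 1 ≤ t := one_le_of_one_le_top (y := y) (u := u) (by omega)
  refine ⟨t, ht, fun k hk hc => ?_⟩
  have hls : lead y u t ∉ sel y u t := by
    intro h
    rcases (mem_sel ht1).1 h with h | h
    · exact h.2 k hk hc
    · exact h.1 rfl
  obtain ⟨-, -, c3, c4⟩ := hclean t (by omega) (by omega)
  obtain ⟨-, -, d3, -⟩ := hclean (t + 1) (by omega) (by omega)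
  -- If some arm challenged, the level would be left by a challenger `b` that already has `m` pulls.
  -- Its duel gives it at least the sum of the leader, while the choice of the leader gives the
  -- reverse inequality: a tie.
  set b := lead y u (t + 1)
  have hbt : pullCount y u (t + 1) b = m + 1 := by rw [pullCount_lead, ht']
  have hble : pullCount y u t b ≤ m := ht ▸ pullCount_le_top
  have hbs : b ∈ sel y u t := by
    by_contra h
    rw [pullCount_succ, if_neg h] at hbt
    omega
  have hbm : pullCount y u t b = m := by
    rw [pullCount_succ, if_pos hbs] at hbt
    omega
  have hba : b ≠ lead y u t := fun h => hls (h ▸ hbs)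
  have hcb : Chal y u t b := by
    rcases (mem_sel ht1).1 hbs with h | h
    · exact absurd h.1 hba
    · exact h.2
  have h1 := psum_le_lead (y := y) (u := u) (t := t) (k := b) (by omega)
  rcases (chal_iff ht1).1 hcb with h | h
  · exact absurd h (not_le.2 (c4 b hba))
  · rw [hbm, ht] at h
    rw [ht] at h1
    refine hne _ c3 _ d3 (Ne.symm hba) (le_antisymm ?_ h1)
    simpa [psum] using h

end Dynamics

/-! ### The past depends only on rewards already collected -/

section Locality

variable {K : ℕ} [NeZero K] {y y' : Fin K → ℕ → ℝ} {u : ℕ → Fin K → ℝ} {t : ℕ}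

omit [NeZero K] in
theorem psum_congr {k : Fin K} {n : ℕ} (h : ∀ i < n, y k i = y' k i) : psum y k n = psum y' k n :=
  Finset.sum_congr rfl fun i hi => h i (Finset.mem_range.1 hi)

omit [NeZero K] in
theorem blockMean_congr {k : Fin K} {n m : ℕ} (h : ∀ i < m, y k i = y' k i) :
    blockMean (y k) n m = blockMean (y' k) n m := by
  unfold blockMean
  rw [Finset.sum_congr rfl fun i hi => h i (Finset.mem_Ico.1 hi).2]

theorem selection_congr {N : Fin K → ℕ} (h : ∀ k, ∀ i < N k, y k i = y' k i) (v : Fin K → ℝ)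
    (r : ℕ) : selection y N v r = selection y' N v r := by
  have h1 : (fun k => ∑ i ∈ Finset.range (N k), y k i) =
      fun k => ∑ i ∈ Finset.range (N k), y' k i := funext fun k => psum_congr (h k)
  have h2 : ∀ ℓ, challengers y N r ℓ = challengers y' N r ℓ := by
    intro ℓ
    ext k
    simp only [challengers, Finset.mem_filter, Finset.mem_univ, true_and]
    rw [blockMean_congr (h ℓ), blockMean_congr (h k)]
  simp only [selection, h1, h2]

/-- A run up to round `t` reads no reward beyond its own pull counts. Events that fix these counts
are therefore independent of the later rewards of every arm, as if at a stopping time. -/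
theorem pullCount_congr (h : ∀ k, ∀ i < pullCount y u t k, y k i = y' k i) {t' : ℕ}
    (ht : t' ≤ t) : pullCount y' u t' = pullCount y u t' := by
  induction t' with
  | zero => rfl
  | succ n ih =>
    have ih := ih (by omega)
    funext k
    rw [pullCount_succ, pullCount_succ, sel, sel, ih, selection_congr fun k i hi =>
      h k i (lt_of_lt_of_le hi (pullCount_mono (by omega)))]

theorem top_congr (h : ∀ k, ∀ i < pullCount y u t k, y k i = y' k i) {t' : ℕ} (ht : t' ≤ t) :
    top y' u t' = top y u t' := by rw [top, top, pullCount_congr h ht]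

theorem lead_congr (h : ∀ k, ∀ i < pullCount y u t k, y k i = y' k i) {t' : ℕ} (ht : t' ≤ t) :
    lead y' u t' = lead y u t' := by
  rw [lead, lead, pullCount_congr h ht]
  congr 1
  funext k
  exact (psum_congr fun i hi => h k i (lt_of_lt_of_le hi (pullCount_mono ht))).symm

theorem sel_congr (h : ∀ k, ∀ i < pullCount y u t k, y k i = y' k i) {t' : ℕ} (ht : t' ≤ t) :
    sel y' u t' = sel y u t' := by
  rw [sel, sel, pullCount_congr h ht]
  exact (selection_congr (fun k i hi =>
    h k i (lt_of_lt_of_le hi (pullCount_mono ht))) _ _).symm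

theorem chal_congr (h : ∀ k, ∀ i < pullCount y u t k, y k i = y' k i) {t' : ℕ} (ht : t' ≤ t)
    {k : Fin K} : Chal y' u t' k ↔ Chal y u t' k := by
  have h' : ∀ k, ∀ i < pullCount y u t' k, y k i = y' k i := fun k i hi =>
    h k i (lt_of_lt_of_le hi (pullCount_mono ht))
  rw [Chal, Chal, pullCount_congr h ht, lead_congr h ht, blockMean_congr (h' k),
    blockMean_congr (h' _)]

theorem cleanAt_congr (h : ∀ k, ∀ i < pullCount y u t k, y k i = y' k i) {t' : ℕ} (ht : t' ≤ t)
    {s : Fin K} {j : ℕ} {𝒦 : Finset (Fin K)} : CleanAt y' u s j 𝒦 t' ↔ CleanAt y u s j 𝒦 t' := by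
  rw [CleanAt, CleanAt, pullCount_congr h ht, lead_congr h ht, sel_congr h ht]

theorem local_clean (s : Fin K) (j : ℕ) (𝒦 : Finset (Fin K)) (lo m : ℕ) :
    Local {p : Fin K × ℕ | p.2 < m} {e : Env K | Clean e.1 e.2 s j 𝒦 lo m} := by
  intro y y' u hy h t h1 h2
  have hloc : ∀ k, ∀ i < pullCount y' u t k, y' k i = y k i := fun k i hi =>
    (hy (k, i) (lt_of_lt_of_le hi (pullCount_le_top.trans h2.le))).symm
  rw [← top_congr hloc le_rfl] at h1 h2
  exact (cleanAt_congr hloc le_rfl).1 (h t h1 h2)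

/-- The trajectory up to round `t` is clean on the levels from `lo` on, and ends with pull counts
`N` and with leader `a` facing no challenger. -/
def Regular (s : Fin K) (j : ℕ) (𝒦 : Finset (Fin K)) (lo t : ℕ) (N : Fin K → ℕ) (a : Fin K) :
    Set (Env K) :=
  {e | pullCount e.1 e.2 t = N ∧ lead e.1 e.2 t = a ∧ (∀ k, k ≠ a → ¬ Chal e.1 e.2 t k) ∧
    ∀ t' ≤ t, lo ≤ top e.1 e.2 t' → CleanAt e.1 e.2 s j 𝒦 t'}

theorem local_regular (s : Fin K) (j : ℕ) (𝒦 : Finset (Fin K)) (lo t : ℕ) (N : Fin K → ℕ)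
    (a : Fin K) : Local {p : Fin K × ℕ | p.2 < N p.1} (Regular s j 𝒦 lo t N a) := by
  rintro y y' u hy ⟨h1, h2, h3, h4⟩
  have hloc : ∀ k, ∀ i < pullCount y u t k, y k i = y' k i := fun k i hi =>
    hy (k, i) (by simp only [h1] at hi; exact hi)
  refine ⟨(pullCount_congr hloc le_rfl).trans h1, (lead_congr hloc le_rfl).trans h2,
    fun k hk => (chal_congr hloc le_rfl).not.2 (h3 k hk), fun t' ht' h => ?_⟩
  rw [show top (y', u).1 (y', u).2 t' = top y u t' from top_congr hloc ht'] at h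
  exact (cleanAt_congr hloc ht').2 (h4 t' ht' h)

end Locality

/-! ### Measurability of the trajectory -/

section Measurability

variable {K : ℕ} [NeZero K] {Ω : Type*} [MeasurableSpace Ω]

/-- Pull counts and leaders take countably many values. Splitting over these values lets each
predicate be studied with the counts frozen. -/
theorem measurable_of_countable_param {β : Type*} [MeasurableSpace β] [Countable β]
    [MeasurableSingletonClass β] {f : Ω → β} (hf : Measurable f) {p : β → Ω → Prop}
    (hp : ∀ b, Measurable (p b)) : Measurable fun e => p (f e) e := by
  have : (fun e => p (f e) e) = fun e => ∃ b, f e = b ∧ p b e := by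
    funext e
    simp
  rw [this]
  refine Measurable.exists fun b => Measurable.and ?_ (hp b)
  exact measurableSet_setOfPred.1 (hf (measurableSet_singleton b))

theorem measurable_mem_argmaxOn {ι : Type*} [Countable ι] {s : Ω → Finset ι} {f : Ω → ι → ℝ}
    (hs : ∀ i, Measurable fun e => i ∈ s e) (hf : ∀ i, Measurable fun e => f e i) (i : ι) :
    Measurable fun e => i ∈ argmaxOn (s e) (f e) := by
  simp only [mem_argmaxOn]
  refine (hs i).and (Measurable.forall fun j => (hs j).imp ?_)
  exact measurableSet_setOfPred.1 (measurableSet_le (hf j) (hf i))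

omit [NeZero K] in
theorem measurable_reward_apply (k : Fin K) (i : ℕ) : Measurable fun e : Env K => e.1 k i :=
  (measurable_pi_apply i).comp ((measurable_pi_apply k).comp measurable_fst)

omit [NeZero K] in
theorem measurable_mark_apply (r : ℕ) (k : Fin K) : Measurable fun e : Env K => e.2 r k :=
  (measurable_pi_apply k).comp ((measurable_pi_apply r).comp measurable_snd)

omit [NeZero K] in
theorem measurable_psum (k : Fin K) (n : ℕ) : Measurable fun e : Env K => psum e.1 k n :=
  Finset.measurable_sum _ fun i _ => measurable_reward_apply k i

omit [NeZero K] in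
theorem measurable_blockMean (k : Fin K) (n m : ℕ) :
    Measurable fun e : Env K => blockMean (e.1 k) n m :=
  (Finset.measurable_sum _ fun i _ => measurable_reward_apply k i).div_const _

theorem leader_eq_iff {N : Fin K → ℕ} {S v : Fin K → ℝ} {a : Fin K} : leader N S v = a ↔
    a ∈ argmaxOn (argmaxOn (argmaxOn Finset.univ N) S) v ∧
      ∀ b, b ∈ argmaxOn (argmaxOn (argmaxOn Finset.univ N) S) v → a ≤ b := by
  constructor
  · rintro rfl
    exact ⟨leader_mem N S v, fun b hb => Finset.min'_le _ _ hb⟩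
  · rintro ⟨h1, h2⟩
    exact le_antisymm (Finset.min'_le _ _ h1) (h2 _ (leader_mem N S v))

theorem measurable_leader (N : Fin K → ℕ) (r : ℕ) (a : Fin K) : Measurable fun e : Env K =>
    leader N (fun k => psum e.1 k (N k)) (e.2 r) = a := by
  have h : ∀ b, Measurable fun e : Env K =>
      b ∈ argmaxOn (argmaxOn (argmaxOn Finset.univ N) fun k => psum e.1 k (N k)) (e.2 r) :=
    measurable_mem_argmaxOn (measurable_mem_argmaxOn (fun _ => measurable_const)
      fun k => measurable_psum k (N k)) fun k => measurable_mark_apply r k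
  simp only [leader_eq_iff]
  exact (h a).and (Measurable.forall fun b => (h b).imp measurable_const)

omit [NeZero K] in
theorem measurable_duel (N : Fin K → ℕ) (r : ℕ) (k ℓ : Fin K) : Measurable fun e : Env K =>
    ((N k : ℝ) ≤ Real.sqrt (Real.log r) ∨
      blockMean (e.1 ℓ) (N ℓ - N k) (N ℓ) ≤ blockMean (e.1 k) 0 (N k)) :=
  measurable_const.or (measurableSet_setOfPred.1
    (measurableSet_le (measurable_blockMean _ _ _) (measurable_blockMean _ _ _)))

omit [NeZero K] in
theorem measurable_challengers (N : Fin K → ℕ) (r : ℕ) (k ℓ : Fin K) :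
    Measurable fun e : Env K => k ∈ challengers e.1 N r ℓ := by
  simp only [challengers, Finset.mem_filter, Finset.mem_univ, true_and]
  exact measurable_const.and (measurable_duel N r k ℓ)

theorem measurable_selection (N : Fin K → ℕ) (r r' : ℕ) (k : Fin K) :
    Measurable fun e : Env K => k ∈ selection e.1 N (e.2 r') r := by
  by_cases hr : r = 1
  · simp [selection, hr]
  · have h : ∀ e : Env K, k ∈ selection e.1 N (e.2 r') r ↔ ∃ ℓ,
        leader N (fun k => psum e.1 k (N k)) (e.2 r') = ℓ ∧
          (((∀ j, j ∉ challengers e.1 N r ℓ) ∧ k = ℓ) ∨ k ∈ challengers e.1 N r ℓ) := by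
      intro e
      have h0 : ∀ ℓ, (k ∈ if challengers e.1 N r ℓ = ∅ then {ℓ} else challengers e.1 N r ℓ) ↔
          (((∀ j, j ∉ challengers e.1 N r ℓ) ∧ k = ℓ) ∨ k ∈ challengers e.1 N r ℓ) := by
        intro ℓ
        split_ifs with h
        · simp [h]
        · have : ¬ ∀ j, j ∉ challengers e.1 N r ℓ := fun h' =>
            h (Finset.eq_empty_of_forall_notMem h')
          simp [this]
      rw [exists_eq_left', ← h0]
      simp only [selection, hr, if_false]
      rfl
    simp only [h]
    refine Measurable.exists fun ℓ => (measurable_leader N r' ℓ).and (Measurable.or ?_ ?_)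
    · exact (Measurable.forall fun j => (measurable_challengers N r j ℓ).not).and
        measurable_const
    · exact measurable_challengers N r k ℓ

theorem measurable_pullCount (t : ℕ) : Measurable fun e : Env K => pullCount e.1 e.2 t := by
  induction t with
  | zero => exact measurable_const
  | succ t ih =>
    refine measurable_pi_iff.2 fun k => ?_
    have hs : Measurable fun e : Env K =>
        k ∈ selection e.1 (pullCount e.1 e.2 t) (e.2 (t + 1)) (t + 1) :=
      measurable_of_countable_param ih (p := fun N e => k ∈ selection e.1 N (e.2 (t + 1)) (t + 1))
        fun N => measurable_selection N _ _ k
    exact ((measurable_pi_apply k).comp ih).add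
      (Measurable.ite (measurableSet_setOfPred.2 hs) measurable_const measurable_const)

theorem measurable_sel (t : ℕ) (k : Fin K) : Measurable fun e : Env K => k ∈ sel e.1 e.2 t :=
  measurable_of_countable_param (measurable_pullCount t)
    (p := fun N e => k ∈ selection e.1 N (e.2 (t + 1)) (t + 1))
    fun N => measurable_selection N _ _ k

theorem measurable_lead_eq (t : ℕ) (a : Fin K) :
    Measurable fun e : Env K => lead e.1 e.2 t = a :=
  measurable_of_countable_param (measurable_pullCount t)
    (p := fun N e => leader N (fun k => psum e.1 k (N k)) (e.2 (t + 1)) = a)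
    fun N => measurable_leader N _ a

theorem measurable_lead (t : ℕ) : Measurable fun e : Env K => lead e.1 e.2 t :=
  measurable_to_countable' fun a => measurableSet_setOfPred.2 (measurable_lead_eq t a)

theorem measurable_top (t : ℕ) : Measurable fun e : Env K => top e.1 e.2 t :=
  (measurable_of_countable fun N : Fin K → ℕ => Finset.univ.sup N).comp (measurable_pullCount t)

theorem measurable_chal (t : ℕ) (k : Fin K) : Measurable fun e : Env K => Chal e.1 e.2 t k :=
  measurable_of_countable_param ((measurable_pullCount t).prodMk (measurable_lead t))
    (p := fun q e => (q.1 k : ℝ) ≤ Real.sqrt (Real.log (t + 1 : ℕ)) ∨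
      blockMean (e.1 q.2) (q.1 q.2 - q.1 k) (q.1 q.2) ≤ blockMean (e.1 k) 0 (q.1 k))
    fun q => measurable_duel q.1 _ k q.2

theorem measurable_pred {β : Type*} [MeasurableSpace β] [DiscreteMeasurableSpace β] {f : Ω → β}
    (hf : Measurable f) (p : β → Prop) : Measurable fun e => p (f e) :=
  (Measurable.of_discrete (f := p)).comp hf

theorem measurable_cleanAt (s : Fin K) (j : ℕ) (𝒦 : Finset (Fin K)) (t : ℕ) :
    Measurable fun e : Env K => CleanAt e.1 e.2 s j 𝒦 t := by
  refine Measurable.and ?_ (Measurable.and (measurable_sel t s).not (Measurable.and ?_ ?_))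
  · exact measurable_pred (measurable_pullCount t) fun N => N s = j
  · exact measurable_pred (measurable_lead t) fun a => a ∈ 𝒦
  · exact measurable_pred ((measurable_pullCount t).prodMk (measurable_lead t))
      fun q => ∀ k, k ≠ q.2 → Real.sqrt (Real.log (t + 1 : ℕ)) < q.1 k

theorem measurableSet_clean (s : Fin K) (j : ℕ) (𝒦 : Finset (Fin K)) (lo hi : ℕ) :
    MeasurableSet {e : Env K | Clean e.1 e.2 s j 𝒦 lo hi} := by
  refine measurableSet_setOfPred.2 (Measurable.forall fun t => Measurable.imp ?_ (Measurable.imp ?_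
    (measurable_cleanAt s j 𝒦 t)))
  · exact measurable_pred (measurable_top t) fun n => lo ≤ n
  · exact measurable_pred (measurable_top t) fun n => n < hi

theorem measurableSet_regular (s : Fin K) (j : ℕ) (𝒦 : Finset (Fin K)) (lo t : ℕ) (N : Fin K → ℕ)
    (a : Fin K) : MeasurableSet (Regular s j 𝒦 lo t N a) := by
  refine measurableSet_setOfPred.2 (Measurable.and ?_ (Measurable.and (measurable_lead_eq t a)
    (Measurable.and ?_ ?_)))
  · exact measurable_pred (measurable_pullCount t) fun M => M = N
  · exact Measurable.forall fun k => measurable_const.imp (measurable_chal t k).not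
  · exact Measurable.forall fun t' => measurable_const.imp
      ((measurable_pred (measurable_top t') fun n => lo ≤ n).imp (measurable_cleanAt s j 𝒦 t'))

end Measurability

section Windows

variable {K : ℕ} {Ω : Type u} [MeasurableSpace Ω] {P : Measure Ω}
    {ν : Fin K → Measure ℝ} {Y : Fin K → ℕ → Ω → ℝ} {U : ℕ → Fin K → Ω → ℝ}

/-- The arms are added one at a time: the past event and the windows of the arms already treated use
no reward of the new arm `a` from index `N a` on. -/
theorem measure_inter_windows (hB : IsBandit P ν Y U) {N : Fin K → ℕ} {A : Set (Env K)}
    (hA : MeasurableSet A) (hI : Local {p | p.2 < N p.1} A) {T : Fin K → Set (ℕ → ℝ)}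
    (hT : ∀ k, MeasurableSet (T k)) (𝒦 : Finset (Fin K)) :
    P.real {ω | env Y U ω ∈ A ∧ ∀ k ∈ 𝒦, window k (N k) (env Y U ω) ∈ T k} =
      P.real {ω | env Y U ω ∈ A} * ∏ k ∈ 𝒦, (seqLaw (ν k)).real (T k) := by
  induction 𝒦 using Finset.induction_on with
  | empty => simp
  | insert a 𝒦 ha ih =>
    rw [Finset.prod_insert ha, mul_comm ((seqLaw (ν a)).real (T a)), ← mul_assoc, ← ih]
    have hm : MeasurableSet (A ∩ {e | ∀ k ∈ 𝒦, window k (N k) e ∈ T k}) := by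
      refine hA.inter (measurableSet_setOfPred.2 (Measurable.forall fun k =>
        measurable_const.imp (measurableSet_setOfPred.1 (measurable_window k (N k) (hT k)))))
    have hl : Local {p | p.2 < N p.1 ∨ p.1 ∈ 𝒦} (A ∩ {e | ∀ k ∈ 𝒦, window k (N k) e ∈ T k}) := by
      refine Local.inter (hI.mono fun p hp => Or.inl hp) ?_
      intro y y' u hy h k hk
      have : window k (N k) (y, u) = window k (N k) (y', u) := funext fun i =>
        hy (k, N k + i) (Or.inr hk)
      exact this ▸ h k hk
    refine Eq.trans ?_ (measure_inter_window hB hm hl (k := a) (n := N a) ?_ (hT a))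
    · congr 1
      ext ω
      simp only [Set.mem_ofPred_eq, Finset.forall_mem_insert, Set.mem_inter_iff]
      tauto
    · rintro i hi (h | h)
      · exact absurd h (not_lt.2 hi)
      · exact ha h

end Windows

/-! ### Random walks and exponential change of measure -/

/-- The random walk with steps `x i - d`. -/
def walk (d : ℝ) (x : ℕ → ℝ) (n : ℕ) : ℝ := ∑ i ∈ Finset.range n, (x i - d)

/-- The exponential moment of `X - d` at `s`, for `X` with law `ν`. -/
def expMom (ν : Measure ℝ) (d s : ℝ) : ℝ := ∫ x, Real.exp (s * (x - d)) ∂ν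

section Walk

variable {d : ℝ}

theorem measurable_walk (n : ℕ) : Measurable fun x : ℕ → ℝ => walk d x n :=
  Finset.measurable_sum _ fun i _ => by fun_prop

@[simp] theorem walk_zero (x : ℕ → ℝ) : walk d x 0 = 0 := rfl

theorem walk_shift (x : ℕ → ℝ) (m k : ℕ) :
    walk d (shift m x) k = walk d x (m + k) - walk d x m := by
  simp only [walk, Finset.sum_range_add, shift]
  ring

theorem walk_congr {x x' : ℕ → ℝ} {n : ℕ} (h : ∀ i < n, x i = x' i) : walk d x n = walk d x' n :=
  Finset.sum_congr rfl fun i hi => by rw [h i (Finset.mem_range.1 hi)]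

theorem walk_one_add (x : ℕ → ℝ) (n : ℕ) : walk d x (n + 1) = (x 0 - d) + walk d (shift 1 x) n := by
  rw [walk_shift, add_comm 1 n]
  simp [walk]

theorem walk_eq (x : ℕ → ℝ) (n : ℕ) : walk d x n = ∑ i ∈ Finset.range n, x i - n * d := by
  simp [walk, Finset.sum_sub_distrib]

end Walk

section Seq

variable {ν : Measure ℝ} [IsProbabilityMeasure ν] {d : ℝ}

theorem map_head_tail_seqLaw :
    (seqLaw ν).map (fun x => (x 0, shift 1 x)) = ν.prod (seqLaw ν) := by
  have hind : IndepFun (fun x : ℕ → ℝ => x 0) (shift 1) (seqLaw ν) := by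
    rw [indepFun_iff_measure_inter_preimage_eq_mul]
    intro s T hs hT
    have h := seqLaw_inter_shift (ν := ν) (n := 1) (A := (fun x : ℕ → ℝ => x 0) ⁻¹' s)
      (measurable_pi_apply 0 hs) (fun z z' h hz => by
        have := h 0 (Set.mem_Iio.2 one_pos)
        simpa only [Set.mem_preimage, ← this] using hz) hT
    rw [← seqLaw_shift_preimage 1 hT] at h
    simp only [measureReal_def] at h
    rw [← ENNReal.toReal_mul, ENNReal.toReal_eq_toReal_iff' (measure_ne_top _ _)
      (ENNReal.mul_ne_top (measure_ne_top _ _) (measure_ne_top _ _))] at h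
    exact h
  rw [(indepFun_iff_map_prod_eq_prod_map_map (measurable_pi_apply 0).aemeasurable
    (measurable_shift 1).aemeasurable).1 hind, map_eval_seqLaw, map_shift_seqLaw]

theorem lintegral_head_tail {g : ℝ → (ℕ → ℝ) → ENNReal} (hg : Measurable (Function.uncurry g)) :
    ∫⁻ x, g (x 0) (shift 1 x) ∂seqLaw ν = ∫⁻ a, ∫⁻ x, g a x ∂seqLaw ν ∂ν := by
  have hm : Measurable fun x : ℕ → ℝ => (x 0, shift 1 x) :=
    (measurable_pi_apply 0).prodMk (measurable_shift 1)
  calc ∫⁻ x, g (x 0) (shift 1 x) ∂seqLaw ν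
      = ∫⁻ p, Function.uncurry g p ∂(seqLaw ν).map (fun x => (x 0, shift 1 x)) := by
        rw [lintegral_map hg hm]; rfl
    _ = _ := by rw [map_head_tail_seqLaw, lintegral_prod _ hg.aemeasurable]; rfl

/-- The exponential change of measure for the random walk. -/
theorem lintegral_walk_tilted {s : ℝ} (hs : Integrable (fun x => Real.exp (s * x)) ν) (n : ℕ)
    {g : ℝ → ENNReal} (hg : Measurable g) :
    ∫⁻ x, g (walk d x n) ∂seqLaw (ν.tilted fun x => s * x) =
      ∫⁻ x, ENNReal.ofReal (Real.exp (s * walk d x n) /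
        expMom ν d s ^ n) * g (walk d x n) ∂seqLaw ν := by
  have : IsProbabilityMeasure (ν.tilted fun x => s * x) := isProbabilityMeasure_tilted hs
  have hM : expMom ν d s = Real.exp (-(s * d)) * ∫ x, Real.exp (s * x) ∂ν := by
    rw [expMom, ← integral_const_mul]
    congr 1 with x
    rw [← Real.exp_add]
    congr 1; ring
  have hpos : 0 < ∫ x, Real.exp (s * x) ∂ν := integral_exp_pos hs
  have hMpos : 0 < expMom ν d s := hM ▸ mul_pos (Real.exp_pos _) hpos
  set M := expMom ν d s with hMdef
  induction n generalizing g with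
  | zero => simp
  | succ n ih =>
    simp only [walk_one_add]
    rw [lintegral_head_tail (g := fun a x => g (a - d + walk d x n)), lintegral_head_tail
      (g := fun a x => ENNReal.ofReal (Real.exp (s * (a - d + walk d x n)) / M ^ (n + 1)) *
        g (a - d + walk d x n)), lintegral_tilted]
    · congr 1 with a
      rw [ih (g := fun z => g (a - d + z)) (hg.comp (measurable_const.add measurable_id)),
        ← lintegral_const_mul]
      · congr 1 with x
        rw [← mul_assoc, ← ENNReal.ofReal_mul (by positivity)]
        congr 2
        rw [hM, mul_add, Real.exp_add, pow_succ, mul_sub, Real.exp_sub, Real.exp_neg]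
        rw [hM] at hMpos
        field_simp
      · have := measurable_walk (d := d) n
        fun_prop
    · have : Measurable fun p : ℝ × (ℕ → ℝ) => p.1 - d + walk d p.2 n :=
        (measurable_fst.sub_const d).add ((measurable_walk n).comp measurable_snd)
      simp only [Function.uncurry_def]
      fun_prop
    · have : Measurable fun p : ℝ × (ℕ → ℝ) => p.1 - d + walk d p.2 n :=
        (measurable_fst.sub_const d).add ((measurable_walk n).comp measurable_snd)
      simp only [Function.uncurry_def]
      fun_prop

/-- On the event that the walk ends in `V`, the density of the tilted law is at most its value at
`σ`. -/
theorem measure_walk_tilted_le {s : ℝ} (hs0 : 0 ≤ s)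
    (hs : Integrable (fun x => Real.exp (s * x)) ν) (n : ℕ) {V : Set ℝ} (hV : MeasurableSet V)
    {σ : ℝ} (hσ : ∀ v ∈ V, v ≤ σ) :
    (seqLaw (ν.tilted fun x => s * x)).real {x | walk d x n ∈ V} ≤
      Real.exp (s * σ) / expMom ν d s ^ n *
        (seqLaw ν).real {x | walk d x n ∈ V} := by
  have : IsProbabilityMeasure (ν.tilted fun x => s * x) := isProbabilityMeasure_tilted hs
  have hMnn : 0 ≤ expMom ν d s := integral_nonneg fun x => (Real.exp_pos _).le
  set M := expMom ν d s with hMdef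
  have hm : MeasurableSet {x : ℕ → ℝ | walk d x n ∈ V} := measurable_walk n hV
  have h := lintegral_walk_tilted (d := d) hs n (g := V.indicator 1)
    (measurable_one.indicator hV)
  have h1 : ∫⁻ x, V.indicator 1 (walk d x n) ∂seqLaw (ν.tilted fun x => s * x) =
      seqLaw (ν.tilted fun x => s * x) {x | walk d x n ∈ V} := by
    rw [← lintegral_indicator_one hm]
    rfl
  rw [h1] at h
  rw [measureReal_def, h, measureReal_def]
  have h2 : ∫⁻ x, ENNReal.ofReal (Real.exp (s * walk d x n) / M ^ n) *
      V.indicator 1 (walk d x n) ∂seqLaw ν ≤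
      ENNReal.ofReal (Real.exp (s * σ) / M ^ n) * seqLaw ν {x | walk d x n ∈ V} := by
    rw [← lintegral_indicator_one hm, ← lintegral_const_mul _ (measurable_one.indicator hm)]
    refine lintegral_mono fun x => ?_
    by_cases hx : walk d x n ∈ V
    · have hx' : x ∈ {x : ℕ → ℝ | walk d x n ∈ V} := hx
      simp only [Set.indicator_of_mem hx, Set.indicator_of_mem hx', Pi.one_apply]
      gcongr
      exact hσ _ hx
    · simp [Set.indicator_of_notMem hx]
  refine (ENNReal.toReal_mono (ENNReal.mul_ne_top ENNReal.ofReal_ne_top (measure_ne_top _ _))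
    h2).trans ?_
  rw [ENNReal.toReal_mul, ENNReal.toReal_ofReal (by positivity)]

/-- Chernoff's bound: the tilted probability of the event is at most one, and the density is at
least `exp (s a) / expMom ν d s ^ n` on it. -/
theorem measure_le_walk_le {s : ℝ} (hs0 : 0 ≤ s)
    (hs : Integrable (fun x => Real.exp (s * x)) ν) (n : ℕ) (a : ℝ) :
    (seqLaw ν).real {x | a ≤ walk d x n} ≤
      Real.exp (-(s * a)) * expMom ν d s ^ n := by
  have : IsProbabilityMeasure (ν.tilted fun x => s * x) := isProbabilityMeasure_tilted hs
  have hMpos : 0 < expMom ν d s := by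
    refine integral_exp_pos ((hs.const_mul (Real.exp (-(s * d)))).congr (ae_of_all _ fun x => ?_))
    change Real.exp (-(s * d)) * Real.exp (s * x) = Real.exp (s * (x - d))
    rw [← Real.exp_add]
    congr 1; ring
  set M := expMom ν d s with hMdef
  have hm : MeasurableSet {x : ℕ → ℝ | a ≤ walk d x n} :=
    measurableSet_le measurable_const (measurable_walk n)
  have h := lintegral_walk_tilted (d := d) hs n (g := fun _ => 1) measurable_const
  have h1 : ENNReal.ofReal (Real.exp (s * a) / M ^ n) * seqLaw ν {x | a ≤ walk d x n} ≤ 1 := by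
    have h0 : ∫⁻ x, 1 ∂seqLaw (ν.tilted fun x => s * x) = 1 := by simp
    rw [h0] at h
    rw [h, ← lintegral_indicator_one hm, ← lintegral_const_mul _ (measurable_one.indicator hm)]
    refine lintegral_mono fun x => ?_
    by_cases hx : x ∈ {x : ℕ → ℝ | a ≤ walk d x n}
    · simp only [Set.indicator_of_mem hx, Pi.one_apply]
      gcongr
      exact hx
    · simp [Set.indicator_of_notMem hx]
  have h2 := ENNReal.toReal_mono ENNReal.one_ne_top h1
  rw [ENNReal.toReal_mul, ENNReal.toReal_ofReal (by positivity), ENNReal.toReal_one,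
    ← measureReal_def] at h2
  rw [Real.exp_neg]
  have hp := Real.exp_pos (s * a)
  rw [div_mul_eq_mul_div, div_le_one (by positivity)] at h2
  rw [inv_mul_eq_div, le_div_iff₀ hp]
  linarith

end Seq

/-! ### Fluctuations of a walk with negative drift -/

/-- The law `ν` has a mean less than `d`, but `E exp (lam (X - d)) > 1`. -/
structure Pair (ν : Measure ℝ) (d lam : ℝ) : Prop where
  integrable_id : Integrable (fun x : ℝ => x) ν
  mean_lt : mean ν < d
  lam_pos : 0 < lam
  integrable_exp : Integrable (fun x => Real.exp (lam * x)) ν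
  one_lt : 1 < expMom ν d lam
  integrable_id_tilted : Integrable (fun x : ℝ => x) (ν.tilted fun x => lam * x)

section Pair

variable {ν : Measure ℝ} [IsProbabilityMeasure ν] {d lam : ℝ}

theorem integrable_exp_of_le {s : ℝ} (hs : 0 ≤ s) (hsl : s ≤ lam)
    (h : Integrable (fun x => Real.exp (lam * x)) ν) :
    Integrable (fun x => Real.exp (s * x)) ν := by
  refine ((integrable_const (1 : ℝ)).add h).mono' (by fun_prop) (ae_of_all _ fun x => ?_)
  rw [Real.norm_eq_abs, abs_of_pos (Real.exp_pos _)]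
  change Real.exp (s * x) ≤ 1 + Real.exp (lam * x)
  rcases le_total 0 x with hx | hx
  · have : Real.exp (s * x) ≤ Real.exp (lam * x) :=
      Real.exp_le_exp.2 (mul_le_mul_of_nonneg_right hsl hx)
    linarith
  · have : Real.exp (s * x) ≤ 1 := Real.exp_le_one_iff.2 (mul_nonpos_of_nonneg_of_nonpos hs hx)
    linarith [Real.exp_pos (lam * x)]

omit [IsProbabilityMeasure ν] in
theorem integrable_exp_sub {s : ℝ} (d : ℝ) (h : Integrable (fun x => Real.exp (s * x)) ν) :
    Integrable (fun x => Real.exp (s * (x - d))) ν := by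
  refine (h.const_mul (Real.exp (-(s * d)))).congr (ae_of_all _ fun x => ?_)
  change Real.exp (-(s * d)) * Real.exp (s * x) = Real.exp (s * (x - d))
  rw [← Real.exp_add]
  congr 1; ring

/-- A law with mean less than `d` and a positive exponential moment has an exponential moment of
`X - d` less than one. -/
theorem exists_expMom_lt_one (hid : Integrable (fun x : ℝ => x) ν) (hd : mean ν < d)
    (hl : 0 < lam) (he : Integrable (fun x => Real.exp (lam * x)) ν) :
    ∃ s, 0 < s ∧ s ≤ lam ∧ expMom ν d s < 1 := by
  set s : ℕ → ℝ := fun n => lam / (n + 1) with hsdef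
  have hs0 : ∀ n, 0 < s n := fun n => by positivity
  have hsl : ∀ n, s n ≤ lam := fun n => div_le_self hl.le (by linarith [n.cast_nonneg (α := ℝ)])
  have hst : Filter.Tendsto s Filter.atTop (nhds 0) :=
    tendsto_const_div_atTop_nhds_zero_nat lam |>.comp (Filter.tendsto_add_atTop_nat 1) |>.congr
      fun n => by simp [hsdef]
  have hlim : Filter.Tendsto (fun n => ∫ x, (Real.exp (s n * (x - d)) - 1) / s n ∂ν)
      Filter.atTop (nhds (∫ x, (x - d) ∂ν)) := by
    refine tendsto_integral_of_dominated_convergence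
      (fun x => |x - d| + (Real.exp (lam * (x - d)) / lam + 1 / lam)) (fun n => ?_) ?_
          (fun n => ?_) ?_
    · exact (Continuous.aestronglyMeasurable (by fun_prop))
    · exact ((hid.sub (integrable_const d)).abs).add
        (((integrable_exp_sub d he).div_const lam).add (integrable_const _))
    · refine ae_of_all _ fun x => ?_
      -- The difference quotient lies between the tangent `x - d` and, by convexity, the quotient at
      -- `lam`; both are integrable.
      have h1 : x - d ≤ (Real.exp (s n * (x - d)) - 1) / s n := by
        rw [le_div_iff₀ (hs0 n)]
        linarith [Real.add_one_le_exp (s n * (x - d))]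
      have h2 : (Real.exp (s n * (x - d)) - 1) / s n ≤ (Real.exp (lam * (x - d)) - 1) / lam := by
        have hc := convexOn_exp.2 (Set.mem_univ (0 : ℝ)) (Set.mem_univ (lam * (x - d)))
          (show 0 ≤ 1 - s n / lam from sub_nonneg.2 ((div_le_one hl).2 (hsl n)))
          (show 0 ≤ s n / lam from div_nonneg (hs0 n).le hl.le) (by ring)
        simp only [smul_eq_mul, mul_zero, zero_add, Real.exp_zero, mul_one] at hc
        rw [show s n / lam * (lam * (x - d)) = s n * (x - d) by field_simp] at hc
        rw [div_le_div_iff₀ (hs0 n) hl]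
        have h5 := mul_le_mul_of_nonneg_right hc hl.le
        have h6 : (1 - s n / lam + s n / lam * Real.exp (lam * (x - d))) * lam =
            lam - s n + s n * Real.exp (lam * (x - d)) := by field_simp
        linarith
      rw [Real.norm_eq_abs, abs_le]
      have h3 : 0 ≤ Real.exp (lam * (x - d)) / lam := by positivity
      have h4 : 0 ≤ 1 / lam := by positivity
      constructor
      · linarith [neg_abs_le (x - d)]
      · rw [sub_div _ _ lam] at h2
        linarith [abs_nonneg (x - d)]
    · refine ae_of_all _ fun x => ?_
      have hder : HasDerivAt (fun r : ℝ => Real.exp (r * (x - d))) (x - d) 0 := by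
        have := ((hasDerivAt_id (0 : ℝ)).mul_const (x - d)).exp
        simpa using this
      have := hder.tendsto_slope_zero.comp (tendsto_nhdsWithin_iff.2
        ⟨hst, Filter.Eventually.of_forall fun n => (hs0 n).ne'⟩)
      refine this.congr fun n => ?_
      simp [div_eq_inv_mul]
  have hneg : ∫ x, (x - d) ∂ν < 0 := by
    rw [integral_sub hid (integrable_const d)]
    simp only [integral_const, probReal_univ, one_smul]
    exact sub_neg.2 hd
  obtain ⟨n, hn⟩ := (hlim.eventually (gt_mem_nhds hneg)).exists
  refine ⟨s n, hs0 n, hsl n, ?_⟩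
  rw [integral_div, integral_sub (integrable_exp_sub d (integrable_exp_of_le (hs0 n).le (hsl n) he))
    (integrable_const 1)] at hn
  simp only [integral_const, probReal_univ, one_smul] at hn
  have := (div_neg_iff.1 hn).resolve_left fun h => absurd h.2 (hs0 n).not_gt
  exact sub_neg.1 this.1

theorem expMom_pos {s : ℝ} (h : Integrable (fun x => Real.exp (s * x)) ν) : 0 < expMom ν d s :=
  integral_exp_pos (integrable_exp_sub d h)

theorem seqLaw_forall_lt (n : ℕ) {B : ℕ → Set ℝ} (hB : ∀ i, MeasurableSet (B i)) :
    (seqLaw ν).real {x | ∀ i < n, x i ∈ B i} = ∏ i ∈ Finset.range n, ν.real (B i) := by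
  have h := Measure.infinitePi_pi (fun _ : ℕ => ν) (s := Finset.range n) (t := B) fun i _ => hB i
  have hset : {x : ℕ → ℝ | ∀ i < n, x i ∈ B i} = Set.pi (Finset.range n : Set ℕ) B := by
    ext x; simp
  rw [hset, measureReal_def, seqLaw, h, ENNReal.toReal_prod]
  rfl

/-- The walk with negative drift stays nonpositive with positive probability. -/
theorem exists_forall_walk_nonpos (hp : Pair ν d lam) :
    ∃ q, 0 < q ∧ q ≤ (seqLaw ν).real {x | ∀ n, walk d x n ≤ 0} := by
  obtain ⟨s, hs, hsl, hM⟩ := exists_expMom_lt_one hp.integrable_id hp.mean_lt hp.lam_pos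
    hp.integrable_exp
  have hes := integrable_exp_of_le hs.le hsl hp.integrable_exp
  have hM0 : 0 < expMom ν d s := expMom_pos hes
  set M := expMom ν d s
  set δ := d - mean ν with hδ
  have hδ0 : 0 < δ := sub_pos.2 hp.mean_lt
  have hp0 : 0 < ν.real (Set.Iic (mean ν)) := by
    rw [measureReal_def, ENNReal.toReal_pos_iff]
    exact ⟨measure_le_integral_pos hp.integrable_id, measure_lt_top _ _⟩
  obtain ⟨N, hN⟩ : ∃ N : ℕ, Real.exp (-(s * (N * δ))) * (1 - M)⁻¹ ≤ 1 / 2 := by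
    have : Filter.Tendsto (fun N : ℕ => Real.exp (-(s * (N * δ))) * (1 - M)⁻¹) Filter.atTop
        (nhds (0 * (1 - M)⁻¹)) := by
      refine Filter.Tendsto.mul_const _ (Real.tendsto_exp_neg_atTop_nhds_zero.comp ?_)
      refine Filter.Tendsto.const_mul_atTop hs ?_
      exact Filter.Tendsto.atTop_mul_const hδ0 tendsto_natCast_atTop_atTop
    rw [zero_mul] at this
    exact (this.eventually (ge_mem_nhds (by norm_num))).exists
  -- `N` rewards not exceeding the mean bring the walk down to `-N δ`; by the choice of `N`, it then
  -- rises by less than `N δ` forever with probability at least `1 / 2`.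
  set A : Set (ℕ → ℝ) := {x | ∀ i < N, x i ∈ Set.Iic (mean ν)} with hA
  -- Time `0` is exempted because the strict inequality fails there when `N = 0`.
  set T : Set (ℕ → ℝ) := {x | ∀ n, walk d x n < N * δ ∨ n = 0} with hT
  have hmA : MeasurableSet A := by
    refine MeasurableSet.congr (s := ⋂ i, {x : ℕ → ℝ | i < N → x i ∈ Set.Iic (mean ν)})
      (MeasurableSet.iInter fun i => ?_) (by ext x; simp [hA])
    exact MeasurableSet.imp (MeasurableSet.const _) (measurable_pi_apply i measurableSet_Iic)
  have hmT : MeasurableSet T := by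
    refine measurableSet_setOfPred.2 (Measurable.forall fun n => Measurable.or ?_ measurable_const)
    exact measurableSet_setOfPred.1 (measurableSet_lt (measurable_walk n) measurable_const)
  have hTc : (seqLaw ν).real Tᶜ ≤ 1 / 2 := by
    have hsub : Tᶜ ⊆ ⋃ n : ℕ, {x | N * δ ≤ walk d x (n + 1)} := by
      intro x hx
      simp only [hT, Set.mem_compl_iff, Set.mem_ofPred_eq, not_forall, not_or, not_lt] at hx
      obtain ⟨n, hn, hn0⟩ := hx
      obtain ⟨m, rfl⟩ := Nat.exists_eq_succ_of_ne_zero hn0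
      exact Set.mem_iUnion.2 ⟨m, hn⟩
    have hsum : HasSum (fun n => Real.exp (-(s * (N * δ))) * M ^ n)
        (Real.exp (-(s * (N * δ))) * (1 - M)⁻¹) :=
      (hasSum_geometric_of_lt_one hM0.le hM).mul_left _
    have hle : seqLaw ν Tᶜ ≤ ENNReal.ofReal (Real.exp (-(s * (N * δ))) * (1 - M)⁻¹) := by
      refine (measure_mono hsub).trans ((measure_iUnion_le _).trans ?_)
      rw [← hsum.tsum_eq, ENNReal.ofReal_tsum_of_nonneg (fun n => by positivity) hsum.summable]
      refine ENNReal.tsum_le_tsum fun n => ?_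
      rw [← ENNReal.ofReal_toReal (measure_ne_top (seqLaw ν) _)]
      refine ENNReal.ofReal_le_ofReal ((measure_le_walk_le hs.le hes (n + 1) _).trans ?_)
      refine mul_le_mul_of_nonneg_left ?_ (Real.exp_pos _).le
      exact pow_le_pow_of_le_one hM0.le hM.le (Nat.le_succ n)
    refine (ENNReal.toReal_mono ENNReal.ofReal_ne_top hle).trans ?_
    rw [ENNReal.toReal_ofReal (mul_nonneg (Real.exp_pos _).le (inv_nonneg.2 (by linarith)))]
    exact hN
  have hTge : 1 / 2 ≤ (seqLaw ν).real T := by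
    have := probReal_compl_eq_one_sub (μ := seqLaw ν) hmT
    linarith
  refine ⟨ν.real (Set.Iic (mean ν)) ^ N * (1 / 2), by positivity, ?_⟩
  have hAT : (seqLaw ν).real {x | x ∈ A ∧ shift N x ∈ T} =
      (seqLaw ν).real A * (seqLaw ν).real T :=
    seqLaw_inter_shift hmA (fun z z' h hz i hi => by
      rw [← h i (Set.mem_Iio.2 hi)]; exact hz i hi) hmT
  have hAv : (seqLaw ν).real A = ν.real (Set.Iic (mean ν)) ^ N := by
    rw [hA, seqLaw_forall_lt N (B := fun _ => Set.Iic (mean ν)) fun _ => measurableSet_Iic]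
    simp
  calc ν.real (Set.Iic (mean ν)) ^ N * (1 / 2) ≤ (seqLaw ν).real A * (seqLaw ν).real T := by
        rw [hAv]; gcongr
    _ ≤ _ := by
        rw [← hAT]
        refine measureReal_mono ?_
        rintro x ⟨hxA, hxT⟩
        have hfirst : ∀ n ≤ N, walk d x n ≤ -(n * δ) := by
          intro n hn
          rw [walk, ← mul_neg]
          refine (Finset.sum_le_card_nsmul _ _ (-δ) fun i hi => ?_).trans (by simp)
          have := hxA i ((Finset.mem_range.1 hi).trans_le hn)
          rw [Set.mem_Iic] at this
          linarith
        intro n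
        rcases le_or_gt n N with h | h
        · exact (hfirst n h).trans (neg_nonpos.2 (by positivity))
        · obtain ⟨m, rfl⟩ := Nat.exists_eq_add_of_lt h
          have h1 := (hxT (m + 1)).resolve_right (Nat.succ_ne_zero m)
          rw [walk_shift, ← add_assoc] at h1
          linarith [hfirst N le_rfl]

/-- There is mass below `d` because the mean is less than `d`, and above `d` because otherwise `exp
(lam (X - d)) ≤ 1` almost surely. The two support points serve to break ties. -/
theorem exists_balls (hp : Pair ν d lam) : ∃ s₁ s₂ : ℝ, s₁ < s₂ ∧ ∀ r, 0 < r →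
    0 < ν.real (Set.Icc (s₁ - r) (s₁ + r)) ∧ 0 < ν.real (Set.Icc (s₂ - r) (s₂ + r)) := by
  have h1 : ν (Set.Iio d) ≠ 0 := by
    refine fun h => (measure_le_integral_pos hp.integrable_id).ne' (measure_mono_null ?_ h)
    exact fun x hx => lt_of_le_of_lt hx hp.mean_lt
  have h2 : ν (Set.Ioi d) ≠ 0 := by
    intro h
    have hle : expMom ν d lam ≤ 1 := by
      have : ∫ x, Real.exp (lam * (x - d)) ∂ν ≤ ∫ x, (1 : ℝ) ∂ν := by
        refine integral_mono_ae (integrable_exp_sub d hp.integrable_exp) (integrable_const 1) ?_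
        have : ∀ᵐ x ∂ν, x ∉ Set.Ioi d := measure_eq_zero_iff_ae_notMem.1 h
        filter_upwards [this] with x hx
        rw [Real.exp_le_one_iff]
        exact mul_nonpos_of_nonneg_of_nonpos hp.lam_pos.le (sub_nonpos.2 (not_lt.1 hx))
      simpa [expMom] using this
    exact absurd hp.one_lt hle.not_gt
  obtain ⟨s₁, hs₁, hb₁⟩ := exists_mem_forall_mem_nhdsWithin_pos_measure h1
  obtain ⟨s₂, hs₂, hb₂⟩ := exists_mem_forall_mem_nhdsWithin_pos_measure h2
  refine ⟨s₁, s₂, lt_trans hs₁ hs₂, fun r hr => ⟨?_, ?_⟩⟩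
  · exact ENNReal.toReal_pos (hb₁ _ (mem_nhdsWithin_of_mem_nhds
      (Icc_mem_nhds (by linarith) (by linarith)))).ne' (measure_ne_top _ _)
  · exact ENNReal.toReal_pos (hb₂ _ (mem_nhdsWithin_of_mem_nhds
      (Icc_mem_nhds (by linarith) (by linarith)))).ne' (measure_ne_top _ _)

end Pair

/-- The walk stays nonnegative up to time `l`, when it is at least `a`. -/
def Boost (d a : ℝ) (l : ℕ) : Set (ℕ → ℝ) := {x | (∀ k ≤ l, 0 ≤ walk d x k) ∧ a ≤ walk d x l}

theorem measurableSet_boost (d a : ℝ) (l : ℕ) : MeasurableSet (Boost d a l) :=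
  measurableSet_setOfPred.2 ((Measurable.forall fun k => measurable_const.imp
    (measurableSet_setOfPred.1 (measurableSet_le measurable_const (measurable_walk k)))).and
    (measurableSet_setOfPred.1 (measurableSet_le measurable_const (measurable_walk l))))

theorem decidedBy_boost (d a : ℝ) (l : ℕ) : DecidedBy (Set.Iio l) (Boost d a l) := by
  intro z z' h hz
  have hw : ∀ k ≤ l, walk d z k = walk d z' k := fun k hk =>
    walk_congr fun i hi => h i (Set.mem_Iio.2 (hi.trans_le hk))
  exact ⟨fun k hk => hw k hk ▸ hz.1 k hk, hw l le_rfl ▸ hz.2⟩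

section Pair

variable {ν : Measure ℝ} [IsProbabilityMeasure ν] {d lam : ℝ}

theorem integral_abs_walk_le (hid : Integrable (fun x : ℝ => x) ν) (n : ℕ) :
    Integrable (fun x => ∑ i ∈ Finset.range n, |x i - d|) (seqLaw ν) ∧
      ∫ x, ∑ i ∈ Finset.range n, |x i - d| ∂seqLaw ν = n * ∫ x, |x - d| ∂ν := by
  have hi : ∀ i, Integrable (fun x : ℕ → ℝ => |x i - d|) (seqLaw ν) := by
    intro i
    have h : Integrable (fun x : ℝ => |x - d|) ((seqLaw ν).map fun x => x i) := by
      rw [map_eval_seqLaw]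
      exact (hid.sub (integrable_const d)).abs
    exact h.comp_measurable (measurable_pi_apply i)
  refine ⟨integrable_finsetSum _ fun i _ => hi i, ?_⟩
  rw [integral_finsetSum _ fun i _ => hi i]
  have : ∀ i, ∫ x : ℕ → ℝ, |x i - d| ∂seqLaw ν = ∫ x, |x - d| ∂ν := by
    intro i
    conv_rhs => rw [← map_eval_seqLaw (ν := ν) i]
    rw [integral_map (measurable_pi_apply i).aemeasurable
      (Continuous.aestronglyMeasurable (by fun_prop))]
  simp [this]

/-- Under the tilted law the walk lies in `[1, C L)` at time `L` with probability at least `1 / 2`: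
smaller values are excluded by the density, which carries `M^L` in the denominator, larger ones by
Markov's inequality. Some unit interval `[a, a + 1)` then has tilted probability at least `1 / (2 C
L)`. Undoing the tilt multiplies this by at least `M^L exp (-lam (a + 1))`, and since `M > 1` the
power `M^L` absorbs all polynomial losses, including the extra factor `L`. -/
theorem exists_measure_walk_ge (hp : Pair ν d lam) : ∃ L a : ℕ, 1 ≤ L ∧ 1 ≤ a ∧
    L * Real.exp (-(lam * a)) ≤ (seqLaw ν).real {x | (a : ℝ) ≤ walk d x L} := by
  set ν' := ν.tilted fun x => lam * x with hν'
  have hprob : IsProbabilityMeasure ν' := isProbabilityMeasure_tilted hp.integrable_exp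
  set M := expMom ν d lam with hM
  have hM1 : 1 < M := hp.one_lt
  have hM0 : 0 < M := by linarith
  obtain ⟨C, hC⟩ := exists_nat_gt (4 * ∫ x, |x - d| ∂ν')
  have hC0 : 0 < (C : ℝ) := lt_of_le_of_lt (by positivity) hC
  have hl0 : 0 < Real.exp lam := Real.exp_pos _
  obtain ⟨L, hL1, hL2, hL3⟩ : ∃ L : ℕ, 1 ≤ L ∧ Real.exp lam / M ^ L ≤ 1 / 4 ∧
      (L : ℝ) ^ 2 / M ^ L ≤ 1 / (2 * C * Real.exp lam) := by
    have t1 : Filter.Tendsto (fun L : ℕ => (L : ℝ) ^ 2 / M ^ L) Filter.atTop (nhds 0) :=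
      tendsto_pow_const_div_const_pow_of_one_lt 2 hM1
    have t2 : Filter.Tendsto (fun L : ℕ => Real.exp lam / M ^ L) Filter.atTop (nhds 0) :=
      Filter.Tendsto.const_div_atTop (tendsto_pow_atTop_atTop_of_one_lt hM1) _
    have e := ((Filter.eventually_ge_atTop 1).and (t2.eventually (ge_mem_nhds
      (show (0 : ℝ) < 1 / 4 by norm_num)))).and (t1.eventually (ge_mem_nhds
      (show (0 : ℝ) < 1 / (2 * C * Real.exp lam) by positivity)))
    obtain ⟨L, ⟨h1, h2⟩, h3⟩ := e.exists
    exact ⟨L, h1, h2, h3⟩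
  have hLpos : (0 : ℝ) < L := by exact_mod_cast hL1
  have hlow : (seqLaw ν').real {x | walk d x L ∈ Set.Iio 1} ≤ 1 / 4 := by
    refine (measure_walk_tilted_le hp.lam_pos.le hp.integrable_exp L measurableSet_Iio
      (σ := 1) fun v hv => (Set.mem_Iio.1 hv).le).trans ?_
    refine (mul_le_of_le_one_right (by positivity) measureReal_le_one).trans ?_
    rw [mul_one]
    exact hL2
  have hhigh : (seqLaw ν').real {x | (C * L : ℝ) ≤ walk d x L} ≤ 1 / 4 := by
    obtain ⟨i1, i2⟩ := integral_abs_walk_le (ν := ν') (d := d) hp.integrable_id_tilted L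
    have hm := mul_meas_ge_le_integral_of_nonneg
      (ae_of_all _ fun x : ℕ → ℝ => Finset.sum_nonneg fun i _ => abs_nonneg (x i - d)) i1
          (C * L : ℝ)
    rw [i2] at hm
    have hle : (seqLaw ν').real {x | (C * L : ℝ) ≤ walk d x L} ≤
        (seqLaw ν').real {x | (C * L : ℝ) ≤ ∑ i ∈ Finset.range L, |x i - d|} := by
      refine measureReal_mono fun x hx => le_trans (Set.mem_ofPred_eq ▸ hx) ?_
      exact Finset.sum_le_sum fun i _ => le_abs_self _
    have h4 : (C * L : ℝ) * (seqLaw ν').real {x | (C * L : ℝ) ≤ ∑ i ∈ Finset.range L, |x i - d|} ≤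
        (C * L : ℝ) * (1 / 4) := by
      refine hm.trans ?_
      nlinarith
    exact hle.trans (le_of_mul_le_mul_left h4 (by positivity))
  set B : ℕ → Set (ℕ → ℝ) := fun a => {x | walk d x L ∈ Set.Ico (a : ℝ) (a + 1)} with hB
  have hcover : (Set.univ : Set (ℕ → ℝ)) ⊆ ({x | walk d x L ∈ Set.Iio 1} ∪
      {x | (C * L : ℝ) ≤ walk d x L}) ∪ ⋃ a ∈ Finset.Ico 1 (C * L), B a := by
    intro x _
    rcases lt_or_ge (walk d x L) 1 with h1 | h1
    · exact Or.inl (Or.inl h1)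
    rcases le_or_gt (C * L : ℝ) (walk d x L) with h2 | h2
    · exact Or.inl (Or.inr h2)
    refine Or.inr (Set.mem_iUnion₂.2 ⟨⌊walk d x L⌋₊, Finset.mem_Ico.2 ⟨?_, ?_⟩, ?_, ?_⟩)
    · exact Nat.le_floor (by simpa using h1)
    · exact (Nat.floor_lt (by linarith)).2 (by push_cast; exact h2)
    · exact Nat.floor_le (by linarith)
    · exact Nat.lt_floor_add_one _
  have hsum : 1 / 2 ≤ ∑ a ∈ Finset.Ico 1 (C * L), (seqLaw ν').real (B a) := by
    have h1 := (measureReal_mono (μ := seqLaw ν') hcover).trans ((measureReal_union_le _ _).trans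
      (add_le_add (measureReal_union_le _ _) (measureReal_biUnion_finset_le _ _)))
    rw [probReal_univ] at h1
    linarith
  obtain ⟨a, ha, hBa⟩ : ∃ a ∈ Finset.Ico 1 (C * L), 1 / (2 * C * L) ≤ (seqLaw ν').real (B a) := by
    by_contra hcon
    push Not at hcon
    have hcard : ∑ a ∈ Finset.Ico 1 (C * L), (seqLaw ν').real (B a) ≤
        (Finset.Ico 1 (C * L)).card • (1 / (2 * C * L) : ℝ) :=
      Finset.sum_le_card_nsmul _ _ _ fun a ha => (hcon a ha).le
    rw [Nat.card_Ico, nsmul_eq_mul] at hcard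
    have hCL : 1 ≤ C * L := Nat.mul_pos (by exact_mod_cast hC0) hL1
    rw [Nat.cast_sub hCL] at hcard
    push_cast at hcard
    have h2 : (C * L - 1 : ℝ) * (1 / (2 * C * L)) < 1 / 2 := by
      rw [mul_one_div, div_lt_div_iff₀ (by positivity) (by norm_num)]
      nlinarith
    linarith
  refine ⟨L, a, hL1, (Finset.mem_Ico.1 ha).1, ?_⟩
  have h1 := measure_walk_tilted_le (d := d) hp.lam_pos.le hp.integrable_exp L
    (V := Set.Ico (a : ℝ) (a + 1)) measurableSet_Ico (σ := a + 1) fun v hv => hv.2.le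
  have h2 : (seqLaw ν).real (B a) ≤ (seqLaw ν).real {x | (a : ℝ) ≤ walk d x L} :=
    measureReal_mono fun x hx => hx.1
  have h3 := (hBa.trans h1).trans (mul_le_mul_of_nonneg_left h2 (by positivity))
  rw [← hM, mul_add, mul_one, Real.exp_add] at h3
  rw [Real.exp_neg]
  have ha0 : 0 < Real.exp (lam * a) := Real.exp_pos _
  set Q := (seqLaw ν).real {x | (a : ℝ) ≤ walk d x L}
  have hQ0 : 0 ≤ Q := measureReal_nonneg
  rw [← div_eq_mul_inv, div_le_iff₀ ha0]
  rw [div_le_div_iff₀ (by positivity) (by positivity), one_mul] at hL3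
  rw [div_mul_eq_mul_div, div_le_div_iff₀ (by positivity) (by positivity), one_mul] at h3
  have h5 : L * (2 * C * L * Real.exp lam) ≤ (Q * Real.exp (lam * a)) *
      (2 * C * L * Real.exp lam) := by
    nlinarith
  exact le_of_mul_le_mul_right h5 (by positivity)

/-- Cut a path that ends above `a` at the time of its minimum: the remaining part is nonnegative and
rises by at least `a`. There are `L` possible cutting times, which is why the preceding estimate
carries a factor `L`; one of them must give a probability of at least `exp (-lam a)`. -/
theorem exists_boost (hp : Pair ν d lam) : ∃ l a : ℕ, 1 ≤ l ∧ 1 ≤ a ∧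
    Real.exp (-(lam * a)) ≤ (seqLaw ν).real (Boost d a l) := by
  obtain ⟨L, a, hL, ha, h⟩ := exists_measure_walk_ge hp
  by_contra hcon
  push Not at hcon
  have hsub : {x | (a : ℝ) ≤ walk d x L} ⊆
      ⋃ τ ∈ Finset.range L, {x | shift τ x ∈ Boost d a (L - τ)} := by
    intro x hx
    obtain ⟨τ, hτ, hmin⟩ := Finset.exists_min_image (Finset.range (L + 1)) (walk d x)
      ⟨0, Finset.mem_range.2 (Nat.succ_pos L)⟩
    have h0 : walk d x τ ≤ 0 := by
      have := hmin 0 (Finset.mem_range.2 (Nat.succ_pos L))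
      simpa using this
    have hτL : τ < L := by
      rcases Nat.lt_or_ge τ L with h | h
      · exact h
      · have h1 : τ = L := by have := Finset.mem_range.1 hτ; omega
        rw [h1] at h0
        have h2 : (a : ℝ) ≤ walk d x L := hx
        have h3 : (1 : ℝ) ≤ a := by exact_mod_cast ha
        linarith
    refine Set.mem_iUnion₂.2 ⟨τ, Finset.mem_range.2 hτL, fun k hk => ?_, ?_⟩
    · rw [walk_shift, sub_nonneg]
      exact hmin _ (Finset.mem_range.2 (by omega))
    · rw [walk_shift, Nat.add_sub_cancel' hτL.le]
      have h2 : (a : ℝ) ≤ walk d x L := hx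
      linarith
  have h1 := h.trans ((measureReal_mono hsub (measure_ne_top _ _)).trans
      (measureReal_biUnion_finset_le _ _))
  have h2 : ∑ τ ∈ Finset.range L, (seqLaw ν).real {x | shift τ x ∈ Boost d a (L - τ)} <
      ∑ τ ∈ Finset.range L, Real.exp (-(lam * a)) := by
    refine Finset.sum_lt_sum_of_nonempty ⟨0, Finset.mem_range.2 hL⟩ fun τ hτ => ?_
    rw [seqLaw_shift_preimage τ (measurableSet_boost d a (L - τ))]
    have := Finset.mem_range.1 hτ
    exact hcon (L - τ) a (by omega) ha
  simp only [Finset.sum_const, Finset.card_range, nsmul_eq_mul] at h2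
  linarith

theorem boost_shift_subset (a b : ℝ) (hb : 0 ≤ a) (l n : ℕ) :
    {x | x ∈ Boost d a l ∧ shift l x ∈ Boost d b n} ⊆ Boost d (a + b) (l + n) := by
  rintro x ⟨⟨h1, h2⟩, h3, h4⟩
  refine ⟨fun k hk => ?_, ?_⟩
  · rcases le_or_gt k l with h | h
    · exact h1 k h
    · obtain ⟨i, rfl⟩ := Nat.exists_eq_add_of_le h.le
      have := h3 i (by omega)
      rw [walk_shift] at this
      linarith
  · rw [walk_shift] at h4
    linarith

/-- A walk with negative drift reaches level `t` without ever being negative with a probability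
of the exact exponential order, within a time linear in `t`. -/
theorem exists_boost_level (hp : Pair ν d lam) : ∃ c : ℝ, 0 < c ∧ ∃ C : ℕ, ∀ t : ℕ, ∃ L ≤ C *
    (t + 1),
    c * Real.exp (-(lam * t)) ≤ (seqLaw ν).real (Boost d t L) := by
  obtain ⟨l, a, hl, ha, h⟩ := exists_boost hp
  -- Boosts concatenate, and the bound `exp (-lam a)` has no prefactor, so no constant accumulates.
  have hpow : ∀ n : ℕ, Real.exp (-(lam * (n * a))) ≤ (seqLaw ν).real (Boost d (n * a) (n * l)) := by
    intro n
    induction n with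
    | zero =>
      have : Boost d ((0 : ℕ) * a) (0 * l) = Set.univ := by
        ext x; simp [Boost]
      rw [this]; simp
    | succ n ih =>
      have h1 := boost_shift_subset (d := d) (a : ℝ) (n * a) (by positivity) l (n * l)
      have h2 := measureReal_mono (μ := seqLaw ν) h1
      rw [seqLaw_inter_shift (measurableSet_boost _ _ _) (decidedBy_boost _ _ _)
        (measurableSet_boost _ _ _)] at h2
      have h3 : Real.exp (-(lam * a)) * Real.exp (-(lam * (n * a))) ≤
          (seqLaw ν).real (Boost d a l) * (seqLaw ν).real (Boost d (n * a) (n * l)) := by gcongr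
      rw [← Real.exp_add] at h3
      have e1 : -(lam * a) + -(lam * (n * a)) = -(lam * ((n + 1 : ℕ) * a)) := by push_cast; ring
      have e2 : (a : ℝ) + n * a = (n + 1 : ℕ) * a := by push_cast; ring
      have e3 : l + n * l = (n + 1) * l := by ring
      rw [e1] at h3
      rw [e2, e3] at h2
      exact h3.trans h2
  -- With `t / a + 1` boosts the height exceeds `t` by at most `a`, which costs the constant factor
  -- `exp (-lam a)`.
  refine ⟨Real.exp (-(lam * a)), Real.exp_pos _, l, fun t => ⟨(t / a + 1) * l, ?_, ?_⟩⟩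
  · rw [mul_comm]
    gcongr
    exact Nat.div_le_self t a
  · have hlt : t ≤ (t / a + 1) * a := by
      have := Nat.div_add_mod t a
      have := Nat.mod_lt t (show 0 < a by omega)
      nlinarith
    have hge : (t / a + 1) * a ≤ t + a := by
      have := Nat.div_mul_le_self t a
      nlinarith
    have h1 := hpow (t / a + 1)
    have h2 : (seqLaw ν).real (Boost d ((t / a + 1 : ℕ) * a) ((t / a + 1) * l)) ≤
        (seqLaw ν).real (Boost d t ((t / a + 1) * l)) := by
      refine measureReal_mono fun x hx => ⟨hx.1, le_trans ?_ hx.2⟩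
      exact_mod_cast hlt
    refine le_trans ?_ (h1.trans h2)
    rw [← Real.exp_add]
    refine Real.exp_le_exp.2 ?_
    have h3 : (((t / a + 1 : ℕ) : ℝ) * a) ≤ t + a := by exact_mod_cast hge
    have := mul_le_mul_of_nonneg_left h3 hp.lam_pos.le
    linarith

/-- A walk that ends in `[-t, σ]`, `σ ≤ 0`, has a cyclic rotation of its steps which never goes
below `-t`. -/
theorem measure_walk_le_rotation {j : ℕ} {t σ : ℝ} (ht : 0 ≤ t) :
    (seqLaw ν).real {x | walk d x j ∈ Set.Icc (-t) σ} ≤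
      (j + 1) * (seqLaw ν).real {x | (∀ k ≤ j, -t ≤ walk d x k) ∧ walk d x j ≤ σ} := by
  set D : Set (ℕ → ℝ) := {x | (∀ k ≤ j, -t ≤ walk d x k) ∧ walk d x j ≤ σ} with hD
  have hmD : MeasurableSet D :=
    measurableSet_setOfPred.2 ((Measurable.forall fun k => measurable_const.imp
      (measurableSet_setOfPred.1 (measurableSet_le measurable_const (measurable_walk k)))).and
      (measurableSet_setOfPred.1 (measurableSet_le (measurable_walk j) measurable_const)))
  -- The first `j` indices are rotated by `r`, the others are fixed. Being injective, the map
  -- preserves the law of the sequence.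
  set rot : ℕ → ℕ → ℕ := fun r i =>
    if i + r < j then i + r else if i < j then i + r - j else i with hrot
  have hinj : ∀ r ≤ j, Function.Injective (rot r) := by
    intro r hr i i' h
    simp only [hrot] at h
    split_ifs at h <;> omega
  have hwalk1 : ∀ r ≤ j, ∀ (x : ℕ → ℝ) k, k + r ≤ j →
      walk d (fun i => x (rot r i)) k = walk d x (r + k) - walk d x r := by
    intro r hr x k hk
    rw [← walk_shift]
    refine walk_congr fun i hi => ?_
    simp only [hrot, shift, show i + r < j by omega, if_true]
    rw [add_comm]
  have hwalk2 : ∀ r ≤ j, ∀ (x : ℕ → ℝ) k, k ≤ r →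
      walk d (fun i => x (rot r i)) (j - r + k) = walk d x j - walk d x r + walk d x k := by
    intro r hr x k hk
    have h1 := hwalk1 r hr x (j - r) (by omega)
    rw [show r + (j - r) = j by omega] at h1
    have h2 := walk_shift (d := d) (fun i => x (rot r i)) (j - r) k
    rw [h1] at h2
    have h3 : walk d (shift (j - r) fun i => x (rot r i)) k = walk d x k := by
      refine walk_congr fun i hi => ?_
      simp only [hrot, shift, show ¬ (j - r + i + r < j) by omega,
        show j - r + i < j by omega, if_true, if_false]
      congr 1
      omega
    linarith
  -- Rotate at a minimiser `r` of the walk. Before the wrap-around, the new partial sums are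
  -- nonnegative; after it they are at least the final value, hence at least `-t`.
  have hsub : {x | walk d x j ∈ Set.Icc (-t) σ} ⊆
      ⋃ r ∈ Finset.range (j + 1), {x | (fun i => x (rot r i)) ∈ D} := by
    rintro x ⟨hx1, hx2⟩
    obtain ⟨r, hr, hmin⟩ := Finset.exists_min_image (Finset.range (j + 1)) (walk d x)
      ⟨0, Finset.mem_range.2 (Nat.succ_pos j)⟩
    have hrj : r ≤ j := by have := Finset.mem_range.1 hr; omega
    have h0 : walk d x r ≤ 0 := by
      have := hmin 0 (Finset.mem_range.2 (Nat.succ_pos j))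
      simpa using this
    refine Set.mem_iUnion₂.2 ⟨r, hr, fun k hk => ?_, ?_⟩
    · rcases le_or_gt (k + r) j with h | h
      · rw [hwalk1 r hrj x k h]
        have := hmin (r + k) (Finset.mem_range.2 (by omega))
        linarith
      · obtain ⟨i, rfl⟩ := Nat.exists_eq_add_of_le (show j - r ≤ k by omega)
        rw [hwalk2 r hrj x i (by omega)]
        have := hmin i (Finset.mem_range.2 (by omega))
        linarith
    · have := hwalk2 r hrj x r le_rfl
      rw [Nat.sub_add_cancel hrj] at this
      rw [this]
      linarith
  refine ((measureReal_mono hsub (measure_ne_top _ _)).trans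
      (measureReal_biUnion_finset_le _ _)).trans ?_
  have hrotD : ∀ r ∈ Finset.range (j + 1),
      (seqLaw ν).real {x | (fun i => x (rot r i)) ∈ D} = (seqLaw ν).real D := by
    intro r hr
    have hr' : r ≤ j := by have := Finset.mem_range.1 hr; omega
    conv_rhs => rw [← map_comp_injective_seqLaw (ν := ν) (hinj r hr')]
    rw [measureReal_def, measureReal_def, Measure.map_apply
      (measurable_pi_iff.2 fun i => measurable_pi_apply _) hmD]
    rfl
  rw [Finset.sum_congr rfl hrotD]
  simp

end Pair

theorem psum_add {K : ℕ} (e : Env K) (k : Fin K) (m n : ℕ) :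
    psum e.1 k (m + n) = psum e.1 k m + ∑ i ∈ Finset.range n, window k m e i := by
  simp only [psum, Finset.sum_range_add, window, shift]

theorem psum_add_walk {K : ℕ} (d : ℝ) (e : Env K) (k : Fin K) (m n : ℕ) :
    psum e.1 k (m + n) = psum e.1 k m + walk d (window k m e) n + n * d := by
  rw [psum_add, walk_eq]; ring

theorem sum_ite_lt_eq (s₁ s₂ : ℝ) {n r : ℕ} (hr : r ≤ n) :
    ∑ i ∈ Finset.range n, (if i < r then s₂ else s₁) = n * s₁ + r * (s₂ - s₁) := by
  obtain ⟨k, rfl⟩ := Nat.exists_eq_add_of_le hr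
  rw [Finset.sum_range_add, Finset.sum_congr rfl (g := fun _ => s₂) fun i hi => if_pos
      (Finset.mem_range.1 hi)]
  simp
  ring

/-! ### Breaking ties between reward sums -/

section NoTie

variable {K : ℕ} {Ω : Type u} [MeasurableSpace Ω] {P : Measure Ω} [IsProbabilityMeasure P]
    {ν : Fin K → Measure ℝ} {Y : Fin K → ℕ → Ω → ℝ} {U : ℕ → Fin K → Ω → ℝ}

/-- The reward sums of the arms of `𝒦` at level `m` are distinct. -/
def NoTie (𝒦 : Finset (Fin K)) (m : ℕ) : Set (Env K) :=
  {e | ∀ a ∈ 𝒦, ∀ b ∈ 𝒦, a ≠ b → psum e.1 a m ≠ psum e.1 b m}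

theorem measurableSet_noTie (𝒦 : Finset (Fin K)) (m : ℕ) : MeasurableSet (NoTie 𝒦 m) := by
  refine measurableSet_setOfPred.2 (Measurable.forall fun a => measurable_const.imp
    (Measurable.forall fun b => measurable_const.imp (measurable_const.imp (Measurable.not ?_))))
  exact measurableSet_setOfPred.1 (measurableSet_eq_fun (measurable_psum a m) (measurable_psum b m))

/-- Whatever happened before level `m`, ties at level `m + K` are avoided with a probability
bounded from below. -/
theorem exists_noTie {ν₀ : Measure ℝ} [IsProbabilityMeasure ν₀] {d lam : ℝ}
    (hp : Pair ν₀ d lam) (K : ℕ) : ∃ c, 0 < c ∧ c ≤ 1 ∧ ∀ (𝒦 : Finset (Fin K))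
        (ν : Fin K → Measure ℝ),
      (∀ b ∈ 𝒦, ν b = ν₀) → ∀ (Ω : Type u) [MeasurableSpace Ω] (P : Measure Ω)
      [IsProbabilityMeasure P] (Y : Fin K → ℕ → Ω → ℝ) (U : ℕ → Fin K → Ω → ℝ),
      IsBandit P ν Y U → ∀ (m : ℕ) (A : Set (Env K)), MeasurableSet A → Local {p | p.2 < m} A →
      c * P.real {ω | env Y U ω ∈ A} ≤ P.real {ω | env Y U ω ∈ A ∩ NoTie 𝒦 (m + K)} := by
  classical
  obtain ⟨s₁, s₂, hs, hballs⟩ := exists_balls hp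
  -- The radius is such that `K` deviations on either side add up to less than the gap `s₂ - s₁`.
  set r := (s₂ - s₁) / (4 * (K + 1)) with hr
  have hr0 : 0 < r := div_pos (sub_pos.2 hs) (by positivity)
  obtain ⟨hb1, hb2⟩ := hballs r hr0
  set B : ℕ → ℕ → Set ℝ := fun ρ i =>
    if i < ρ then Set.Icc (s₂ - r) (s₂ + r) else Set.Icc (s₁ - r) (s₁ + r) with hB
  have hmB : ∀ ρ i, MeasurableSet (B ρ i) := by
    intro ρ i
    simp only [hB]
    split_ifs <;> exact measurableSet_Icc
  set T : ℕ → Set (ℕ → ℝ) := fun ρ => {x | ∀ i < K, x i ∈ B ρ i} with hT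
  have hmT : ∀ ρ, MeasurableSet (T ρ) := fun ρ => measurableSet_setOfPred.2
    (Measurable.forall fun i => measurable_const.imp
      (measurableSet_setOfPred.1 (measurable_pi_apply i (hmB ρ i))))
  set β := min (ν₀.real (Set.Icc (s₁ - r) (s₁ + r))) (ν₀.real (Set.Icc (s₂ - r) (s₂ + r))) with hβ
  have hβ0 : 0 < β := lt_min hb1 hb2
  have hβ1 : β ≤ 1 := (min_le_left _ _).trans measureReal_le_one
  have hTge : ∀ ρ, β ^ K ≤ (seqLaw ν₀).real (T ρ) := by
    intro ρ
    rw [hT, seqLaw_forall_lt K (hmB ρ), ← Finset.card_range K, ← Finset.prod_const,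
      Finset.card_range]
    refine Finset.prod_le_prod (fun _ _ => hβ0.le) fun i _ => ?_
    simp only [hB]
    split_ifs
    · exact min_le_right _ _
    · exact min_le_left _ _
  have hsum1 : ∀ ρ ≤ K, ∀ x ∈ T ρ, ∑ i ∈ Finset.range K, x i ≤ K * s₁ + ρ * (s₂ - s₁) + K * r := by
    intro ρ hρ x hx
    rw [← sum_ite_lt_eq s₁ s₂ hρ]
    have h1 : ∑ i ∈ Finset.range K, x i ≤ ∑ i ∈ Finset.range K,
        ((if i < ρ then s₂ else s₁) + r) := by
      refine Finset.sum_le_sum fun i hi => ?_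
      have := hx i (Finset.mem_range.1 hi)
      simp only [hB] at this
      split_ifs at this ⊢ <;> exact this.2
    rwa [Finset.sum_add_distrib, Finset.sum_const, Finset.card_range, nsmul_eq_mul] at h1
  have hsum2 : ∀ ρ ≤ K, ∀ x ∈ T ρ, K * s₁ + ρ * (s₂ - s₁) - K * r ≤ ∑ i ∈ Finset.range K, x i := by
    intro ρ hρ x hx
    rw [← sum_ite_lt_eq s₁ s₂ hρ]
    have h1 : ∑ i ∈ Finset.range K, ((if i < ρ then s₂ else s₁) - r) ≤ ∑ i ∈ Finset.range K, x
        i := by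
      refine Finset.sum_le_sum fun i hi => ?_
      have := hx i (Finset.mem_range.1 hi)
      simp only [hB] at this
      split_ifs at this ⊢ <;> exact this.1
    rwa [Finset.sum_sub_distrib, Finset.sum_const, Finset.card_range, nsmul_eq_mul] at h1
  have hKr : 2 * (K * r) < s₂ - s₁ := by
    rw [hr]
    have : (0 : ℝ) ≤ K := Nat.cast_nonneg K
    rw [mul_div_assoc', mul_div_assoc', div_lt_iff₀ (by positivity)]
    nlinarith
  have hN0 : (0 : ℝ) < Fintype.card (Equiv.Perm (Fin K)) := by exact_mod_cast Fintype.card_pos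
  have hN1 : (1 : ℝ) ≤ Fintype.card (Equiv.Perm (Fin K)) := by exact_mod_cast Fintype.card_pos
  have hβK : β ^ K ≤ 1 := pow_le_one₀ hβ0.le hβ1
  refine ⟨(β ^ K) ^ K / Fintype.card (Equiv.Perm (Fin K)), by positivity,
    (div_le_one hN0).2 ((pow_le_one₀ (by positivity) hβK).trans hN1), ?_⟩
  intro 𝒦 ν hν Ω _ P _ Y U hban m A hA hloc
  -- Order the arms by their sums at level `m`. Over the next `K` rewards, let the arm of rank `i`
  -- receive `i` values near `s₂` and the others near `s₁`: the weak order of the sums becomes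
  -- strict. Fixing the most likely permutation costs only a constant factor.
  set G : Equiv.Perm (Fin K) → Set (Env K) := fun σ =>
    {e | ∀ i j : Fin K, i ≤ j → psum e.1 (σ i) m ≤ psum e.1 (σ j) m} with hG
  have hmG : ∀ σ, MeasurableSet (G σ) := fun σ => measurableSet_setOfPred.2
    (Measurable.forall fun i => Measurable.forall fun j => measurable_const.imp
      (measurableSet_setOfPred.1 (measurableSet_le (measurable_psum _ m) (measurable_psum _ m))))
  have hlG : ∀ σ, Local {p : Fin K × ℕ | p.2 < m} (G σ) := by
    intro σ y y' u hy h i j hij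
    have hc : ∀ k, psum y k m = psum y' k m := fun k => psum_congr fun i hi => hy (k, i) hi
    have := h i j hij
    simp only [hc] at this
    exact this
  have hcover : {ω | env Y U ω ∈ A} ⊆ ⋃ σ ∈ (Finset.univ : Finset (Equiv.Perm (Fin K))),
      {ω | env Y U ω ∈ A ∩ G σ} := by
    intro ω hω
    refine Set.mem_iUnion₂.2 ⟨Tuple.sort fun k => psum (env Y U ω).1 k m, Finset.mem_univ _, hω, ?_⟩
    intro i j hij
    exact Tuple.monotone_sort (fun k => psum (env Y U ω).1 k m) hij
  obtain ⟨σ, -, hσ⟩ : ∃ σ ∈ (Finset.univ : Finset (Equiv.Perm (Fin K))),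
      P.real {ω | env Y U ω ∈ A} / Fintype.card (Equiv.Perm (Fin K)) ≤
        P.real {ω | env Y U ω ∈ A ∩ G σ} := by
    refine Finset.exists_le_of_sum_le Finset.univ_nonempty ?_
    rw [Finset.sum_const, Finset.card_univ, nsmul_eq_mul, mul_div_cancel₀ _ hN0.ne']
    exact (measureReal_mono hcover (measure_ne_top _ _)).trans (measureReal_biUnion_finset_le _ _)
  have hw := measure_inter_windows hban (N := fun _ => m) (hA.inter (hmG σ))
    (hloc.inter (hlG σ)) (T := fun k => T (σ.symm k)) (fun k => hmT _) 𝒦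
  have hprod : (β ^ K) ^ K ≤ ∏ k ∈ 𝒦, (seqLaw (ν k)).real (T (σ.symm k)) := by
    have h1 : 𝒦.card ≤ K := by simpa using 𝒦.card_le_univ
    refine (pow_le_pow_of_le_one (by positivity) hβK h1).trans ?_
    rw [← Finset.prod_const]
    refine Finset.prod_le_prod (fun _ _ => by positivity) fun k hk => ?_
    rw [hν k hk]
    exact hTge _
  calc (β ^ K) ^ K / Fintype.card (Equiv.Perm (Fin K)) * P.real {ω | env Y U ω ∈ A}
      = P.real {ω | env Y U ω ∈ A} / Fintype.card (Equiv.Perm (Fin K)) * (β ^ K) ^ K := by ring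
    _ ≤ P.real {ω | env Y U ω ∈ A ∩ G σ} * ∏ k ∈ 𝒦, (seqLaw (ν k)).real (T (σ.symm k)) := by
        gcongr
    _ ≤ _ := by
        rw [← hw]
        refine measureReal_mono ?_
        rintro ω ⟨⟨h1, h2⟩, h3⟩
        refine ⟨h1, ?_⟩
        have key : ∀ i i' : Fin K, σ i ∈ 𝒦 → σ i' ∈ 𝒦 → i < i' →
            psum (env Y U ω).1 (σ i) (m + K) < psum (env Y U ω).1 (σ i') (m + K) := by
          intro i i' hi hi' hlt
          have a1 := hsum1 i i.2.le _ (by simpa using h3 _ hi)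
          have a2 := hsum2 i' i'.2.le _ (by simpa using h3 _ hi')
          have a3 := h2 i i' hlt.le
          rw [psum_add, psum_add]
          have a4 : (i : ℝ) + 1 ≤ i' := by exact_mod_cast hlt
          have a5 : (s₂ - s₁) * ((i : ℝ) + 1) ≤ (s₂ - s₁) * i' :=
            mul_le_mul_of_nonneg_left a4 (sub_pos.2 hs).le
          linarith
        intro a ha b hb hab heq
        obtain ⟨i, rfl⟩ := σ.surjective a
        obtain ⟨i', rfl⟩ := σ.surjective b
        rcases lt_trichotomy i i' with h | h | h
        · exact absurd heq (key i i' ha hb h).ne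
        · exact hab (h ▸ rfl)
        · exact absurd heq (key i' i hb ha h).ne'

end NoTie

/-! ### The loss of probability on one cell of a clean window -/

theorem mul_measureReal_iUnion_le {Ω ι : Type*} [MeasurableSpace Ω] {P : Measure Ω}
    [IsProbabilityMeasure P] [Countable ι] {A B : ι → Set Ω} {q : ℝ}
    (hB : ∀ i, MeasurableSet (B i)) (hBA : ∀ i, B i ⊆ A i)
    (hd : Pairwise (Function.onFun Disjoint A)) (h : ∀ i, q * P.real (A i) ≤ P.real (B i))
    (hq : 0 ≤ q) : q * P.real (⋃ i, A i) ≤ P.real (⋃ i, B i) := by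
  have h1 : ∀ i, ENNReal.ofReal q * P (A i) ≤ P (B i) := by
    intro i
    rw [← ENNReal.ofReal_toReal (measure_ne_top P (A i)),
      ← ENNReal.ofReal_toReal (measure_ne_top P (B i)), ← ENNReal.ofReal_mul hq]
    exact ENNReal.ofReal_le_ofReal (h i)
  have h2 : ENNReal.ofReal q * P (⋃ i, A i) ≤ P (⋃ i, B i) := by
    rw [measure_iUnion (fun i j hij => (hd hij).mono (hBA i) (hBA j)) hB]
    calc ENNReal.ofReal q * P (⋃ i, A i) ≤ ENNReal.ofReal q * ∑' i, P (A i) := by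
          gcongr; exact measure_iUnion_le _
      _ = ∑' i, ENNReal.ofReal q * P (A i) := ENNReal.tsum_mul_left.symm
      _ ≤ _ := ENNReal.tsum_le_tsum h1
  have h3 := ENNReal.toReal_mono (measure_ne_top P _) h2
  rwa [ENNReal.toReal_mul, ENNReal.toReal_ofReal hq] at h3

/-- The walk is nonnegative up to time `ℓ` and its last `j` steps add up to at most `σ`. -/
def Stay (d : ℝ) (ℓ j : ℕ) (σ : ℝ) : Set (ℕ → ℝ) :=
  {x | (∀ k ≤ ℓ, 0 ≤ walk d x k) ∧ walk d x ℓ - walk d x (ℓ - j) ≤ σ}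

theorem measurableSet_stay (d : ℝ) (ℓ j : ℕ) (σ : ℝ) : MeasurableSet (Stay d ℓ j σ) :=
  measurableSet_setOfPred.2 ((Measurable.forall fun k => measurable_const.imp
    (measurableSet_setOfPred.1 (measurableSet_le measurable_const (measurable_walk k)))).and
    (measurableSet_setOfPred.1 (measurableSet_le
      ((measurable_walk ℓ).sub (measurable_walk (ℓ - j))) measurable_const)))

theorem measurableSet_forall_walk_nonpos (d : ℝ) :
    MeasurableSet {x : ℕ → ℝ | ∀ n, walk d x n ≤ 0} :=
  measurableSet_setOfPred.2 (Measurable.forall fun n =>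
    measurableSet_setOfPred.1 (measurableSet_le (measurable_walk n) measurable_const))

/-- The first `j` rewards of arm `s`, compared with `d`, add up to an element of `V`. -/
def Start {K : ℕ} (d : ℝ) (s : Fin K) (j : ℕ) (V : Set ℝ) : Set (Env K) :=
  {e | walk d (e.1 s) j ∈ V}

theorem measurableSet_start {K : ℕ} (d : ℝ) (s : Fin K) (j : ℕ) {V : Set ℝ}
    (hV : MeasurableSet V) : MeasurableSet (Start d s j V) :=
  ((measurable_walk j).comp ((measurable_pi_apply s).comp measurable_fst)) hV

theorem local_start {K : ℕ} (d : ℝ) (s : Fin K) (j : ℕ) (V : Set ℝ) {I : Set (Fin K × ℕ)}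
    (hI : ∀ i < j, (s, i) ∈ I) : Local I (Start d s j V) := by
  intro y y' u hy h
  have : walk d (y s) j = walk d (y' s) j := walk_congr fun i hi => hy (s, i) (hI i hi)
  change walk d (y' s) j ∈ V
  rw [← this]
  exact h

section Cell

variable {K : ℕ} [NeZero K]

/-- At a moment without challengers the leader is pulled and the level is left for good. Each level
has therefore at most one such moment, which makes it usable like a stopping time. -/
theorem regular_disjoint {s : Fin K} {j lo m : ℕ} {𝒦 : Finset (Fin K)} (hm : 1 ≤ m)
    {t t' : ℕ} {N N' : Fin K → ℕ} {a a' : Fin K} (hN : N a = m) (hN' : N' a' = m) {e : Env K}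
    (h : e ∈ Regular s j 𝒦 lo t N a) (h' : e ∈ Regular s j 𝒦 lo t' N' a') :
    t = t' ∧ N = N' ∧ a = a' := by
  have key : ∀ {t t' : ℕ} {N N' : Fin K → ℕ} {a a' : Fin K}, N a = m → N' a' = m →
      e ∈ Regular s j 𝒦 lo t N a → e ∈ Regular s j 𝒦 lo t' N' a' → t' ≤ t := by
    rintro t t' N N' a a' hN hN' ⟨h1, h2, h3, -⟩ ⟨h1', h2', -, -⟩
    by_contra hlt
    have htop : top e.1 e.2 t = m := by rw [← pullCount_lead, h1, h2, hN]
    have htop' : top e.1 e.2 t' = m := by rw [← pullCount_lead, h1', h2', hN']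
    have ht1 : 1 ≤ t := one_le_of_one_le_top (y := e.1) (u := e.2) (by omega)
    have hsel : lead e.1 e.2 t ∈ sel e.1 e.2 t :=
      (mem_sel ht1).2 (Or.inl ⟨rfl, fun k hk => h3 k (h2 ▸ hk)⟩)
    have hle := pullCount_le_top (y := e.1) (u := e.2) (t := t + 1) (k := lead e.1 e.2 t)
    rw [pullCount_succ, if_pos hsel, pullCount_lead] at hle
    have := top_mono (y := e.1) (u := e.2) (show t + 1 ≤ t' by omega)
    omega
  obtain rfl : t = t' := le_antisymm (key hN' hN h' h) (key hN hN' h h')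
  exact ⟨rfl, h.1.symm.trans h'.1, h.2.1.symm.trans h'.2.1⟩

variable {Ω : Type u} [MeasurableSpace Ω] {P : Measure Ω} [IsProbabilityMeasure P]
    {ν : Fin K → Measure ℝ} {Y : Fin K → ℕ → Ω → ℝ} {U : ℕ → Fin K → Ω → ℝ}

/-- Keeping the trajectory clean for `K + ℓ + 1` more levels costs a constant factor. -/
theorem measure_clean_cell (hban : IsBandit P ν Y U) {s : Fin K} {𝒦 : Finset (Fin K)}
    (hs : s ∉ 𝒦) {ν₀ : Measure ℝ} [IsProbabilityMeasure ν₀] (hν : ∀ b ∈ 𝒦, ν b = ν₀)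
    {c q g d σ : ℝ} (hc : 0 ≤ c) {j ℓ lo m : ℕ}
    (htie : ∀ (m : ℕ) (A : Set (Env K)), MeasurableSet A → Local {p | p.2 < m} A →
      c * P.real {ω | env Y U ω ∈ A} ≤ P.real {ω | env Y U ω ∈ A ∩ NoTie 𝒦 (m + K)})
    (hq : 0 ≤ q) (hqle : q ≤ (seqLaw ν₀).real {x | ∀ n, walk d x n ≤ 0})
    (hg : 0 ≤ g) (hgle : g ≤ (seqLaw ν₀).real (Stay d ℓ j σ))
    {V : Set ℝ} (hV : MeasurableSet V) (hVσ : ∀ v ∈ V, σ ≤ v)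
    (hlo : 1 ≤ lo) (hlom : lo ≤ m) (hj : 1 ≤ j) (hjm : j ≤ m) (hjℓ : j ≤ ℓ) :
    P.real {ω | env Y U ω ∈ Start d s j V ∩ {e | Clean e.1 e.2 s j 𝒦 lo (m + K + ℓ + 1)}} ≤
      (1 - c * (q ^ K * g) / 2) *
        P.real {ω | env Y U ω ∈ Start d s j V ∩ {e | Clean e.1 e.2 s j 𝒦 lo m}} := by
  classical
  have hq1 : q ≤ 1 := hqle.trans measureReal_le_one
  have hg1 : g ≤ 1 := hgle.trans measureReal_le_one
  have hmenv := measurable_env hban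
  set A₀ := Start d s j V ∩ {e : Env K | Clean e.1 e.2 s j 𝒦 lo m} with hA₀
  set E₁ := Start d s j V ∩ {e : Env K | Clean e.1 e.2 s j 𝒦 lo (m + K + ℓ + 1)} with hE₁
  have hmA₀ : MeasurableSet A₀ :=
    (measurableSet_start d s j hV).inter (measurableSet_clean s j 𝒦 lo m)
  have hmE₁ : MeasurableSet E₁ :=
    (measurableSet_start d s j hV).inter (measurableSet_clean s j 𝒦 lo _)
  have hlA₀ : Local {p : Fin K × ℕ | p.2 < m} A₀ :=
    (local_start d s j V (I := {p : Fin K × ℕ | p.2 < m}) fun i hi => show i < m by omega).inter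
        (local_clean s j 𝒦 lo m)
  have hE₁A₀ : E₁ ⊆ A₀ := fun e he => ⟨he.1, Clean.mono he.2 (by omega)⟩
  set m' := m + K with hm'
  have hK : 1 ≤ K := Nat.one_le_iff_ne_zero.2 (NeZero.ne K)
  -- The scenario after the stopping moment: the leader `a` follows `Stay`, and its rivals never
  -- rise above the line of slope `d`.
  set T : Fin K → Fin K → Set (ℕ → ℝ) := fun a k =>
    if k = a then Stay d ℓ j σ else {x | ∀ n, walk d x n ≤ 0} with hT
  have hmT : ∀ a k, MeasurableSet (T a k) := by
    intro a k
    simp only [hT]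
    split_ifs
    · exact measurableSet_stay d ℓ j σ
    · exact measurableSet_forall_walk_nonpos d
  let ι := ℕ × (Fin K → ℕ) × Fin K
  -- `St` runs over the possible states (round, pull counts, leader) at the moment of level `m'`
  -- without challengers; `Sc` adds the scenario, independent of the state because it uses rewards
  -- not yet collected.
  set St : ι → Set (Env K) := fun i => {e | e ∈ Regular s j 𝒦 lo i.1 i.2.1 i.2.2 ∧
    e ∈ Start d s j V ∧ i.2.1 i.2.2 = m'} with hSt
  set Sc : ι → Set (Env K) := fun i =>
    {e | e ∈ St i ∧ ∀ k ∈ 𝒦, window k (i.2.1 k) e ∈ T i.2.2 k} with hSc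
  have hmSt : ∀ i, MeasurableSet (St i) := fun i =>
    (measurableSet_regular s j 𝒦 lo i.1 i.2.1 i.2.2).inter
      ((measurableSet_start d s j hV).inter (MeasurableSet.const _))
  have hmSc : ∀ i, MeasurableSet (Sc i) := fun i =>
    (hmSt i).inter (measurableSet_setOfPred.2 (Measurable.forall fun k => measurable_const.imp
      (measurableSet_setOfPred.1 (measurable_window k _ (hmT _ k)))))
  have hvalid : ∀ i e, e ∈ St i → i.2.2 ∈ 𝒦 ∧ i.2.1 s = j ∧ top e.1 e.2 i.1 = m' := by
    rintro ⟨t, N, a⟩ e ⟨⟨h1, h2, -, h4⟩, -, h5⟩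
    have htop : top e.1 e.2 t = m' := by
      rw [← pullCount_lead, h1, h2]; exact h5
    have hcl := h4 t le_rfl (by omega)
    exact ⟨h2 ▸ hcl.2.2.1, h1 ▸ hcl.1, htop⟩
  have hprob : ∀ i, (q ^ K * g) * P.real {ω | env Y U ω ∈ St i} ≤
      P.real {ω | env Y U ω ∈ Sc i} := by
    intro i
    by_cases hne : ∃ e, e ∈ St i
    · obtain ⟨e₀, he₀⟩ := hne
      obtain ⟨ha, hNs, -⟩ := hvalid i e₀ he₀
      have hloc : Local {p : Fin K × ℕ | p.2 < i.2.1 p.1} (St i) := by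
        have h1 := (local_regular s j 𝒦 lo i.1 i.2.1 i.2.2).inter
          (local_start d s j V (I := {p : Fin K × ℕ | p.2 < i.2.1 p.1}) fun n hn => by
            change n < i.2.1 s; omega)
        intro y y' u hy h
        exact ⟨(h1 y y' u hy ⟨h.1, h.2.1⟩).1, (h1 y y' u hy ⟨h.1, h.2.1⟩).2, h.2.2⟩
      have hw := measure_inter_windows hban (N := i.2.1) (hmSt i) hloc
        (T := T i.2.2) (hmT i.2.2) 𝒦
      change _ ≤ P.real {ω | env Y U ω ∈ St i ∧
        ∀ k ∈ 𝒦, window k (i.2.1 k) (env Y U ω) ∈ T i.2.2 k}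
      rw [hw, mul_comm]
      refine mul_le_mul_of_nonneg_left ?_ measureReal_nonneg
      rw [← Finset.mul_prod_erase 𝒦 _ ha, hν _ ha, mul_comm]
      refine mul_le_mul (by simpa [hT] using hgle) ?_ (by positivity) measureReal_nonneg
      have hcard : (𝒦.erase i.2.2).card ≤ K := by simpa using (𝒦.erase i.2.2).card_le_univ
      refine (pow_le_pow_of_le_one hq hq1 hcard).trans ?_
      rw [← Finset.prod_const]
      refine Finset.prod_le_prod (fun _ _ => hq) fun k hk => ?_
      rw [hν k (Finset.mem_of_mem_erase hk)]
      simp only [hT, Finset.ne_of_mem_erase hk, if_false]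
      exact hqle
    · have h0 : {ω | env Y U ω ∈ St i} = ∅ := by
        ext ω
        simp only [Set.mem_ofPred_eq, Set.mem_empty_iff_false, iff_false]
        exact fun h => hne ⟨_, h⟩
      rw [h0]
      simp
  have hdisj : Pairwise (Function.onFun Disjoint fun i => {ω | env Y U ω ∈ St i}) := by
    rintro ⟨t, N, a⟩ ⟨t', N', a'⟩ hne
    refine Set.disjoint_left.2 fun ω h h' => hne ?_
    obtain ⟨rfl, rfl, rfl⟩ := regular_disjoint (m := m') (by omega) h.2.2 h'.2.2 h.1 h'.1
    rfl
  have hbig := mul_measureReal_iUnion_le (P := P) (A := fun i => {ω | env Y U ω ∈ St i})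
    (B := fun i => {ω | env Y U ω ∈ Sc i}) (fun i => hmenv (hmSc i)) (fun i ω h => h.1) hdisj hprob
    (by positivity)
  -- the three inclusions
  have hScA₀ : (⋃ i, {ω | env Y U ω ∈ Sc i}) ⊆ {ω | env Y U ω ∈ A₀} \ {ω | env Y U ω ∈ E₁} := by
    intro ω hω
    obtain ⟨⟨t, N, a⟩, hi⟩ := Set.mem_iUnion.1 hω
    obtain ⟨hi1, hi2⟩ : env Y U ω ∈ St (t, N, a) ∧
      ∀ k ∈ 𝒦, window k (N k) (env Y U ω) ∈ T a k := hi
    obtain ⟨haK, -, htop⟩ := hvalid _ _ hi1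
    obtain ⟨⟨h1, h2, h3, h4⟩, h5, h6⟩ := hi1
    set e := env Y U ω
    simp only at h1 h2 h3 h4 h6 haK htop
    refine ⟨⟨h5, fun t' ht1 ht2 => h4 t' ?_ ht1⟩, ?_⟩
    · by_contra hlt
      have := top_mono (y := e.1) (u := e.2) (show t ≤ t' by omega)
      change top e.1 e.2 t' < m at ht2
      omega
    -- In the scenario the leader's last `j` rewards do not beat those of `s`, against
    -- `psum_lt_of_clean`; so the enlarged window cannot be clean.
    · rintro ⟨-, hcl⟩
      have hstay : window a m' e ∈ Stay d ℓ j σ := by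
        have := hi2 a haK
        simp only [hT, if_true] at this
        rwa [h6] at this
      have hps : psum e.1 s j = walk d (e.1 s) j + j * d := by
        rw [walk_eq, psum]; ring
      have hlt := psum_lt_of_clean (d := d) (ℓ := ℓ) (m := m') hs hlo (by omega) (by omega) hcl htop
        (fun k hk => h3 k (h2 ▸ hk)) (fun b hb hba i _ => ?_) (fun i hi => ?_)
      · rw [h2, psum_add_walk d e a m' ℓ, Nat.add_sub_assoc hjℓ, psum_add_walk d e a m' (ℓ - j),
          hps] at hlt
        have hcast : ((ℓ - j : ℕ) : ℝ) = ℓ - j := Nat.cast_sub hjℓ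
        have h7 := hstay.2
        have h8 := hVσ _ h5
        rw [hcast] at hlt
        linarith
      · have hb' := hi2 b hb
        have hba' : b ≠ a := h2 ▸ hba
        simp only [hT, hba', if_false] at hb'
        rw [h1, psum_add_walk d]
        have := hb' i
        linarith
      · rw [h2, psum_add_walk d]
        have := hstay.1 i hi
        linarith
  have hE₁St : {ω | env Y U ω ∈ E₁ ∩ NoTie 𝒦 m'} ⊆ ⋃ i, {ω | env Y U ω ∈ St i} := by
    rintro ω ⟨⟨h1, h2⟩, h3⟩
    obtain ⟨t, ht1, ht2⟩ := exists_no_chal (m := m') hlo (by omega)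
      (Clean.mono h2 (show m' + 2 ≤ m + K + ℓ + 1 by omega)) h3
    refine Set.mem_iUnion.2 ⟨(t, pullCount (env Y U ω).1 (env Y U ω).2 t,
      lead (env Y U ω).1 (env Y U ω).2 t), ⟨rfl, rfl, ht2, fun t' ht' h => h2 t' h ?_⟩, h1, ?_⟩
    · have := top_mono (y := (env Y U ω).1) (u := (env Y U ω).2) ht'
      simp only at this
      omega
    · change pullCount _ _ t _ = m'
      rw [pullCount_lead, ht1]
  have hx := htie m A₀ hmA₀ hlA₀
  have hmtie := measurableSet_noTie 𝒦 m'
  have i1 : P.real (⋃ i, {ω | env Y U ω ∈ Sc i}) ≤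
      P.real {ω | env Y U ω ∈ A₀} - P.real {ω | env Y U ω ∈ E₁} := by
    have hsub : {ω | env Y U ω ∈ E₁} ⊆ {ω | env Y U ω ∈ A₀} := fun ω h => hE₁A₀ h
    rw [← measureReal_sdiff hsub (hmenv hmE₁)]
    exact measureReal_mono hScA₀
  have i2 : P.real {ω | env Y U ω ∈ E₁ ∩ NoTie 𝒦 m'} ≤ P.real (⋃ i, {ω | env Y U ω ∈ St i}) :=
    measureReal_mono hE₁St
  have i3 : P.real {ω | env Y U ω ∈ E₁} + P.real {ω | env Y U ω ∈ A₀ ∩ NoTie 𝒦 m'} ≤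
      P.real {ω | env Y U ω ∈ A₀} + P.real {ω | env Y U ω ∈ E₁ ∩ NoTie 𝒦 m'} := by
    have h1 := measureReal_inter_add_sdiff (μ := P) (s := {ω | env Y U ω ∈ E₁}) (hmenv hmtie)
    have h2 := measureReal_inter_add_sdiff (μ := P) (s := {ω | env Y U ω ∈ A₀}) (hmenv hmtie)
    have h3 : P.real ({ω | env Y U ω ∈ E₁} \ (env Y U ⁻¹' NoTie 𝒦 m')) ≤
        P.real ({ω | env Y U ω ∈ A₀} \ (env Y U ⁻¹' NoTie 𝒦 m')) :=
      measureReal_mono fun ω h => ⟨hE₁A₀ h.1, h.2⟩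
    have e1 : {ω | env Y U ω ∈ E₁ ∩ NoTie 𝒦 m'} =
      {ω | env Y U ω ∈ E₁} ∩ env Y U ⁻¹' NoTie 𝒦 m' := rfl
    have e2 : {ω | env Y U ω ∈ A₀ ∩ NoTie 𝒦 m'} =
      {ω | env Y U ω ∈ A₀} ∩ env Y U ⁻¹' NoTie 𝒦 m' := rfl
    rw [e1, e2]
    linarith
  set pA := P.real {ω | env Y U ω ∈ A₀}
  set pE := P.real {ω | env Y U ω ∈ E₁}
  set Q := q ^ K * g
  have hQ0 : 0 ≤ Q := by positivity
  have hQ1 : Q ≤ 1 := mul_le_one₀ (pow_le_one₀ hq hq1) hg hg1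
  have hA0 : 0 ≤ pA := measureReal_nonneg
  -- A clean continuation without tie passes through some `St`, which has probability at least `pE -
  -- (1 - c) pA`; a fraction `Q` of it is lost. Solving for `pE` gives the factor `1 - c Q / (1 +
  -- Q)`, at most `1 - c Q / 2` as `Q ≤ 1`.
  have h4 : Q * (pE - (1 - c) * pA) ≤ pA - pE := by
    refine le_trans ?_ (hbig.trans i1)
    refine mul_le_mul_of_nonneg_left ?_ hQ0
    linarith
  have h5 : pE * (1 + Q) ≤ (1 - c * Q / 2) * pA * (1 + Q) := by
    have : 0 ≤ c * Q * pA * (1 - Q) := by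
      have := sub_nonneg.2 hQ1
      positivity
    nlinarith
  exact le_of_mul_le_mul_right h5 (by linarith)

end Cell

/-- Inner regularity makes it possible to assume that the infimum and the supremum of the set of
values belong to it, so that bounds valid on `V` apply at these points. -/
theorem measureReal_le_of_compact {μ : Measure ℝ} [IsFiniteMeasure μ] {V : Set ℝ}
    (hV : MeasurableSet V) {B : ℝ} (hB : 0 ≤ B)
    (h : ∀ C ⊆ V, IsCompact C → C.Nonempty → μ.real C ≤ B) : μ.real V ≤ B := by
  refine ENNReal.toReal_le_of_le_ofReal hB ?_
  rw [hV.measure_eq_iSup_isCompact]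
  refine iSup₂_le fun C hC => iSup_le fun hc => ?_
  rcases C.eq_empty_or_nonempty with rfl | hne
  · simp
  rw [← ENNReal.ofReal_toReal (measure_ne_top μ C)]
  exact ENNReal.ofReal_le_ofReal (h C hC hc hne)

/-- The bound is inversely proportional to `h` so that the factors of `h` can cancel against the
probability of the initial event. -/
theorem one_sub_pow_le {h : ℝ} (h0 : 0 < h) (h1 : h ≤ 1) {n : ℕ} (hn : 1 ≤ n) :
    (1 - h) ^ n ≤ 1 / (n * h) := by
  have hn0 : (0 : ℝ) < n := by exact_mod_cast hn
  calc (1 - h) ^ n ≤ Real.exp (-h) ^ n :=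
        pow_le_pow_left₀ (by linarith) (by linarith [Real.add_one_le_exp (-h)]) n
    _ = (Real.exp (n * h))⁻¹ := by rw [← Real.exp_nat_mul, ← Real.exp_neg]; congr 1; ring
    _ ≤ _ := by
        rw [← one_div]
        exact one_div_le_one_div_of_le (by positivity) (by linarith [Real.add_one_le_exp (n * h)])

section Laws

variable {ν : Measure ℝ} [IsProbabilityMeasure ν] {d lam : ℝ}

/-- Climb to height `t` without becoming negative, then make `j` steps that never fall by more than
`t` and end at most at `σ`. The rotation lemma gives the second probability with a loss of `j + 1`.
-/
theorem mul_le_measure_stay {j L t : ℕ} {σ c : ℝ}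
    (hc : c * Real.exp (-(lam * t)) ≤ (seqLaw ν).real (Boost d t L)) :
    c * Real.exp (-(lam * t)) *
        ((seqLaw ν).real {x | walk d x j ∈ Set.Icc (-(t : ℝ)) σ} / (j + 1)) ≤
      (seqLaw ν).real (Stay d (L + j) j σ) := by
  have hmD : MeasurableSet {x : ℕ → ℝ | (∀ k ≤ j, -(t : ℝ) ≤ walk d x k) ∧ walk d x j ≤ σ} :=
    measurableSet_setOfPred.2 ((Measurable.forall fun k => measurable_const.imp
      (measurableSet_setOfPred.1 (measurableSet_le measurable_const (measurable_walk k)))).and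
      (measurableSet_setOfPred.1 (measurableSet_le (measurable_walk j) measurable_const)))
  have hrot := measure_walk_le_rotation (ν := ν) (d := d) (j := j) (σ := σ) t.cast_nonneg
  have h1 : (seqLaw ν).real {x | walk d x j ∈ Set.Icc (-(t : ℝ)) σ} / (j + 1) ≤
      (seqLaw ν).real {x | (∀ k ≤ j, -(t : ℝ) ≤ walk d x k) ∧ walk d x j ≤ σ} := by
    rw [div_le_iff₀ (by positivity)]
    linarith
  refine (mul_le_mul hc h1 (by positivity) measureReal_nonneg).trans ?_
  rw [← seqLaw_inter_shift (measurableSet_boost d t L) (decidedBy_boost d t L) hmD]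
  refine measureReal_mono ?_
  rintro x ⟨⟨h1, h2⟩, h3, h4⟩
  refine ⟨fun k hk => ?_, ?_⟩
  · rcases le_or_gt k L with h | h
    · exact h1 k h
    · obtain ⟨i, rfl⟩ := Nat.exists_eq_add_of_le h.le
      have := h3 i (by omega)
      rw [walk_shift] at this
      linarith
  · rw [walk_shift] at h4
    rwa [Nat.add_sub_cancel]

end Laws

/-! ### The probability of a clean window -/

section Clean

variable {K : ℕ} [NeZero K] {Ω : Type u} [MeasurableSpace Ω] {P : Measure Ω}
    [IsProbabilityMeasure P]
    {ν : Fin K → Measure ℝ} {Y : Fin K → ℕ → Ω → ℝ} {U : ℕ → Fin K → Ω → ℝ}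

theorem measure_clean_cells (hban : IsBandit P ν Y U) {s : Fin K} {𝒦 : Finset (Fin K)}
    (hs : s ∉ 𝒦) {ν₀ : Measure ℝ} [IsProbabilityMeasure ν₀] (hν : ∀ b ∈ 𝒦, ν b = ν₀)
    {c q g d σ : ℝ} (hc : 0 ≤ c) (hc1 : c ≤ 1) {j ℓ lo : ℕ}
    (htie : ∀ (m : ℕ) (A : Set (Env K)), MeasurableSet A → Local {p | p.2 < m} A →
      c * P.real {ω | env Y U ω ∈ A} ≤ P.real {ω | env Y U ω ∈ A ∩ NoTie 𝒦 (m + K)})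
    (hq : 0 ≤ q) (hqle : q ≤ (seqLaw ν₀).real {x | ∀ n, walk d x n ≤ 0})
    (hg : 0 ≤ g) (hgle : g ≤ (seqLaw ν₀).real (Stay d ℓ j σ))
    {V : Set ℝ} (hV : MeasurableSet V) (hVσ : ∀ v ∈ V, σ ≤ v)
    (hlo : j ≤ lo) (hj : 1 ≤ j) (hjℓ : j ≤ ℓ) (n : ℕ) :
    P.real {ω | env Y U ω ∈ Start d s j V ∩
        {e | Clean e.1 e.2 s j 𝒦 lo (lo + n * (K + ℓ + 1))}} ≤
      (1 - c * (q ^ K * g) / 2) ^ n * P.real {ω | env Y U ω ∈ Start d s j V} := by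
  have hh : 0 ≤ 1 - c * (q ^ K * g) / 2 := by
    have hq1 : q ≤ 1 := hqle.trans measureReal_le_one
    have hg1 : g ≤ 1 := hgle.trans measureReal_le_one
    have h1 : q ^ K * g ≤ 1 := mul_le_one₀ (pow_le_one₀ hq hq1) hg hg1
    have h2 : c * (q ^ K * g) ≤ 1 := mul_le_one₀ hc1 (by positivity) h1
    linarith
  induction n with
  | zero =>
    rw [pow_zero, one_mul]
    exact measureReal_mono fun ω h => h.1
  | succ n ih =>
    have h := measure_clean_cell hban hs hν hc htie hq hqle hg hgle hV hVσ (lo := lo)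
      (m := lo + n * (K + ℓ + 1)) (by omega) (by omega) hj (by omega) hjℓ
    rw [show lo + n * (K + ℓ + 1) + K + ℓ + 1 = lo + (n + 1) * (K + ℓ + 1) by ring] at h
    refine h.trans ((mul_le_mul_of_nonneg_left ih hh).trans ?_)
    rw [pow_succ]
    apply le_of_eq
    ring

omit [NeZero K] [IsProbabilityMeasure P] in
theorem measure_start (hban : IsBandit P ν Y U) {s : Fin K} (d : ℝ) (j : ℕ) {V : Set ℝ}
    [IsProbabilityMeasure (ν s)] (hV : MeasurableSet V) :
    P.real {ω | env Y U ω ∈ Start d s j V} = (seqLaw (ν s)).real {x | walk d x j ∈ V} := by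
  rw [← measure_window hban s 0 (T := {x | walk d x j ∈ V}) (measurable_walk j hV)]
  congr 1
  ext ω
  have h0 : shift 0 ((env Y U ω).1 s) = (env Y U ω).1 s := funext fun i => by simp [shift]
  simp [Start, window, h0]

/-- A clean trajectory along which arm `s` has a large empirical mean: the leaders would
repeatedly have to produce large block means. -/
theorem measure_clean_start_nonneg (hban : IsBandit P ν Y U) {s : Fin K} {𝒦 : Finset (Fin K)}
    (hs : s ∉ 𝒦) {ν₀ : Measure ℝ} [IsProbabilityMeasure ν₀] (hν : ∀ b ∈ 𝒦, ν b = ν₀) {d s₀ : ℝ}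
    (hs₀ : 0 ≤ s₀) (hint : Integrable (fun x => Real.exp (s₀ * x)) ν₀) {j lo D n : ℕ} (hj : 1 ≤ j)
    (hlo : j ≤ lo) (hD : n * j < D) :
    P.real {ω | env Y U ω ∈ Start d s j (Set.Ici 0) ∩ {e | Clean e.1 e.2 s j 𝒦 lo (lo + D)}} ≤
      (K * expMom ν₀ d s₀ ^ j) ^ n := by
  have hM0 : 0 < expMom ν₀ d s₀ := expMom_pos hint
  set T : Set (ℕ → ℝ) := {x | 0 ≤ walk d x j} with hT
  have hmT : MeasurableSet T := measurableSet_le measurable_const (measurable_walk j)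
  -- Consider the disjoint blocks of indices of length `j` from `lo` on. At the level where a block
  -- ends, the leader's last `j` rewards are exactly that block and must beat a mean of at least
  -- `d`. The blocks are independent, and the leader is one of at most `K` arms.
  set G : ℕ → Set (Env K) := fun n => {e | ∀ r < n, ∃ a ∈ 𝒦, window a (lo + r * j) e ∈ T} with hG
  have hmG : ∀ n, MeasurableSet (G n) := fun n => measurableSet_setOfPred.2
    (Measurable.forall fun r => measurable_const.imp (Measurable.exists fun a =>
      measurable_const.and (measurableSet_setOfPred.1 (measurable_window a _ hmT))))
  have hlG : ∀ n, Local {p : Fin K × ℕ | p.2 < lo + n * j} (G n) := by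
    intro n y y' u hy h r hr
    obtain ⟨a, ha, hw⟩ := h r hr
    refine ⟨a, ha, ?_⟩
    have hle : (r + 1) * j ≤ n * j := Nat.mul_le_mul_right j hr
    have : walk d (window a (lo + r * j) (y, u)) j = walk d (window a (lo + r * j) (y', u)) j :=
      walk_congr fun i hi => hy (a, lo + r * j + i) (by
        change lo + r * j + i < lo + n * j
        rw [add_mul, one_mul] at hle
        omega)
    change 0 ≤ walk d (window a (lo + r * j) (y', u)) j
    rw [← this]
    exact hw
  have hP : ∀ n, P.real {ω | env Y U ω ∈ G n} ≤ (K * expMom ν₀ d s₀ ^ j) ^ n := by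
    intro n
    induction n with
    | zero => simp
    | succ n ih =>
      have hsub : {ω | env Y U ω ∈ G (n + 1)} ⊆ ⋃ a ∈ 𝒦,
          {ω | env Y U ω ∈ G n ∧ window a (lo + n * j) (env Y U ω) ∈ T} := by
        intro ω hω
        obtain ⟨a, ha, hw⟩ := hω n (Nat.lt_succ_self n)
        exact Set.mem_iUnion₂.2 ⟨a, ha, fun r hr => hω r (by omega), hw⟩
      refine ((measureReal_mono hsub (measure_ne_top _ _)).trans
        (measureReal_biUnion_finset_le _ _)).trans ?_
      have hterm : ∀ a ∈ 𝒦, P.real {ω | env Y U ω ∈ G n ∧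
          window a (lo + n * j) (env Y U ω) ∈ T} ≤
            (K * expMom ν₀ d s₀ ^ j) ^ n * expMom ν₀ d s₀ ^ j := by
        intro a ha
        rw [measure_inter_window hban (hmG n) (hlG n)
          (fun i hi h => absurd (show i < lo + n * j from h) (not_lt.2 hi)) hmT, hν a ha]
        refine mul_le_mul ih ?_ measureReal_nonneg (by positivity)
        have := measure_le_walk_le (d := d) hs₀ hint j 0
        simpa using this
      refine (Finset.sum_le_card_nsmul _ _ _ hterm).trans ?_
      have hcard : (𝒦.card : ℝ) ≤ K := by exact_mod_cast (by simpa using 𝒦.card_le_univ)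
      rw [nsmul_eq_mul, pow_succ]
      have h0 : 0 ≤ (K * expMom ν₀ d s₀ ^ j) ^ n * expMom ν₀ d s₀ ^ j := by positivity
      nlinarith
  refine le_trans (measureReal_mono ?_) (hP n)
  rintro ω ⟨h1, h2⟩ r hr
  have hle : (r + 1) * j ≤ n * j := Nat.mul_le_mul_right j hr
  obtain ⟨t, ht, -⟩ := exists_top_eq (env Y U ω).1 (env Y U ω).2 (lo + (r + 1) * j)
  obtain ⟨c1, c2, c3, -⟩ := h2 t (by omega) (by omega)
  have ht1 : 1 ≤ t := one_le_of_one_le_top (y := (env Y U ω).1) (u := (env Y U ω).2) (by omega)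
  refine ⟨_, c3, ?_⟩
  set a := lead (env Y U ω).1 (env Y U ω).2 t
  have hsa : s ≠ a := fun h => hs (h ▸ c3)
  have hno : ¬ Chal (env Y U ω).1 (env Y U ω).2 t s := fun h => c2
      ((mem_sel ht1).2 (Or.inr ⟨hsa, h⟩))
  rw [chal_iff ht1, not_or, not_le, not_le, c1, ht] at hno
  have h3 := hno.2
  have h4 : lo + (r + 1) * j - j = lo + r * j := by rw [add_mul, one_mul]; omega
  rw [h4, show lo + (r + 1) * j = lo + r * j + j by ring, psum_add_walk d] at h3
  have h5 : psum (env Y U ω).1 s j = walk d ((env Y U ω).1 s) j + j * d := by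
    rw [walk_eq, psum]; ring
  have h6 : 0 ≤ walk d ((env Y U ω).1 s) j := h1
  change 0 ≤ walk d _ j
  linarith

end Clean

/-- The probability that the walk ends in `[-t, v]`. -/
def endProb (ν : Measure ℝ) (d : ℝ) (j t : ℕ) (v : ℝ) : ℝ :=
  (seqLaw ν).real {x | walk d x j ∈ Set.Icc (-(t : ℝ)) v}

section Laws

variable {ν : Measure ℝ} [IsProbabilityMeasure ν] {d lam : ℝ}

theorem measurable_endProb (j t : ℕ) : Measurable (endProb ν d j t) := by
  refine Monotone.measurable fun v w h => measureReal_mono fun x hx => ?_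
  exact ⟨hx.1, hx.2.trans h⟩

/-- The density is bounded by its value at `-t + 1`, and `C` lies in `[-t, sSup C]`, whose
probability under `ν` is the value of `endProb` at a point of `C`. -/
theorem measure_tilted_le_of_endProb (hl : 0 ≤ lam)
    (hint : Integrable (fun x => Real.exp (lam * x)) ν)
    {j t : ℕ} {C : Set ℝ} (hC : IsCompact C) (hne : C.Nonempty)
    (hCt : C ⊆ Set.Ico (-(t : ℝ)) (-t + 1)) {p : ℝ} (hp : ∀ v ∈ C, endProb ν d j t v ≤ p) :
    (seqLaw (ν.tilted fun x => lam * x)).real {x | walk d x j ∈ C} ≤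
      Real.exp (lam * (-t + 1)) / expMom ν d lam ^ j * p := by
  have hM : 0 < expMom ν d lam := expMom_pos hint
  refine (measure_walk_tilted_le hl hint j hC.measurableSet
    (σ := -t + 1) fun v hv => (hCt hv).2.le).trans ?_
  refine mul_le_mul_of_nonneg_left (le_trans ?_ (hp _ (hC.sSup_mem hne))) (by positivity)
  exact measureReal_mono fun x hx => ⟨(hCt hx).1, le_csSup hC.bddAbove hx⟩

end Laws

section Clean

variable {K : ℕ} [NeZero K]

/-- The probability that the level window `[lo, lo + D)` is clean. -/
theorem exists_measure_clean_le {ν₀ : Measure ℝ} [IsProbabilityMeasure ν₀] {d lam : ℝ}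
    (hp : Pair ν₀ d lam) (K : ℕ) [NeZero K] : ∃ (κ r : ℝ) (C : ℕ), 0 ≤ κ ∧ 0 < r ∧ r < 1 ∧ 1 ≤ C ∧
    ∀ (s : Fin K) (𝒦 : Finset (Fin K)) (ν : Fin K → Measure ℝ), s ∉ 𝒦 → (∀ b ∈ 𝒦, ν b = ν₀) →
      (ν s = ν₀.tilted fun x => lam * x) → ∀ (Ω : Type u) [MeasurableSpace Ω] (P : Measure Ω)
      [IsProbabilityMeasure P] (Y : Fin K → ℕ → Ω → ℝ) (U : ℕ → Fin K → Ω → ℝ),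
      IsBandit P ν Y U → ∀ j lo D τ n : ℕ, 1 ≤ j → j ≤ lo → 1 ≤ n → n * (C * (τ + j + 1)) ≤ D →
      P.real {ω | env Y U ω ∈ {e | Clean e.1 e.2 s j 𝒦 lo (lo + D)}} ≤
        (K * r ^ j) ^ n + Real.exp (-(lam * τ)) + τ * (Real.exp lam * (1 / 2) ^ τ) +
          τ * (τ * (κ * (j + 1) * r ^ j / n)) := by
  classical
  obtain ⟨s₀, hs₀, hs₀l, hs₀M⟩ := exists_expMom_lt_one hp.integrable_id hp.mean_lt hp.lam_pos
    hp.integrable_exp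
  have hints₀ := integrable_exp_of_le hs₀.le hs₀l hp.integrable_exp
  have hM₀ : 0 < expMom ν₀ d s₀ := expMom_pos hints₀
  have hM1 := hp.one_lt
  have hM : 0 < expMom ν₀ d lam := expMom_pos hp.integrable_exp
  obtain ⟨q, hq0, hq⟩ := exists_forall_walk_nonpos hp
  obtain ⟨c, hc0, hc1, hc⟩ := exists_noTie.{u} hp K
  obtain ⟨cb, hcb0, CL, hcb⟩ := exists_boost_level hp
  set r := max (expMom ν₀ d s₀) (expMom ν₀ d lam)⁻¹ with hr
  have hr0 : 0 < r := lt_max_of_lt_left hM₀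
  have hr1 : r < 1 := max_lt hs₀M (inv_lt_one_of_one_lt₀ hM1)
  -- One factor `2` comes from the dyadic slicing and the other from the `1 / 2` in the loss per
  -- cell; `exp lam` is the width of a unit interval of heights.
  set κ := 4 * Real.exp lam / (c * q ^ K * cb) with hκ
  refine ⟨κ, r, K + CL + 2, by positivity, hr0, hr1, by omega, ?_⟩
  intro s 𝒦 ν hs hν hνs Ω _ P _ Y U hban j lo D τ n hj hlo hn hD
  have hprob : IsProbabilityMeasure (ν s) := by
    rw [hνs]; exact isProbabilityMeasure_tilted hp.integrable_exp
  set Cl : Set (Env K) := {e | Clean e.1 e.2 s j 𝒦 lo (lo + D)} with hCl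
  have hmCl : MeasurableSet {ω | env Y U ω ∈ Cl} := measurable_env hban
      (measurableSet_clean s j 𝒦 lo _)
  have hn0 : (0 : ℝ) < n := by exact_mod_cast hn
  -- Values of the centred sum of `s` in `[-τ, 0)` are sorted by the unit interval that contains
  -- them and by the dyadic size of `endProb`. On a slice `V t i`, the chance of the leader and the
  -- likelihood of `s` are both governed by `2^(-i)`; `W t` collects the quantiles below `2^(-τ)`.
  set W : ℕ → Set ℝ := fun t => {v | v ∈ Set.Ico (-(t : ℝ)) (-t + 1) ∧
    endProb ν₀ d j t v ≤ (1 / 2) ^ τ} with hW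
  set V : ℕ → ℕ → Set ℝ := fun t i => {v | v ∈ Set.Ico (-(t : ℝ)) (-t + 1) ∧
    endProb ν₀ d j t v ∈ Set.Ioc ((1 / 2) ^ (i + 1)) ((1 / 2) ^ i)} with hV
  have hmW : ∀ t, MeasurableSet (W t) := fun t =>
    measurableSet_Ico.inter (measurable_endProb j t measurableSet_Iic)
  have hmV : ∀ t i, MeasurableSet (V t i) := fun t i =>
    measurableSet_Ico.inter (measurable_endProb j t measurableSet_Ioc)
  have hpow : (expMom ν₀ d lam ^ j)⁻¹ ≤ r ^ j := by
    rw [← inv_pow]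
    exact pow_le_pow_left₀ (inv_pos.2 hM).le (le_max_right _ _) j
  have hr1j : r ^ j ≤ 1 := pow_le_one₀ hr0.le hr1.le
  -- the part with a large mean
  have b1 : P.real {ω | env Y U ω ∈ Start d s j (Set.Ici 0) ∩ Cl} ≤ (K * r ^ j) ^ n := by
    refine (measure_clean_start_nonneg hban hs hν hs₀.le hints₀ hj hlo (n := n) (D := D) ?_).trans
        ?_
    · refine lt_of_lt_of_le ?_ hD
      refine Nat.mul_lt_mul_of_pos_left ?_ hn
      nlinarith
    · have : expMom ν₀ d s₀ ^ j ≤ r ^ j := pow_le_pow_left₀ hM₀.le (le_max_left _ _) j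
      gcongr
  -- the part with a very small mean
  have b2 : P.real {ω | env Y U ω ∈ Start d s j (Set.Iio (-(τ : ℝ))) ∩ Cl} ≤
      Real.exp (-(lam * τ)) := by
    have h1 : P.real {ω | env Y U ω ∈ Start d s j (Set.Iio (-(τ : ℝ))) ∩ Cl} ≤
        P.real {ω | env Y U ω ∈ Start d s j (Set.Iio (-(τ : ℝ)))} := measureReal_mono fun ω h => h.1
    rw [measure_start hban d j measurableSet_Iio, hνs] at h1
    refine h1.trans ((measure_walk_tilted_le hp.lam_pos.le hp.integrable_exp j measurableSet_Iio
      (σ := -τ) fun v hv => (Set.mem_Iio.1 hv).le).trans ?_)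
    refine (mul_le_of_le_one_right (by positivity) measureReal_le_one).trans ?_
    rw [mul_neg]
    exact div_le_self (Real.exp_pos _).le (one_le_pow₀ hM1.le)
  -- the extreme quantiles
  have b3 : ∀ t, P.real {ω | env Y U ω ∈ Start d s j (W t) ∩ Cl} ≤ Real.exp lam * (1 / 2) ^ τ := by
    intro t
    have h1 : P.real {ω | env Y U ω ∈ Start d s j (W t) ∩ Cl} ≤
        P.real {ω | env Y U ω ∈ Start d s j (W t)} := measureReal_mono fun ω h => h.1
    rw [measure_start hban d j (hmW t)] at h1
    refine h1.trans ?_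
    have h2 : ((seqLaw (ν s)).map fun x => walk d x j).real (W t) ≤ Real.exp lam * (1 / 2) ^ τ := by
      have := Measure.isProbabilityMeasure_map (μ := seqLaw (ν s))
        (measurable_walk (d := d) j).aemeasurable
      refine measureReal_le_of_compact (hmW t) (by positivity) fun C hC hcC hne => ?_
      rw [map_measureReal_apply (measurable_walk j) hcC.measurableSet, hνs]
      refine (measure_tilted_le_of_endProb hp.lam_pos.le hp.integrable_exp hcC hne
        (fun v hv => (hC hv).1) fun v hv => (hC hv).2).trans ?_
      refine mul_le_mul_of_nonneg_right ?_ (by positivity)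
      refine (div_le_self (Real.exp_pos _).le (one_le_pow₀ hM1.le)).trans (Real.exp_le_exp.2 ?_)
      have : 0 ≤ lam * t := mul_nonneg hp.lam_pos.le t.cast_nonneg
      linarith
    rwa [map_measureReal_apply (measurable_walk j) (hmW t)] at h2
  -- the main part
  have b4 : ∀ t ≤ τ, ∀ i, P.real {ω | env Y U ω ∈ Start d s j (V t i) ∩ Cl} ≤
      κ * (j + 1) * r ^ j / n := by
    intro t ht i
    have hmwalk : Measurable fun ω => walk d ((env Y U ω).1 s) j :=
      (measurable_walk j).comp ((measurable_pi_apply s).comp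
        (measurable_fst.comp (measurable_env hban)))
    set μ := (P.restrict {ω | env Y U ω ∈ Cl}).map fun ω => walk d ((env Y U ω).1 s) j with hμ
    have hμv : ∀ S, MeasurableSet S → μ.real S = P.real {ω | env Y U ω ∈ Start d s j S ∩ Cl} := by
      intro S hS
      rw [hμ, map_measureReal_apply hmwalk hS, measureReal_restrict_apply (hmwalk hS)]
      rfl
    rw [← hμv _ (hmV t i)]
    refine measureReal_le_of_compact (hmV t i) (by positivity) fun C hC hcC hne => ?_
    rw [hμv _ hcC.measurableSet]
    obtain ⟨L, hL, hLb⟩ := hcb t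
    set σ := sInf C with hσ
    have hσC : σ ∈ C := hcC.sInf_mem hne
    -- The chance of the scenario for the least favourable value `σ` in `C`; any sum of `s` in `C`
    -- is at least `σ`.
    set g := cb * Real.exp (-(lam * t)) * (endProb ν₀ d j t σ / (j + 1)) with hg
    have hF : (1 / 2) ^ (i + 1) < endProb ν₀ d j t σ := (hC hσC).2.1
    have hF0 : 0 < endProb ν₀ d j t σ := lt_trans (by positivity) hF
    have hg0 : 0 < g := by positivity
    have hgle : g ≤ (seqLaw ν₀).real (Stay d (L + j) j σ) := mul_le_measure_stay hLb
    have hcells := measure_clean_cells hban hs hν hc0.le hc1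
      (fun m A hA hl => hc 𝒦 ν hν Ω P Y U hban m A hA hl) hq0.le hq hg0.le hgle hcC.measurableSet
      (fun v hv => csInf_le hcC.bddBelow hv) hlo hj (Nat.le_add_left j L) n
    have hlen : n * (K + (L + j) + 1) ≤ D := by
      refine le_trans (Nat.mul_le_mul_left n ?_) hD
      have : CL * (t + 1) ≤ CL * (τ + 1) := Nat.mul_le_mul_left _ (by omega)
      nlinarith
    have h1 : P.real {ω | env Y U ω ∈ Start d s j C ∩ Cl} ≤
        P.real {ω | env Y U ω ∈ Start d s j C ∩
          {e | Clean e.1 e.2 s j 𝒦 lo (lo + n * (K + (L + j) + 1))}} :=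
      measureReal_mono fun ω h => ⟨h.1, Clean.mono h.2 (by omega)⟩
    refine h1.trans (hcells.trans ?_)
    set h := c * (q ^ K * g) / 2 with hh
    have hh0 : 0 < h := by positivity
    have hq1 : q ≤ 1 := hq.trans measureReal_le_one
    have hg1 : g ≤ 1 := hgle.trans measureReal_le_one
    have hh1 : h ≤ 1 := by
      have h1 : q ^ K * g ≤ 1 := mul_le_one₀ (pow_le_one₀ hq0.le hq1) hg0.le hg1
      have h2 : c * (q ^ K * g) ≤ 1 := mul_le_one₀ hc1 (by positivity) h1
      linarith
    rw [measure_start hban d j hcC.measurableSet, hνs]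
    have h2 := measure_tilted_le_of_endProb (d := d) hp.lam_pos.le hp.integrable_exp hcC hne
      (fun v hv => (hC hv).1) (fun v hv => (hC hv).2.2)
    -- The factor `exp (-lam t)` in `h` cancels that of the tilted probability, and `(1 / 2)^(i +
    -- 1)` cancels `(1 / 2)^i` up to `2`.
    calc (1 - h) ^ n * (seqLaw (ν₀.tilted fun x => lam * x)).real {x | walk d x j ∈ C}
        ≤ (1 / (n * h)) * (Real.exp (lam * (-t + 1)) / expMom ν₀ d lam ^ j * (1 / 2) ^ i) :=
          mul_le_mul (one_sub_pow_le hh0 hh1 hn) h2 measureReal_nonneg (by positivity)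
      _ ≤ (1 / (n * (c * (q ^ K * (cb * Real.exp (-(lam * t)) *
            ((1 / 2) ^ (i + 1) / (j + 1)))) / 2))) *
            (Real.exp (lam * (-t + 1)) * r ^ j * (1 / 2) ^ i) := by
          refine mul_le_mul ?_ ?_ (by positivity) (by positivity)
          · refine one_div_le_one_div_of_le (by positivity) ?_
            rw [hh, hg]
            gcongr
          · rw [div_eq_mul_inv]
            gcongr
      _ = κ * (j + 1) * r ^ j / n := by
          rw [hκ, mul_add, mul_one, Real.exp_add, mul_neg]
          have := Real.exp_pos (-(lam * t))
          rw [pow_succ]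
          field_simp
          ring
  have hcover : {ω | env Y U ω ∈ Cl} ⊆ (({ω | env Y U ω ∈ Start d s j (Set.Ici 0) ∩ Cl} ∪
      {ω | env Y U ω ∈ Start d s j (Set.Iio (-(τ : ℝ))) ∩ Cl}) ∪
      ⋃ t ∈ Finset.Icc 1 τ, {ω | env Y U ω ∈ Start d s j (W t) ∩ Cl}) ∪
      ⋃ t ∈ Finset.Icc 1 τ, ⋃ i ∈ Finset.range τ, {ω | env Y U ω ∈ Start d s j (V t i) ∩ Cl} := by
    intro ω hω
    rcases le_or_gt 0 (walk d ((env Y U ω).1 s) j) with h | h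
    · exact Or.inl (Or.inl (Or.inl ⟨h, hω⟩))
    rcases lt_or_ge (walk d ((env Y U ω).1 s) j) (-(τ : ℝ)) with h' | h'
    · exact Or.inl (Or.inl (Or.inr ⟨h', hω⟩))
    set v := walk d ((env Y U ω).1 s) j with hv
    obtain ⟨t, ht1, ht2⟩ : ∃ t ∈ Finset.Icc 1 τ, v ∈ Set.Ico (-(t : ℝ)) (-t + 1) := by
      refine ⟨⌈-v⌉₊, Finset.mem_Icc.2 ⟨Nat.one_le_ceil_iff.2 (by linarith),
        Nat.ceil_le.2 (by linarith)⟩, ?_, ?_⟩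
      · have := Nat.le_ceil (-v)
        linarith
      · have := Nat.ceil_lt_add_one (show 0 ≤ -v by linarith)
        linarith
    rcases le_or_gt (endProb ν₀ d j t v) ((1 / 2) ^ τ) with h3 | h3
    · exact Or.inl (Or.inr (Set.mem_iUnion₂.2 ⟨t, ht1, ⟨ht2, h3⟩, hω⟩))
    · obtain ⟨i, hi1, hi2⟩ := exists_nat_pow_near_of_lt_one
        (lt_trans (by positivity) h3 : 0 < endProb ν₀ d j t v) measureReal_le_one
        (show (0 : ℝ) < 1 / 2 by norm_num) (by norm_num)
      have hiτ : i < τ := by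
        by_contra hcon
        have := pow_le_pow_of_le_one (show (0 : ℝ) ≤ 1 / 2 by norm_num) (by norm_num)
          (not_lt.1 hcon)
        linarith
      exact Or.inr (Set.mem_iUnion₂.2 ⟨t, ht1, Set.mem_iUnion₂.2 ⟨i, Finset.mem_range.2 hiτ,
        ⟨ht2, hi1, hi2⟩, hω⟩⟩)
  refine (measureReal_mono hcover (measure_ne_top _ _)).trans ?_
  refine (measureReal_union_le _ _).trans (add_le_add ((measureReal_union_le _ _).trans
    (add_le_add ((measureReal_union_le _ _).trans (add_le_add b1 b2)) ?_)) ?_)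
  · refine (measureReal_biUnion_finset_le _ _).trans ?_
    refine (Finset.sum_le_card_nsmul _ _ _ fun t _ => b3 t).trans ?_
    simp
  · refine (measureReal_biUnion_finset_le _ _).trans ?_
    refine (Finset.sum_le_card_nsmul _ _ (τ * (κ * (j + 1) * r ^ j / n)) fun t ht => ?_).trans ?_
    · refine (measureReal_biUnion_finset_le _ _).trans ?_
      refine (Finset.sum_le_card_nsmul _ _ _ fun i _ => b4 t (Finset.mem_Icc.1 ht).2 i).trans ?_
      simp
    · simp

end Clean

/-! ### From a late suboptimal leader to a clean window -/

section Dynamics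

variable {K : ℕ} [NeZero K] {y : Fin K → ℕ → ℝ} {u : ℕ → Fin K → ℝ}

/-- Since `log (t + 1) ≤ t ≤ K * top`, above level `K` no arm at the top is pulled by force. -/
theorem sqrt_log_lt_top {t : ℕ} (h : K < top y u t) :
    Real.sqrt (Real.log (t + 1 : ℕ)) < top y u t := by
  have h0 : (0 : ℝ) < top y u t := by exact_mod_cast (Nat.zero_le K).trans_lt h
  rw [Real.sqrt_lt' h0]
  have h1 : (t : ℝ) ≤ K * top y u t := by exact_mod_cast le_mul_top
  have h2 : Real.log (t + 1 : ℕ) ≤ t := by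
    have := Real.log_le_sub_one_of_pos (show (0 : ℝ) < (t + 1 : ℕ) by positivity)
    push_cast at this ⊢
    linarith
  have h3 : (K : ℝ) < top y u t := by exact_mod_cast h
  nlinarith

/-- A new leader has at least the reward sum of the old one at the old level, so once sums are
ordered like means the leadership never passes to an arm of smaller mean. -/
theorem lead_mono {μ : Fin K → ℝ} {lo : ℕ} (hlo : K < lo)
    (hmono : ∀ b a, μ b < μ a → ∀ n, lo ≤ n → psum y b n < psum y a n) {t t' : ℕ}
    (htt : t ≤ t') (ht : lo ≤ top y u t) : μ (lead y u t) ≤ μ (lead y u t') := by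
  induction t', htt using Nat.le_induction with
  | base => exact le_rfl
  | succ n hn ih =>
    refine ih.trans ?_
    have hn' : lo ≤ top y u n := ht.trans (top_mono hn)
    have hn1 : 1 ≤ n := one_le_of_one_le_top (y := y) (u := u) (by omega)
    by_contra hcon
    exact absurd (psum_le_of_lead_ne hn1 (sqrt_log_lt_top (by omega)))
      (not_le.2 (hmono _ _ (not_le.1 hcon) _ hn'))

theorem pullCount_eq_card (t : ℕ) (k : Fin K) :
    pullCount y u t k = ((Finset.range t).filter fun i => k ∈ sel y u i).card := by
  induction t with
  | zero => rfl
  | succ t ih =>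
    rw [pullCount_succ, ih, Finset.range_add_one, Finset.filter_insert]
    split_ifs with h
    · rw [Finset.card_insert_of_notMem (by simp)]
    · rw [add_zero]

theorem injOn_pullCount (k : Fin K) :
    Set.InjOn (fun t => pullCount y u t k) {t | k ∈ sel y u t} := by
  have key : ∀ t t', k ∈ sel y u t → t < t' → pullCount y u t k < pullCount y u t' k := by
    intro t t' hs hlt
    have := pullCount_mono (y := y) (u := u) (k := k) (Nat.succ_le_of_lt hlt)
    rw [Nat.succ_eq_add_one, pullCount_succ, if_pos hs] at this
    omega
  intro t ht t' ht' heq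
  simp only [Set.mem_ofPred_eq] at ht ht' heq
  rcases lt_trichotomy t t' with hlt | hlt | hlt
  · have := key t t' ht hlt; omega
  · exact hlt
  · have := key t' t ht' hlt; omega

/-- An arm is pulled at most `F` times while its number of pulls is less than `F`. -/
theorem card_pulled_lt_le (n F : ℕ) (k : Fin K) :
    ((Finset.range n).filter fun t => k ∈ sel y u t ∧ pullCount y u t k < F).card ≤ F := by
  refine (Finset.card_le_card_of_injOn (t := Finset.range F) _ (fun t ht => ?_)
    ((injOn_pullCount (y := y) (u := u) k).mono fun t ht => ?_)).trans (Finset.card_range F).le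
  · exact Finset.mem_coe.2 (Finset.mem_range.2 (Finset.mem_filter.1 ht).2.2)
  · exact (Finset.mem_filter.1 ht).2.1

/-- An arm that beats every suboptimal leader from `J` pulls on, and is not the leader at a late
time, still had fewer than `J` pulls at an early time. -/
theorem pullCount_lt_of_lead {μ : Fin K → ℝ} {s : Fin K} {lo J u₀ t₀ : ℕ} (hlo : K < lo)
    (hmono : ∀ b a, μ b < μ a → ∀ n, lo ≤ n → psum y b n < psum y a n)
    (hwin : ∀ b, μ b < μ s → ∀ n m, J ≤ n → n ≤ m → m ≤ t₀ →
      psum y b m - psum y b (m - n) ≤ psum y s n)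
    (ht₀ : (K + 1) * u₀ + K < t₀) (hsub : μ (lead y u t₀) < μ s) (hu₀ : lo ≤ top y u u₀) :
    pullCount y u u₀ s < J := by
  by_contra hJ
  have hu1 : 1 ≤ u₀ := one_le_of_one_le_top (y := y) (u := u) (by omega)
  have hut : u₀ ≤ t₀ := by nlinarith
  have hsel : ∀ t, u₀ ≤ t → t < t₀ → s ∈ sel y u t ∧ lead y u t ∉ sel y u t := by
    intro t h1 h2
    have hl : μ (lead y u t) < μ s :=
      (lead_mono hlo hmono h2.le (hu₀.trans (top_mono h1))).trans_lt hsub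
    have hsl : s ≠ lead y u t := fun h => absurd hl (by rw [← h]; exact lt_irrefl _)
    have hc : Chal y u t s := (chal_iff (by omega)).2 (Or.inr (hwin _ hl _ _
      ((not_lt.1 hJ).trans (pullCount_mono h1)) pullCount_le_top (top_le_self.trans h2.le)))
    refine ⟨(mem_sel (by omega)).2 (Or.inr ⟨hsl, hc⟩), fun h => ?_⟩
    rcases (mem_sel (by omega)).1 h with h | h
    · exact h.2 s hsl hc
    · exact h.1 rfl
  -- From `u₀` on, `s` is pulled in every round, while the potential of `mul_top_succ_le` grows by
  -- at most `K - 1` per round. After more than `K u₀ + K` rounds `s` would have more pulls than the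
  -- leader.
  have hpot : ∀ n, u₀ + n ≤ t₀ → n ≤ pullCount y u (u₀ + n) s ∧
      K * top y u (u₀ + n) + n + (Finset.univ.filter
        fun k => pullCount y u (u₀ + n) k = top y u (u₀ + n)).card ≤
        n * K + K * top y u u₀ +
          (Finset.univ.filter fun k => pullCount y u u₀ k = top y u u₀).card := by
    intro n
    induction n with
    | zero => intro _; exact ⟨Nat.zero_le _, by simp⟩
    | succ n ih =>
      intro h
      obtain ⟨ih1, ih2⟩ := ih (by omega)
      obtain ⟨hs, hl⟩ := hsel (u₀ + n) (by omega) (by omega)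
      have hstep := mul_top_succ_le hl
      rw [← add_assoc]
      refine ⟨?_, ?_⟩
      · rw [pullCount_succ, if_pos hs]; omega
      · rw [add_mul, one_mul]; omega
  obtain ⟨h1, h2⟩ := hpot (t₀ - u₀) (by omega)
  rw [Nat.add_sub_cancel' hut] at h1 h2
  have hle : (Finset.univ.filter fun k => pullCount y u u₀ k = top y u u₀).card ≤ K := by
    refine (Finset.card_le_univ _).trans ?_
    simp
  have h3 : K * (t₀ - u₀) ≤ K * top y u t₀ := Nat.mul_le_mul_left K (h1.trans pullCount_le_top)
  have h4 : K * top y u u₀ ≤ K * u₀ := Nat.mul_le_mul_left K top_le_self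
  rw [mul_comm K (t₀ - u₀)] at h3
  rw [add_mul, one_mul] at ht₀
  omega

/-- If a suboptimal arm leads late, then the trajectory was clean on one of many windows. -/
theorem exists_clean {μ : Fin K → ℝ} {s : Fin K} {lo J u₀ t₀ D W F : ℕ} (hlo : K < lo)
    (hmono : ∀ b a, μ b < μ a → ∀ n, lo ≤ n → psum y b n < psum y a n)
    (hwin : ∀ b, μ b < μ s → ∀ n m, J ≤ n → n ≤ m → m ≤ t₀ →
      psum y b m - psum y b (m - n) ≤ psum y s n)
    (ht₀ : (K + 1) * u₀ + K < t₀) (hsub : μ (lead y u t₀) < μ s)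
    (hu₀ : K * (lo + W * D) ≤ u₀) (hD : 1 ≤ D)
    (hF : ∀ t < u₀, Real.sqrt (Real.log (t + 1 : ℕ)) < F) (hW : J + K + K * F ≤ W) :
    ∃ w < W, ∃ j < J, ∃ b, μ b < μ s ∧ Real.sqrt (Real.log lo) < j ∧
      Clean y u s j (Finset.univ.filter fun k => μ k = μ b) (lo + w * D) (lo + w * D + D) := by
  classical
  have hK : 1 ≤ K := Nat.one_le_iff_ne_zero.2 (NeZero.ne K)
  have htop : lo + W * D ≤ top y u u₀ :=
    le_of_mul_le_mul_left (hu₀.trans le_mul_top) (by omega)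
  have hut : u₀ ≤ t₀ := by nlinarith
  have hJ := pullCount_lt_of_lead hlo hmono hwin ht₀ hsub (by omega)
  -- Rounds that spoil a window. There are fewer than `J` pulls of `s`, at most `K` changes of the
  -- mean of the leader because that mean is monotone, and at most `K F` forced pulls.
  set bad : Finset ℕ := (Finset.range u₀).filter fun t => lo ≤ top y u t ∧
    (s ∈ sel y u t ∨ μ (lead y u t) ≠ μ (lead y u (t + 1)) ∨
      ∃ k, k ≠ lead y u t ∧ (pullCount y u t k : ℝ) ≤ Real.sqrt (Real.log (t + 1 : ℕ))) with hbad
  have hcard : bad.card < W := by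
    have hsub : bad ⊆ ((Finset.range u₀).filter fun t => s ∈ sel y u t) ∪
        ((Finset.range u₀).filter fun t => lo ≤ top y u t ∧
          μ (lead y u t) ≠ μ (lead y u (t + 1))) ∪
        Finset.univ.biUnion fun k : Fin K =>
          (Finset.range u₀).filter fun t => k ∈ sel y u t ∧ pullCount y u t k < F := by
      intro t ht
      obtain ⟨h1, h2, h3⟩ := Finset.mem_filter.1 ht
      rcases h3 with h3 | h3 | ⟨k, hk, h3⟩
      · exact Finset.mem_union_left _ (Finset.mem_union_left _ (Finset.mem_filter.2 ⟨h1, h3⟩))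
      · exact Finset.mem_union_left _ (Finset.mem_union_right _ (Finset.mem_filter.2 ⟨h1, h2, h3⟩))
      · refine Finset.mem_union_right _ (Finset.mem_biUnion.2 ⟨k, Finset.mem_univ k,
          Finset.mem_filter.2 ⟨h1, ?_, ?_⟩⟩)
        · exact (mem_sel (one_le_of_one_le_top (y := y) (u := u) (by omega))).2
            (Or.inr ⟨hk, Or.inl h3⟩)
        · exact_mod_cast h3.trans_lt (hF t (Finset.mem_range.1 h1))
    have c2 : ((Finset.range u₀).filter fun t => lo ≤ top y u t ∧
        μ (lead y u t) ≠ μ (lead y u (t + 1))).card ≤ K := by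
      have hinj : Set.InjOn (lead y u) ((Finset.range u₀).filter fun t => lo ≤ top y u t ∧
          μ (lead y u t) ≠ μ (lead y u (t + 1))) := by
        have key : ∀ t t', lo ≤ top y u t → μ (lead y u t) ≠ μ (lead y u (t + 1)) → t < t' →
            lead y u t ≠ lead y u t' := by
          intro t t' h1 h2 hlt heq
          have a1 := lead_mono hlo hmono (Nat.le_add_right t 1) h1
          have a2 := lead_mono hlo hmono (Nat.succ_le_of_lt hlt)
            (h1.trans (top_mono (Nat.le_add_right t 1)))
          rw [← heq] at a2
          exact h2 (le_antisymm a1 a2)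
        intro t ht t' ht' heq
        simp only [Finset.coe_filter, Set.mem_ofPred_eq] at ht ht'
        rcases lt_trichotomy t t' with hlt | hlt | hlt
        · exact absurd heq (key t t' ht.2.1 ht.2.2 hlt)
        · exact hlt
        · exact absurd heq.symm (key t' t ht'.2.1 ht'.2.2 hlt)
      refine (Finset.card_le_card_of_injOn (t := Finset.univ) _
        (fun t _ => Finset.mem_coe.2 (Finset.mem_univ _)) hinj).trans ?_
      simp
    have c3 : (Finset.univ.biUnion fun k : Fin K => (Finset.range u₀).filter
        fun t => k ∈ sel y u t ∧ pullCount y u t k < F).card ≤ K * F := by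
      refine (Finset.card_biUnion_le).trans ((Finset.sum_le_card_nsmul _ _ F
        fun k _ => card_pulled_lt_le u₀ F k).trans ?_)
      simp
    have c1 := pullCount_eq_card (y := y) (u := u) u₀ s
    have := (Finset.card_le_card hsub).trans ((Finset.card_union_le _ _).trans
      (Nat.add_le_add_right (Finset.card_union_le _ _) _))
    omega
  -- Each bad round belongs to at most one window, and there are fewer of them than windows.
  obtain ⟨w, hwW, hw⟩ : ∃ w ∈ Finset.range W, w ∉ bad.image fun t => (top y u t - lo) / D := by
    refine Finset.exists_mem_notMem_of_card_lt_card (lt_of_le_of_lt Finset.card_image_le ?_)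
    rwa [Finset.card_range]
  have hwW' := Finset.mem_range.1 hwW
  have hwD : (w + 1) * D ≤ W * D := Nat.mul_le_mul_right D hwW'
  rw [add_mul, one_mul] at hwD
  set l := lo + w * D with hl
  have hlt : ∀ t, top y u t < l + D → t < u₀ := by
    intro t h
    by_contra hc
    have := top_mono (y := y) (u := u) (not_lt.1 hc)
    omega
  have hgood : ∀ t, l ≤ top y u t → top y u t < l + D → s ∉ sel y u t ∧
      μ (lead y u t) = μ (lead y u (t + 1)) ∧
      ∀ k, k ≠ lead y u t → Real.sqrt (Real.log (t + 1 : ℕ)) < pullCount y u t k := by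
    intro t h1 h2
    have htb : t ∉ bad := by
      intro hb
      refine hw (Finset.mem_image.2 ⟨t, hb, ?_⟩)
      refine Nat.div_eq_of_lt_le ?_ ?_
      · omega
      · rw [add_mul, one_mul]; omega
    rw [hbad, Finset.mem_filter] at htb
    push Not at htb
    obtain ⟨a1, a2, a3⟩ := htb (Finset.mem_range.2 (hlt t h2)) (by omega)
    exact ⟨a1, a2, a3⟩
  obtain ⟨t₁, ht₁, hmin⟩ : ∃ t₁, top y u t₁ = l ∧ ∀ t, l ≤ top y u t → t₁ ≤ t := by
    obtain ⟨t, ht, -⟩ := exists_top_eq y u l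
    have hex : ∃ t, l ≤ top y u t := ⟨t, ht.ge⟩
    refine ⟨Nat.find hex, le_antisymm ?_ (Nat.find_spec hex), fun t' h => Nat.find_min' hex h⟩
    exact (top_mono (Nat.find_min' hex ht.ge)).trans ht.le
  have hlead : ∀ t, t ≤ u₀ → l ≤ top y u t → μ (lead y u t) < μ s := fun t h1 h2 =>
    (lead_mono hlo hmono (h1.trans hut) (by omega)).trans_lt hsub
  have ht₁u : t₁ < u₀ := hlt t₁ (by omega)
  have hsb := hlead t₁ ht₁u.le ht₁.ge
  refine ⟨w, hwW', pullCount y u t₁ s, lt_of_le_of_lt (pullCount_mono ht₁u.le) hJ, lead y u t₁, hsb,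
    ?_, ?_⟩
  · have hs1 : s ≠ lead y u t₁ := fun h => absurd hsb (by rw [← h]; exact lt_irrefl _)
    -- Since `s` is not entitled to a forced pull at `t₁ ≥ lo`, its count exceeds `√(log lo)`:
    -- forced exploration yields the lower bound on `j`.
    refine lt_of_le_of_lt (Real.sqrt_le_sqrt (Real.log_le_log ?_ ?_))
      ((hgood t₁ ht₁.ge (by omega)).2.2 s hs1)
    · exact_mod_cast (Nat.zero_le K).trans_lt hlo
    · have := top_le_self (y := y) (u := u) (t := t₁)
      exact_mod_cast (by omega : lo ≤ t₁ + 1)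
  · intro t h1 h2
    have hind : ∀ t, t₁ ≤ t → top y u t < l + D → pullCount y u t s = pullCount y u t₁ s ∧
        μ (lead y u t) = μ (lead y u t₁) := by
      intro t ht
      induction t, ht using Nat.le_induction with
      | base => exact fun _ => ⟨rfl, rfl⟩
      | succ n hn ih =>
        intro h
        have hnle := top_mono (y := y) (u := u) (Nat.le_add_right n 1)
        have hn1 := top_mono (y := y) (u := u) hn
        obtain ⟨i1, i2⟩ := ih (by omega)
        obtain ⟨g1, g2, -⟩ := hgood n (by omega) (by omega)
        exact ⟨by rw [pullCount_succ, if_neg g1, i1, add_zero], by rw [← g2, i2]⟩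
    obtain ⟨i1, i2⟩ := hind t (hmin t h1) h2
    obtain ⟨g1, -, g3⟩ := hgood t h1 h2
    exact ⟨i1, g1, Finset.mem_filter.2 ⟨Finset.mem_univ _, i2⟩, g3⟩

end Dynamics

/-! ### Numerical estimates on the exponential scale -/

theorem exists_pow_mul_pow_le (p : ℕ) {r : ℝ} (h0 : 0 ≤ r) (h1 : r < 1) :
    ∃ c : ℝ, 0 < c ∧ ∀ n : ℕ, (n : ℝ) ^ p * r ^ n ≤ c := by
  obtain ⟨c, hc⟩ := (tendsto_pow_const_mul_const_pow_of_lt_one p h0 h1).bddAbove_range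
  exact ⟨max c 1, lt_max_of_lt_right one_pos,
    fun n => (hc (Set.mem_range_self n)).trans (le_max_left _ _)⟩

/-- Powers of `k` become powers of `j²`, which `r ^ j` absorbs. -/
theorem succ_le_three_mul_sq {k j : ℕ} (h : Real.sqrt (Real.log ((2 : ℝ) ^ k)) < j) :
    (k : ℝ) + 1 ≤ 3 * (j : ℝ) ^ 2 := by
  have hj : (0 : ℝ) < j := (Real.sqrt_nonneg _).trans_lt h
  have hj1 : (1 : ℝ) ≤ j := by exact_mod_cast hj
  rw [Real.sqrt_lt' hj, Real.log_pow] at h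
  have h2 : (1 : ℝ) / 2 ≤ Real.log 2 := by linarith [Real.log_two_gt_d9]
  have h3 : (k : ℝ) * (1 / 2) ≤ k * Real.log 2 := mul_le_mul_of_nonneg_left h2 k.cast_nonneg
  nlinarith

/-- The bound on the probability of a clean window, for parameters that are linear in `k`. -/
theorem exists_window_bound {κ r lam E : ℝ} (K A B : ℕ) (hκ : 0 ≤ κ) (hr0 : 0 < r) (hr1 : r < 1)
    (hE : 0 ≤ E) (hB : Real.exp (-(lam * B)) ≤ 1 / 8) (hB3 : 3 ≤ B) :
    ∃ (c : ℝ) (k₀ : ℕ), 0 < c ∧ ∀ k ≥ k₀, ∀ j n : ℕ, Real.sqrt (Real.log ((2 : ℝ) ^ k)) < j →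
      j < A * (k + 1) → k + 1 ≤ n → (4 : ℝ) ^ k ≤ n * (E * ((k : ℝ) + 1) ^ 2) →
      (K * r ^ j) ^ n + Real.exp (-(lam * (B * (k + 1) : ℕ))) +
        ((B * (k + 1) : ℕ) : ℝ) * (Real.exp lam * (1 / 2) ^ (B * (k + 1))) +
        ((B * (k + 1) : ℕ) : ℝ) * (((B * (k + 1) : ℕ) : ℝ) * (κ * (j + 1) * r ^ j / n)) ≤
        c / (((k : ℝ) + 1) ^ 4 * 4 ^ k) := by
  obtain ⟨c₅, hc₅, h5⟩ := exists_pow_mul_pow_le 5 (show (0 : ℝ) ≤ 1 / 2 by norm_num) (by norm_num)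
  -- In the main term, two factors `τ`, the factor `j + 1` and `1 / n` contribute `x^5`, where `x =
  -- k + 1`; with the target `x^(-4)` this makes `x^9 ≤ (3 j²)^9`, whence the exponent `18`.
  obtain ⟨c₁₈, hc₁₈, h18⟩ := exists_pow_mul_pow_le 18 hr0.le hr1
  obtain ⟨j₀, hj₀⟩ : ∃ j₀ : ℕ, ∀ j ≥ j₀, K * r ^ j ≤ 1 / 8 := by
    have : Filter.Tendsto (fun j : ℕ => K * r ^ j) Filter.atTop (nhds (K * 0)) :=
      (tendsto_pow_atTop_nhds_zero_of_lt_one hr0.le hr1).const_mul _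
    rw [mul_zero] at this
    exact Filter.eventually_atTop.1 (this.eventually (ge_mem_nhds (by norm_num)))
  refine ⟨(2 + B * Real.exp lam) * c₅ + (B : ℝ) ^ 2 * κ * A * E * (3 ^ 9 * c₁₈) , 3 * j₀ ^ 2 + 1,
    by positivity, ?_⟩
  intro k hk j n hj hjA hn hnE
  set x : ℝ := (k : ℝ) + 1 with hx
  have hx1 : 1 ≤ x := by rw [hx]; linarith [k.cast_nonneg (α := ℝ)]
  have hx0 : 0 < x := by linarith
  have hxj : x ≤ 3 * (j : ℝ) ^ 2 := succ_le_three_mul_sq hj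
  have hn0 : (0 : ℝ) < n := by exact_mod_cast (by omega : 0 < n)
  have hjj : j₀ ≤ j := by
    by_contra hcon
    have h1 : (j : ℝ) ≤ j₀ := by exact_mod_cast (not_le.1 hcon).le
    have h2 : (3 * (j₀ : ℝ) ^ 2 + 1) ≤ k := by exact_mod_cast hk
    have h3 : (j : ℝ) ^ 2 ≤ (j₀ : ℝ) ^ 2 := by gcongr
    rw [hx] at hxj
    linarith
  have h8 : (0 : ℝ) ≤ (1 / 8) ^ (k + 1) := by positivity
  have t1 : (K * r ^ j) ^ n ≤ (1 / 8) ^ (k + 1) :=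
    (pow_le_pow_left₀ (by positivity) (hj₀ j hjj) n).trans
      (pow_le_pow_of_le_one (by norm_num) (by norm_num) hn)
  have t2 : Real.exp (-(lam * (B * (k + 1) : ℕ))) ≤ (1 / 8) ^ (k + 1) := by
    refine le_trans (le_of_eq ?_) (pow_le_pow_left₀ (Real.exp_pos _).le hB (k + 1))
    rw [← Real.exp_nat_mul]
    congr 1
    push_cast
    ring
  have t3 : ((1 : ℝ) / 2) ^ (B * (k + 1)) ≤ (1 / 8) ^ (k + 1) := by
    rw [pow_mul]
    refine pow_le_pow_left₀ (by positivity) ?_ _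
    refine (pow_le_pow_of_le_one (by norm_num) (by norm_num) hB3).trans ?_
    norm_num
  have h8x : ((1 : ℝ) / 8) ^ (k + 1) * (x ^ 4 * 4 ^ k) * x ≤ c₅ := by
    have e1 : ((1 : ℝ) / 8) ^ (k + 1) * (x ^ 4 * 4 ^ k) * x = (x ^ 5 * (1 / 2) ^ (k + 1)) *
        (1 / 4) := by
      have : ((1 : ℝ) / 8) ^ (k + 1) = (1 / 2) ^ (k + 1) * ((1 / 4) ^ k * (1 / 4)) := by
        rw [← pow_succ, ← mul_pow]; norm_num
      rw [this]
      have h4 : ((1 : ℝ) / 4) ^ k * 4 ^ k = 1 := by rw [← mul_pow]; norm_num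
      linear_combination (x ^ 5 * (1 / 2) ^ (k + 1) * (1 / 4)) * h4
    have e2 := h5 (k + 1)
    push_cast at e2
    rw [e1]
    have : 0 ≤ x ^ 5 * ((1 : ℝ) / 2) ^ (k + 1) := by positivity
    rw [← hx] at e2
    linarith
  have t4 : (1 : ℝ) / n ≤ E * x ^ 2 / 4 ^ k := by
    rw [div_le_div_iff₀ hn0 (by positivity)]
    linarith
  have hjx : (j : ℝ) + 1 ≤ A * x := by
    rw [hx]; exact_mod_cast hjA
  have hrj : x ^ 9 * r ^ j ≤ 3 ^ 9 * c₁₈ := by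
    calc x ^ 9 * r ^ j ≤ (3 * (j : ℝ) ^ 2) ^ 9 * r ^ j := by gcongr
      _ = 3 ^ 9 * ((j : ℝ) ^ 18 * r ^ j) := by ring
      _ ≤ _ := by gcongr; exact h18 j
  have hcast : ((B * (k + 1) : ℕ) : ℝ) = B * x := by rw [hx]; push_cast; ring
  rw [hcast] at t2 ⊢
  have t5 : B * x * (B * x * (κ * (j + 1) * r ^ j / n)) ≤
      (B : ℝ) ^ 2 * κ * A * E * (3 ^ 9 * c₁₈) / (x ^ 4 * 4 ^ k) := by
    calc B * x * (B * x * (κ * (j + 1) * r ^ j / n))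
        = B * x * (B * x * (κ * (j + 1) * r ^ j * (1 / n))) := by ring
      _ ≤ B * x * (B * x * (κ * (A * x) * r ^ j * (E * x ^ 2 / 4 ^ k))) := by gcongr
      _ = (B : ℝ) ^ 2 * κ * A * E * (x ^ 9 * r ^ j) / (x ^ 4 * 4 ^ k) := by
          field_simp
      _ ≤ _ := by gcongr
  have t6 : ((1 : ℝ) / 8) ^ (k + 1) + (1 / 8) ^ (k + 1) +
      B * x * (Real.exp lam * (1 / 8) ^ (k + 1)) ≤
      (2 + B * Real.exp lam) * c₅ / (x ^ 4 * 4 ^ k) := by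
    rw [le_div_iff₀ (by positivity)]
    have e : 0 ≤ ((1 : ℝ) / 8) ^ (k + 1) * (x ^ 4 * 4 ^ k) := by positivity
    have e0 : ((1 : ℝ) / 8) ^ (k + 1) * (x ^ 4 * 4 ^ k) ≤ c₅ := by nlinarith
    have e1 : 0 ≤ B * Real.exp lam := by positivity
    have e2 := mul_le_mul_of_nonneg_left h8x e1
    nlinarith
  have t7 : B * x * (Real.exp lam * (1 / 2) ^ (B * (k + 1))) ≤
      B * x * (Real.exp lam * (1 / 8) ^ (k + 1)) := by gcongr
  rw [add_div]
  linarith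

/-! ### Failure of the ordering of sums and of the duels -/

section Fail

variable {K : ℕ} {Ω : Type u} [MeasurableSpace Ω] {P : Measure Ω} [IsProbabilityMeasure P]
    {ν : Fin K → Measure ℝ} {Y : Fin K → ℕ → Ω → ℝ} {U : ℕ → Fin K → Ω → ℝ}

omit [IsProbabilityMeasure P] in
theorem measure_exists_ge_le [IsFiniteMeasure P] {A : ℕ → Set Ω} {r c : ℝ} (hr0 : 0 ≤ r)
    (hr1 : r < 1)
    (hc : 0 ≤ c) (J : ℕ) (h : ∀ n ≥ J, P.real (A n) ≤ c * r ^ n) :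
    P.real {ω | ∃ n ≥ J, ω ∈ A n} ≤ c * (r ^ J / (1 - r)) := by
  have hsum : HasSum (fun n => c * r ^ J * r ^ n) (c * r ^ J * (1 - r)⁻¹) :=
    (hasSum_geometric_of_lt_one hr0 hr1).mul_left _
  have hsub : {ω | ∃ n ≥ J, ω ∈ A n} ⊆ ⋃ n, A (J + n) := by
    rintro ω ⟨n, hn, hω⟩
    exact Set.mem_iUnion.2 ⟨n - J, by rwa [Nat.add_sub_cancel' hn]⟩
  have hr2 : 0 ≤ (1 - r)⁻¹ := inv_nonneg.2 (by linarith)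
  refine ENNReal.toReal_le_of_le_ofReal
    (mul_nonneg hc (div_nonneg (by positivity) (by linarith))) ?_
  rw [show c * (r ^ J / (1 - r)) = c * r ^ J * (1 - r)⁻¹ by rw [div_eq_mul_inv]; ring]
  refine (measure_mono hsub).trans ((measure_iUnion_le _).trans ?_)
  rw [← hsum.tsum_eq, ENNReal.ofReal_tsum_of_nonneg (fun n => by positivity) hsum.summable]
  refine ENNReal.tsum_le_tsum fun n => ?_
  rw [← ENNReal.ofReal_toReal (measure_ne_top P _)]
  refine ENNReal.ofReal_le_ofReal ((h (J + n) (Nat.le_add_right J n)).trans (le_of_eq ?_))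
  rw [pow_add, mul_assoc]

/-- The sums of `ν`-rewards stay below, and those of `ν'`-rewards stay above, the line of slope
`d`. -/
def Separated (ν ν' : Measure ℝ) (d r : ℝ) : Prop :=
  ∀ n, (seqLaw ν).real {x | 0 ≤ walk d x n} ≤ r ^ n ∧ (seqLaw ν').real {x | walk d x n ≤ 0} ≤ r ^ n

/-- Chernoff's bound at a small parameter on one side, the change of measure on the other. All
larger rates are admitted so that finitely many pairs can share one. -/
theorem Pair.exists_separated {ν₀ : Measure ℝ} [IsProbabilityMeasure ν₀] {d lam : ℝ}
    (hp : Pair ν₀ d lam) : ∃ r < 1, ∀ r' ≥ r, Separated ν₀ (ν₀.tilted fun x => lam * x) d r' := by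
  obtain ⟨s₀, hs₀, hs₀l, hs₀M⟩ := exists_expMom_lt_one hp.integrable_id hp.mean_lt hp.lam_pos
    hp.integrable_exp
  have hints₀ := integrable_exp_of_le hs₀.le hs₀l hp.integrable_exp
  have hM₀ : 0 < expMom ν₀ d s₀ := expMom_pos hints₀
  have hM : 0 < expMom ν₀ d lam := expMom_pos hp.integrable_exp
  refine ⟨max (expMom ν₀ d s₀) (expMom ν₀ d lam)⁻¹, max_lt hs₀M (inv_lt_one_of_one_lt₀ hp.one_lt),
    fun r' hr' n => ⟨?_, ?_⟩⟩
  · refine (measure_le_walk_le hs₀.le hints₀ n 0).trans ?_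
    simp only [mul_zero, neg_zero, Real.exp_zero, one_mul]
    exact pow_le_pow_left₀ hM₀.le ((le_max_left _ _).trans hr') n
  · have h := measure_walk_tilted_le (d := d) hp.lam_pos.le hp.integrable_exp n
      (V := Set.Iic 0) measurableSet_Iic (σ := 0) fun v hv => hv
    refine h.trans ((mul_le_of_le_one_right (by positivity) measureReal_le_one).trans ?_)
    rw [mul_zero, Real.exp_zero, one_div, ← inv_pow]
    exact pow_le_pow_left₀ (inv_pos.2 hM).le ((le_max_right _ _).trans hr') n

omit [IsProbabilityMeasure P] in
theorem measure_walk_window (hban : IsBandit P ν Y U) (k : Fin K) [IsProbabilityMeasure (ν k)]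
    (d : ℝ) (m n : ℕ) {V : Set ℝ} (hV : MeasurableSet V) :
    P.real {ω | walk d (window k m (env Y U ω)) n ∈ V} = (seqLaw (ν k)).real {x | walk d x n ∈ V} :=
  measure_window hban k m (T := {x | walk d x n ∈ V}) (measurable_walk n hV)

theorem psum_eq_walk (d : ℝ) (e : Env K) (k : Fin K) (n : ℕ) :
    psum e.1 k n = walk d (window k 0 e) n + n * d := by
  have := psum_add_walk d e k 0 n
  rw [zero_add] at this
  rw [this]
  simp [psum]

theorem measure_exists_psum_le (hban : IsBandit P ν Y U) {b a : Fin K}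
    [IsProbabilityMeasure (ν b)] [IsProbabilityMeasure (ν a)] {d r : ℝ} (hr0 : 0 ≤ r) (hr1 : r < 1)
    (hsep : Separated (ν b) (ν a) d r) (lo : ℕ) :
    P.real {ω | ∃ n ≥ lo, psum (env Y U ω).1 a n ≤ psum (env Y U ω).1 b n} ≤
      2 * (r ^ lo / (1 - r)) := by
  refine measure_exists_ge_le (A := fun n =>
    {ω | psum (env Y U ω).1 a n ≤ psum (env Y U ω).1 b n}) hr0 hr1 (by norm_num) lo fun n _ => ?_
  have hsub : {ω | psum (env Y U ω).1 a n ≤ psum (env Y U ω).1 b n} ⊆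
      {ω | walk d (window b 0 (env Y U ω)) n ∈ Set.Ici 0} ∪
        {ω | walk d (window a 0 (env Y U ω)) n ∈ Set.Iic 0} := by
    intro ω hω
    by_contra hcon
    rw [Set.mem_union, not_or] at hcon
    have h1 : walk d (window b 0 (env Y U ω)) n < 0 := not_le.1 hcon.1
    have h2 : 0 < walk d (window a 0 (env Y U ω)) n := not_le.1 hcon.2
    have h3 : psum (env Y U ω).1 a n ≤ psum (env Y U ω).1 b n := hω
    rw [psum_eq_walk d, psum_eq_walk d] at h3
    linarith
  refine (measureReal_mono hsub).trans ((measureReal_union_le _ _).trans ?_)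
  rw [measure_walk_window hban b d 0 n measurableSet_Ici,
    measure_walk_window hban a d 0 n measurableSet_Iic]
  have h1 := (hsep n).1
  have h2 := (hsep n).2
  simp only [Set.mem_Ici, Set.mem_Iic]
  linarith

/-- For each `n`, either one of the `T` blocks of `b` lies on or above the line of slope `d`, or the
start of `a`, common to all these duels, lies on or below it. -/
theorem measure_exists_psum_lt_block (hban : IsBandit P ν Y U) {b a : Fin K}
    [IsProbabilityMeasure (ν b)] [IsProbabilityMeasure (ν a)] {d r : ℝ} (hr0 : 0 ≤ r) (hr1 : r < 1)
    (hsep : Separated (ν b) (ν a) d r) (J T : ℕ) :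
    P.real {ω | ∃ n ≥ J, ∃ m < T, n ≤ m ∧ psum (env Y U ω).1 a n <
      psum (env Y U ω).1 b m - psum (env Y U ω).1 b (m - n)} ≤
      (T + 1) * (r ^ J / (1 - r)) := by
  refine measure_exists_ge_le (A := fun n => {ω | ∃ m < T, n ≤ m ∧ psum (env Y U ω).1 a n <
      psum (env Y U ω).1 b m - psum (env Y U ω).1 b (m - n)}) hr0 hr1 (by positivity) J fun n _ =>
          ?_
  have hsub : {ω | ∃ m < T, n ≤ m ∧ psum (env Y U ω).1 a n <
      psum (env Y U ω).1 b m - psum (env Y U ω).1 b (m - n)} ⊆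
      (⋃ m ∈ Finset.range T, {ω | walk d (window b (m - n) (env Y U ω)) n ∈ Set.Ici 0}) ∪
        {ω | walk d (window a 0 (env Y U ω)) n ∈ Set.Iic 0} := by
    rintro ω ⟨m, hm, hnm, hω⟩
    by_contra hcon
    rw [Set.mem_union, not_or] at hcon
    have h1 : walk d (window b (m - n) (env Y U ω)) n < 0 := by
      by_contra h
      exact hcon.1 (Set.mem_iUnion₂.2 ⟨m, Finset.mem_range.2 hm, not_lt.1 h⟩)
    have h2 : 0 < walk d (window a 0 (env Y U ω)) n := not_le.1 hcon.2
    have h3 := psum_add_walk d (env Y U ω) b (m - n) n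
    rw [Nat.sub_add_cancel hnm] at h3
    rw [psum_eq_walk d _ a, h3] at hω
    linarith
  refine (measureReal_mono hsub (measure_ne_top _ _)).trans ((measureReal_union_le _ _).trans ?_)
  rw [measure_walk_window hban a d 0 n measurableSet_Iic, add_mul, one_mul]
  refine add_le_add ((measureReal_biUnion_finset_le _ _).trans ?_) (hsep n).2
  refine (Finset.sum_le_card_nsmul _ _ (r ^ n) fun m _ => ?_).trans (by simp)
  rw [measure_walk_window hban b d _ n measurableSet_Ici]
  exact (hsep n).1

end Fail

/-! ### Bounding the probability of a suboptimal leader -/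

/-- Any two laws with different means are exponential tilts of each other, with the tail bounds that
this entails, and laws with the same mean coincide. -/
structure IsTiltFamily {K : ℕ} (ν : Fin K → Measure ℝ) : Prop where
  prob : ∀ k, IsProbabilityMeasure (ν k)
  pair : ∀ b a, mean (ν b) < mean (ν a) →
    ∃ d lam, Pair (ν b) d lam ∧ ν a = (ν b).tilted fun x => lam * x
  ext : ∀ a b, mean (ν a) = mean (ν b) → ν a = ν b

theorem exists_uniform_separated {K : ℕ} {ν : Fin K → Measure ℝ} (h : IsTiltFamily ν) :
    ∃ r : ℝ, 0 < r ∧ r < 1 ∧ ∀ b a, mean (ν b) < mean (ν a) → ∃ d, Separated (ν b) (ν a) d r := by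
  have h1 : ∀ p : Fin K × Fin K, ∃ r < (1 : ℝ), ∀ r' ≥ r, mean (ν p.1) < mean (ν p.2) →
      ∃ d, Separated (ν p.1) (ν p.2) d r' := by
    rintro ⟨b, a⟩
    by_cases hba : mean (ν b) < mean (ν a)
    · obtain ⟨d, lam, hp, ht⟩ := h.pair b a hba
      have := h.prob b
      obtain ⟨r, hr, hs⟩ := hp.exists_separated
      exact ⟨r, hr, fun r' hr' _ => ⟨d, by simpa only [ht] using hs r' hr'⟩⟩
    · exact ⟨0, one_pos, fun r' _ h' => absurd h' hba⟩
  choose rr hrr hs using h1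
  obtain ⟨r, hr0, hr1, hr⟩ : ∃ r : ℝ, 0 < r ∧ r < 1 ∧ ∀ p, rr p ≤ r := by
    have : ∀ᶠ r in nhdsWithin (1 : ℝ) (Set.Iio 1), ∀ p, rr p ≤ r :=
      Filter.eventually_all.2 fun p => Filter.mem_of_superset
        (Ioo_mem_nhdsLT (hrr p)) fun r hr => hr.1.le
    obtain ⟨r, h1, h2⟩ := (this.and (Ioo_mem_nhdsLT (show (0 : ℝ) < 1 by norm_num))).exists
    exact ⟨r, h2.1, h2.2, h1⟩
  exact ⟨r, hr0, hr1, fun b a hba => hs (b, a) r (hr _) hba⟩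

theorem sqrt_log_lt_add_two {k t : ℕ} (h : t + 1 ≤ 4 ^ k) :
    Real.sqrt (Real.log (t + 1 : ℕ)) < (k + 2 : ℕ) := by
  rw [Real.sqrt_lt' (by positivity)]
  have e2 : Real.log (t + 1 : ℕ) ≤ Real.log ((4 : ℝ) ^ k) :=
    Real.log_le_log (by positivity) (by exact_mod_cast h)
  rw [Real.log_pow] at e2
  have e3 : Real.log 4 ≤ 2 := by
    rw [show (4 : ℝ) = 2 ^ 2 by norm_num, Real.log_pow]
    push_cast
    linarith [Real.log_two_lt_d9]
  have e4 : (k : ℝ) * Real.log 4 ≤ k * 2 := mul_le_mul_of_nonneg_left e3 k.cast_nonneg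
  push_cast at e2 ⊢
  nlinarith [k.cast_nonneg (α := ℝ)]

theorem exists_forall_pow_le (p c : ℕ) {q : ℕ} (hq : 1 < q) :
    ∀ᶠ k : ℕ in Filter.atTop, c * (k + 1) ^ p ≤ q ^ k := by
  have hq0 : (0 : ℝ) < q := by exact_mod_cast (by omega : 0 < q)
  have t := (tendsto_pow_const_div_const_pow_of_one_lt p
    (show (1 : ℝ) < q by exact_mod_cast hq)).comp (Filter.tendsto_add_atTop_nat 1)
  filter_upwards [t.eventually (ge_mem_nhds (show (0 : ℝ) < 1 / (q * (c + 1)) by positivity))]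
    with k hk
  simp only [Function.comp] at hk
  rw [div_le_div_iff₀ (by positivity) (by positivity), one_mul, pow_succ] at hk
  have h1 : (c : ℝ) * ((k + 1 : ℕ) : ℝ) ^ p ≤ q ^ k := by
    have h3 : (c + 1 : ℝ) * ((k + 1 : ℕ) : ℝ) ^ p * q ≤ q ^ k * q := by linarith
    have h4 := le_of_mul_le_mul_right h3 hq0
    have h5 : (0 : ℝ) ≤ ((k + 1 : ℕ) : ℝ) ^ p := by positivity
    linarith
  exact_mod_cast h1

theorem mul_two_pow_add_le {K k X : ℕ} (hK : 4 * K * (K + 1) ≤ 2 ^ k)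
    (hX : 8 * K * (K + 1) * X ≤ 4 ^ k) : K * (2 ^ k + X) ≤ 4 ^ k / (2 * (K + 1)) := by
  have hsq : (4 : ℕ) ^ k = 2 ^ k * 2 ^ k := by rw [← mul_pow]; norm_num
  rw [Nat.le_div_iff_mul_le (by positivity)]
  have e3 : 4 * K * (K + 1) * 2 ^ k ≤ 4 ^ k := by
    rw [hsq]; exact Nat.mul_le_mul_right _ hK
  have e4 : K * (2 ^ k + X) * (2 * (K + 1)) =
      2 * K * (K + 1) * 2 ^ k + 2 * K * (K + 1) * X := by ring
  have e5 : 4 * K * (K + 1) * 2 ^ k = 2 * (2 * K * (K + 1) * 2 ^ k) := by ring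
  have e6 : 8 * K * (K + 1) * X = 4 * (2 * K * (K + 1) * X) := by ring
  omega

theorem mul_div_add_lt {K k : ℕ} (h1 : 1 ≤ K) (hK : 4 * K * (K + 1) ≤ 2 ^ k) :
    (K + 1) * (4 ^ k / (2 * (K + 1))) + K < 4 ^ k := by
  have hsq : (4 : ℕ) ^ k = 2 ^ k * 2 ^ k := by rw [← mul_pow]; norm_num
  have e1 : 4 ^ k / (2 * (K + 1)) * (2 * (K + 1)) ≤ 4 ^ k := Nat.div_mul_le_self _ _
  have e2 : 4 ^ k / (2 * (K + 1)) * (2 * (K + 1)) = 2 * ((K + 1) * (4 ^ k / (2 * (K + 1)))) := by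
    ring
  have e4 : 4 * K * 1 ≤ 4 * K * (K + 1) := Nat.mul_le_mul_left _ (by omega)
  have e5 : 2 ^ k ≤ 2 ^ k * 2 ^ k := Nat.le_mul_of_pos_right _ (by positivity)
  omega

theorem geometric_two_pow_le {r c : ℝ} (hr0 : 0 ≤ r) (hr1 : r < 1)
    (h : ∀ n : ℕ, (n : ℝ) ^ 4 * r ^ n ≤ c) (k : ℕ) :
    2 * (r ^ (2 ^ k) / (1 - r)) ≤ 2 * (c / (1 - r)) / (((k : ℝ) + 1) ^ 2 * 4 ^ k) := by
  have h1r : 0 < 1 - r := by linarith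
  have hx2 : (k : ℝ) + 1 ≤ 2 ^ k := by
    have : k + 1 ≤ 2 ^ k := Nat.lt_two_pow_self
    exact_mod_cast this
  rw [le_div_iff₀ (by positivity)]
  have e3 : ((k : ℝ) + 1) ^ 2 * 4 ^ k ≤ ((2 ^ k : ℕ) : ℝ) ^ 4 := by
    push_cast
    calc ((k : ℝ) + 1) ^ 2 * 4 ^ k ≤ ((2 : ℝ) ^ k) ^ 2 * 4 ^ k := by gcongr
      _ = _ := by
        rw [show (4 : ℝ) = 2 ^ 2 by norm_num, ← pow_mul, ← pow_mul, ← pow_mul, ← pow_add]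
        congr 1; ring
  have e4 : r ^ (2 ^ k) * (((k : ℝ) + 1) ^ 2 * 4 ^ k) ≤ c := by
    refine le_trans ?_ (h (2 ^ k))
    rw [mul_comm]
    gcongr
  calc 2 * (r ^ (2 ^ k) / (1 - r)) * (((k : ℝ) + 1) ^ 2 * 4 ^ k)
      = 2 * ((r ^ (2 ^ k) * (((k : ℝ) + 1) ^ 2 * 4 ^ k)) / (1 - r)) := by ring
    _ ≤ _ := by gcongr

/-- The `4^(k + 1)` positions of blocks and the target `4^(-k)` together cost about `16^k`; the base
`1 / 32` leaves a factor `2^(-k)` for the square. -/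
theorem geometric_mul_le {r c : ℝ} {A : ℕ} (hr0 : 0 ≤ r) (hr1 : r < 1) (hA : r ^ A ≤ 1 / 32)
    (h : ∀ n : ℕ, (n : ℝ) ^ 2 * (1 / 2) ^ n ≤ c) (k : ℕ) :
    (((4 ^ (k + 1) : ℕ) : ℝ) + 1) * (r ^ (A * (k + 1)) / (1 - r)) ≤
      2 * c / (1 - r) / (((k : ℝ) + 1) ^ 2 * 4 ^ k) := by
  have h1r : 0 < 1 - r := by linarith
  rw [le_div_iff₀ (by positivity)]
  have e2 : r ^ (A * (k + 1)) ≤ (1 / 32) ^ (k + 1) := by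
    rw [pow_mul]
    exact pow_le_pow_left₀ (by positivity) hA _
  have e3 := h (k + 1)
  push_cast at e3
  have e4 : (((4 ^ (k + 1) : ℕ) : ℝ) + 1) * r ^ (A * (k + 1)) * (((k : ℝ) + 1) ^ 2 * 4 ^ k) ≤
      2 * c := by
    have e5 : (((4 ^ (k + 1) : ℕ) : ℝ) + 1) ≤ 2 * 4 ^ (k + 1) := by
      push_cast
      have : (1 : ℝ) ≤ 4 ^ (k + 1) := one_le_pow₀ (by norm_num)
      linarith
    have e6 : (4 : ℝ) ^ k ≤ 4 ^ (k + 1) := pow_le_pow_right₀ (by norm_num) (Nat.le_succ k)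
    calc (((4 ^ (k + 1) : ℕ) : ℝ) + 1) * r ^ (A * (k + 1)) * (((k : ℝ) + 1) ^ 2 * 4 ^ k)
        ≤ (2 * 4 ^ (k + 1)) * (1 / 32) ^ (k + 1) * (((k : ℝ) + 1) ^ 2 * 4 ^ (k + 1)) := by gcongr
      _ = 2 * (((k : ℝ) + 1) ^ 2 * (1 / 2) ^ (k + 1)) := by
        have : ((1 : ℝ) / 2) ^ (k + 1) = 4 ^ (k + 1) * (1 / 32) ^ (k + 1) * 4 ^ (k + 1) := by
          rw [← mul_pow, ← mul_pow]; norm_num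
        rw [this]; ring
      _ ≤ _ := by linarith
  calc (((4 ^ (k + 1) : ℕ) : ℝ) + 1) * (r ^ (A * (k + 1)) / (1 - r)) * (((k : ℝ) + 1) ^ 2 * 4 ^ k)
      = ((((4 ^ (k + 1) : ℕ) : ℝ) + 1) * r ^ (A * (k + 1)) * (((k : ℝ) + 1) ^ 2 * 4 ^ k)) /
          (1 - r) := by
        ring
    _ ≤ _ := by gcongr

set_option maxHeartbeats 1000000 in
/-- The leader is suboptimal only on an event whose probability is summable on the exponential
scale. -/
theorem exists_measure_lead_le {K : ℕ} [NeZero K] {ν : Fin K → Measure ℝ} (h : IsTiltFamily ν)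
    (s : Fin K) : ∃ c : ℝ, 0 ≤ c ∧ ∀ (Ω : Type u) [MeasurableSpace Ω] (P : Measure Ω)
      [IsProbabilityMeasure P] (Y : Fin K → ℕ → Ω → ℝ) (U : ℕ → Fin K → Ω → ℝ),
      IsBandit P ν Y U → ∀ k : ℕ,
      P.real {ω | ∃ t, 4 ^ k ≤ t ∧ t < 4 ^ (k + 1) ∧
        mean (ν (lead (env Y U ω).1 (env Y U ω).2 t)) < mean (ν s)} ≤
        c / (((k : ℝ) + 1) ^ 2 * 4 ^ k) := by
  classical
  have hprob := h.prob
  have hK : 1 ≤ K := Nat.one_le_iff_ne_zero.2 (NeZero.ne K)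
  obtain ⟨r, hr0, hr1, hsep⟩ := exists_uniform_separated h
  choose d hd using hsep
  have hclean : ∀ b : Fin K, ∃ (κ r lam : ℝ) (C : ℕ), 0 ≤ κ ∧ 0 < r ∧ r < 1 ∧ 0 < lam ∧
      (mean (ν b) < mean (ν s) → ∀ (Ω : Type u) [MeasurableSpace Ω] (P : Measure Ω)
        [IsProbabilityMeasure P] (Y : Fin K → ℕ → Ω → ℝ) (U : ℕ → Fin K → Ω → ℝ),
        IsBandit P ν Y U → ∀ j lo D τ n : ℕ, 1 ≤ j → j ≤ lo → 1 ≤ n → n * (C * (τ + j + 1)) ≤ D →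
        P.real {ω | Clean (env Y U ω).1 (env Y U ω).2 s j
            (Finset.univ.filter fun k => mean (ν k) = mean (ν b)) lo (lo + D)} ≤
          (K * r ^ j) ^ n + Real.exp (-(lam * τ)) + τ * (Real.exp lam * (1 / 2) ^ τ) +
            τ * (τ * (κ * (j + 1) * r ^ j / n))) := by
    intro b
    by_cases hb : mean (ν b) < mean (ν s)
    · obtain ⟨d, lam, hp, ht⟩ := h.pair b s hb
      obtain ⟨κ, r, C, h1, h2, h3, -, h5⟩ := exists_measure_clean_le.{u} hp K
      refine ⟨κ, r, lam, C, h1, h2, h3, hp.lam_pos, fun _ Ω _ P _ Y U hban j lo D τ n => ?_⟩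
      refine h5 s _ ν ?_ ?_ ht Ω P Y U hban j lo D τ n
      · simp [hb.ne']
      · intro k hk
        exact h.ext k b (Finset.mem_filter.1 hk).2
    · exact ⟨0, 1 / 2, 1, 0, le_rfl, by norm_num, by norm_num, one_pos, fun h' => absurd h' hb⟩
  choose κ rb lam C hκ hrb0 hrb1 hlam hclean using hclean
  obtain ⟨B, hB3, hB⟩ : ∃ B : ℕ, 3 ≤ B ∧ ∀ b, Real.exp (-(lam b * B)) ≤ 1 / 8 := by
    have h1 : ∀ b, ∀ᶠ B : ℕ in Filter.atTop, Real.exp (-(lam b * B)) ≤ 1 / 8 := fun b =>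
      ((Real.tendsto_exp_neg_atTop_nhds_zero.comp
        (tendsto_natCast_atTop_atTop.const_mul_atTop (hlam b))).eventually
          (ge_mem_nhds (by norm_num)))
    obtain ⟨B, h2, h3⟩ := ((Filter.eventually_ge_atTop 3).and (Filter.eventually_all.2 h1)).exists
    exact ⟨B, h2, h3⟩
  obtain ⟨A, hA1, hA⟩ : ∃ A : ℕ, 1 ≤ A ∧ r ^ A ≤ 1 / 32 := by
    obtain ⟨A, h1, h2⟩ := ((Filter.eventually_ge_atTop 1).and
      ((tendsto_pow_atTop_nhds_zero_of_lt_one hr0.le hr1).eventually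
        (ge_mem_nhds (show (0 : ℝ) < 1 / 32 by norm_num)))).exists
    exact ⟨A, h1, h2⟩
  set C₀ : ℕ := ∑ b, C b + 1 with hC₀
  have hC : ∀ b, C b ≤ C₀ := fun b =>
    (Finset.single_le_sum (f := C) (fun _ _ => Nat.zero_le _) (Finset.mem_univ b)).trans
      (Nat.le_succ _)
  -- The total length of all windows will be `n * (E₁ * (k + 1)^2)`; `E₂` makes it small enough for
  -- `K * (lo + W * D) ≤ u₀`.
  set E₁ : ℕ := (A + 3 * K) * (C₀ * (A + B)) with hE₁
  set E₂ : ℕ := 8 * K * (K + 1) * E₁ with hE₂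
  have hE₂0 : 1 ≤ E₂ := by
    have : 0 < (A + 3 * K) * (C₀ * (A + B)) := by positivity
    have h3 : 0 < 8 * K * (K + 1) * E₁ := by positivity
    exact h3
  have hwin : ∀ b, ∃ (c : ℝ) (k₀ : ℕ), 0 < c ∧ ∀ k ≥ k₀, ∀ j n : ℕ,
      Real.sqrt (Real.log ((2 : ℝ) ^ k)) < j → j < A * (k + 1) → k + 1 ≤ n →
      (4 : ℝ) ^ k ≤ n * ((2 * E₂ : ℕ) * ((k : ℝ) + 1) ^ 2) →
      (K * rb b ^ j) ^ n + Real.exp (-(lam b * (B * (k + 1) : ℕ))) +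
        ((B * (k + 1) : ℕ) : ℝ) * (Real.exp (lam b) * (1 / 2) ^ (B * (k + 1))) +
        ((B * (k + 1) : ℕ) : ℝ) * (((B * (k + 1) : ℕ) : ℝ) * (κ b * (j + 1) * rb b ^ j / n)) ≤
        c / (((k : ℝ) + 1) ^ 4 * 4 ^ k) := fun b =>
    exists_window_bound K A B (hκ b) (hrb0 b) (hrb1 b) (Nat.cast_nonneg _) (hB b) hB3
  choose cw k₀ hcw hwin using hwin
  obtain ⟨c₄, hc₄, h4⟩ := exists_pow_mul_pow_le 4 hr0.le hr1
  obtain ⟨c₂, hc₂, h2⟩ := exists_pow_mul_pow_le 2 (show (0 : ℝ) ≤ 1 / 2 by norm_num) (by norm_num)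
  obtain ⟨k₁, hk₁⟩ : ∃ k₁ : ℕ, ∀ k ≥ k₁, (∀ b, k₀ b ≤ k) ∧ 4 * K * (K + 1) ≤ 2 ^ k ∧
      A * (k + 1) ≤ 2 ^ k ∧ (k + 1) * (E₂ * (k + 1) ^ 2) ≤ 4 ^ k := by
    have e1 : ∀ᶠ k : ℕ in Filter.atTop, ∀ b, k₀ b ≤ k :=
      Filter.eventually_all.2 fun b => Filter.eventually_ge_atTop _
    have e2 : ∀ᶠ k : ℕ in Filter.atTop, 4 * K * (K + 1) ≤ 2 ^ k :=
      (tendsto_pow_atTop_atTop_of_one_lt (show 1 < 2 by norm_num)).eventually_ge_atTop _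
    obtain ⟨k₁, hk⟩ := Filter.eventually_atTop.1
      ((e1.and e2).and ((exists_forall_pow_le 1 A (show 1 < 2 by norm_num)).and
        (exists_forall_pow_le 3 E₂ (show 1 < 4 by norm_num))))
    refine ⟨k₁, fun k hk' => ?_⟩
    obtain ⟨⟨a1, a2⟩, a3, a4⟩ := hk k hk'
    refine ⟨a1, a2, by simpa using a3, le_trans (le_of_eq ?_) a4⟩
    ring
  refine ⟨(k₁ + 1 : ℝ) ^ 2 * 4 ^ k₁ + (K ^ 2 * (2 * (c₄ / (1 - r))) + K * (2 * c₂ / (1 - r)) +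
    (A + 3 * K) * A * ∑ b, cw b), ?_, ?_⟩
  · have : 0 < 1 - r := by linarith
    have h3 : 0 ≤ ∑ b, cw b := Finset.sum_nonneg fun b _ => (hcw b).le
    positivity
  intro Ω _ P _ Y U hban k
  have h1r : 0 < 1 - r := by linarith
  have hcw0 : 0 ≤ ∑ b, cw b := Finset.sum_nonneg fun b _ => (hcw b).le
  set x : ℝ := (k : ℝ) + 1 with hx
  have hx0 : 0 < x := by positivity
  -- For the finitely many small scales the first summand of the constant makes the claimed bound at
  -- least one.
  rcases lt_or_ge k k₁ with hk | hk
  · refine measureReal_le_one.trans ?_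
    rw [le_div_iff₀ (by positivity), one_mul]
    have h3 : x ^ 2 * 4 ^ k ≤ (k₁ + 1 : ℝ) ^ 2 * 4 ^ k₁ := by
      have : (k : ℝ) ≤ k₁ := by exact_mod_cast hk.le
      have h5 : x ≤ k₁ + 1 := by linarith
      have h6 : (4 : ℝ) ^ k ≤ 4 ^ k₁ := pow_le_pow_right₀ (by norm_num) hk.le
      gcongr
    have h7 : 0 ≤ K ^ 2 * (2 * (c₄ / (1 - r))) + K * (2 * c₂ / (1 - r)) +
      (A + 3 * K) * A * ∑ b, cw b := by positivity
    linarith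
  obtain ⟨hk0, hkK, hkA, hkE⟩ := hk₁ k hk
  -- As many cells per window as fit: of order `4^k / (k + 1)^2`.
  set n : ℕ := 4 ^ k / (E₂ * (k + 1) ^ 2) with hn
  have hEk : 0 < E₂ * (k + 1) ^ 2 := by positivity
  have hnk : k + 1 ≤ n := (Nat.le_div_iff_mul_le hEk).2 hkE
  have hn4 : n * (E₂ * (k + 1) ^ 2) ≤ 4 ^ k := Nat.div_mul_le_self _ _
  have hn4' : 4 ^ k ≤ n * (2 * E₂ * (k + 1) ^ 2) := by
    have h3 := Nat.lt_div_mul_add (a := 4 ^ k) hEk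
    rw [← hn] at h3
    nlinarith
  set J := A * (k + 1) with hJ
  set τ := B * (k + 1) with hτ
  set W := (A + 3 * K) * (k + 1) with hW
  set D := n * (C₀ * ((A + B) * (k + 1))) with hD
  set lo := 2 ^ k with hlo
  -- Early enough for `s` to overtake the leader between `u₀` and `4^k`, and late enough for all
  -- windows to lie below the level reached at `u₀`.
  set u₀ := 4 ^ k / (2 * (K + 1)) with hu₀
  have hlo1 : 1 ≤ lo := Nat.one_le_two_pow
  have hKlo : K < lo := by nlinarith
  have hD1 : 1 ≤ D := by
    have : 0 < n := by omega
    have h3 : 0 < n * (C₀ * ((A + B) * (k + 1))) := by positivity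
    exact h3
  have hu1 : K * (lo + W * D) ≤ u₀ := by
    have e1 : W * D = n * (E₁ * (k + 1) ^ 2) := by rw [hW, hD, hE₁]; ring
    refine mul_two_pow_add_le hkK ?_
    rw [e1]
    refine le_trans (le_of_eq ?_) hn4
    rw [hE₂]; ring
  have hu2 : (K + 1) * u₀ + K < 4 ^ k := mul_div_add_lt hK hkK
  have hF : ∀ t < u₀, Real.sqrt (Real.log (t + 1 : ℕ)) < (k + 2 : ℕ) := fun t ht =>
    sqrt_log_lt_add_two ((Nat.succ_le_of_lt ht).trans (Nat.div_le_self _ _))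
  have hWle : J + K + K * (k + 2) ≤ W := by rw [hJ, hW]; nlinarith
  -- the failure events
  set M : Fin K → Fin K → Set Ω := fun b a =>
    {ω | mean (ν b) < mean (ν a) ∧ ∃ n ≥ lo, psum (env Y U ω).1 a n ≤ psum (env Y U ω).1 b n} with
        hM
  set N : Fin K → Set Ω := fun b =>
    {ω | mean (ν b) < mean (ν s) ∧ ∃ n ≥ J, ∃ m < 4 ^ (k + 1), n ≤ m ∧ psum (env Y U ω).1 s n <
      psum (env Y U ω).1 b m - psum (env Y U ω).1 b (m - n)} with hN
  set Z : ℕ → ℕ → Fin K → Set Ω := fun w j b =>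
    {ω | mean (ν b) < mean (ν s) ∧ Real.sqrt (Real.log lo) < j ∧
      Clean (env Y U ω).1 (env Y U ω).2 s j
        (Finset.univ.filter fun k => mean (ν k) = mean (ν b)) (lo + w * D) (lo + w * D + D)} with hZ
  have hcover : {ω | ∃ t, 4 ^ k ≤ t ∧ t < 4 ^ (k + 1) ∧
      mean (ν (lead (env Y U ω).1 (env Y U ω).2 t)) < mean (ν s)} ⊆
      ((⋃ b ∈ Finset.univ, ⋃ a ∈ Finset.univ, M b a) ∪ ⋃ b ∈ Finset.univ, N b) ∪
        ⋃ w ∈ Finset.range W, ⋃ j ∈ Finset.range J, ⋃ b ∈ Finset.univ, Z w j b := by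
    rintro ω ⟨t, ht1, ht2, ht3⟩
    by_contra hcon
    rw [Set.mem_union, Set.mem_union, not_or, not_or] at hcon
    obtain ⟨⟨n1, n2⟩, n3⟩ := hcon
    obtain ⟨w, hw, j, hj, b, hb, hlj, hcl⟩ := exists_clean (y := (env Y U ω).1) (u := (env Y U ω).2)
      (μ := fun k => mean (ν k)) (s := s) (lo := lo) (J := J) (u₀ := u₀) (t₀ := t) (D := D) (W := W)
      (F := k + 2) hKlo (fun b a hba n hn => by
        by_contra hc
        exact n1 (Set.mem_iUnion₂.2 ⟨b, Finset.mem_univ b, Set.mem_iUnion₂.2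
          ⟨a, Finset.mem_univ a, hba, n, hn, not_lt.1 hc⟩⟩)) (fun b hb n m hn hnm hm => by
        by_contra hc
        exact n2 (Set.mem_iUnion₂.2 ⟨b, Finset.mem_univ b, hb, n, hn, m, by omega, hnm,
          not_le.1 hc⟩)) (by omega) ht3 hu1 hD1 hF hWle
    exact n3 (Set.mem_iUnion₂.2 ⟨w, Finset.mem_range.2 hw, Set.mem_iUnion₂.2
      ⟨j, Finset.mem_range.2 hj, Set.mem_iUnion₂.2 ⟨b, Finset.mem_univ b, hb, hlj, hcl⟩⟩⟩)
  have bM : ∀ b a, P.real (M b a) ≤ 2 * (c₄ / (1 - r)) / (x ^ 2 * 4 ^ k) := by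
    intro b a
    by_cases hba : mean (ν b) < mean (ν a)
    · have e1 : P.real (M b a) ≤ _ := (measureReal_mono fun ω hω => hω.2).trans
        (measure_exists_psum_le hban hr0.le hr1 (hd b a hba) lo)
      exact e1.trans (geometric_two_pow_le hr0.le hr1 h4 k)
    · have : M b a = ∅ := by
        ext ω
        simp only [hM, Set.mem_ofPred_eq, Set.mem_empty_iff_false, iff_false]
        exact fun h => hba h.1
      rw [this, measureReal_empty]
      positivity
  have bN : ∀ b, P.real (N b) ≤ 2 * c₂ / (1 - r) / (x ^ 2 * 4 ^ k) := by
    intro b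
    by_cases hb : mean (ν b) < mean (ν s)
    · have e1 : P.real (N b) ≤ _ := (measureReal_mono fun ω hω => hω.2).trans
        (measure_exists_psum_lt_block hban hr0.le hr1 (hd b s hb) J (4 ^ (k + 1)))
      exact e1.trans (geometric_mul_le hr0.le hr1 hA h2 k)
    · have : N b = ∅ := by
        ext ω
        simp only [hN, Set.mem_ofPred_eq, Set.mem_empty_iff_false, iff_false]
        exact fun h => hb h.1
      rw [this, measureReal_empty]
      positivity
  have bZ : ∀ w, ∀ j ∈ Finset.range J, ∀ b, P.real (Z w j b) ≤ cw b / (x ^ 4 * 4 ^ k) := by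
    intro w j hj b
    by_cases hb : mean (ν b) < mean (ν s) ∧ Real.sqrt (Real.log lo) < j
    · obtain ⟨hb, hlj⟩ := hb
      have hj' := Finset.mem_range.1 hj
      have hj1 : 1 ≤ j := by
        have : (0 : ℝ) < j := (Real.sqrt_nonneg _).trans_lt hlj
        exact_mod_cast this
      have e1 := hclean b hb Ω P Y U hban j (lo + w * D) D τ n hj1 (by omega) (by omega) (by
        rw [hD]
        refine Nat.mul_le_mul_left n (Nat.mul_le_mul (hC b) ?_)
        rw [add_mul, ← hJ, ← hτ]
        omega)
      have e2 : P.real (Z w j b) ≤ _ := (measureReal_mono fun ω hω => hω.2.2).trans e1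
      refine e2.trans (hwin b k (hk0 b) j n ?_ hj' hnk ?_)
      · rw [hlo] at hlj
        push_cast at hlj
        exact hlj
      · rw [← mul_assoc] at hn4'
        have : ((4 ^ k : ℕ) : ℝ) ≤ ((n * (2 * E₂) * (k + 1) ^ 2 : ℕ) : ℝ) := by
          exact_mod_cast hn4'
        push_cast at this ⊢
        rw [← mul_assoc]
        exact this
    · have : Z w j b = ∅ := by
        ext ω
        simp only [hZ, Set.mem_ofPred_eq, Set.mem_empty_iff_false, iff_false]
        exact fun h => hb ⟨h.1, h.2.1⟩
      rw [this, measureReal_empty]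
      have := hcw b
      positivity
  have sM : P.real (⋃ b ∈ Finset.univ, ⋃ a ∈ Finset.univ, M b a) ≤
      K ^ 2 * (2 * (c₄ / (1 - r))) / (x ^ 2 * 4 ^ k) := by
    refine (measureReal_biUnion_finset_le _ _).trans ?_
    refine (Finset.sum_le_card_nsmul _ _ (K * (2 * (c₄ / (1 - r)) / (x ^ 2 * 4 ^ k))) fun b _ =>
        ?_).trans ?_
    · refine (measureReal_biUnion_finset_le _ _).trans ?_
      refine (Finset.sum_le_card_nsmul _ _ _ fun a _ => bM b a).trans ?_
      simp
    · simp only [Finset.card_univ, Fintype.card_fin, nsmul_eq_mul]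
      apply le_of_eq
      ring
  have sN : P.real (⋃ b ∈ Finset.univ, N b) ≤ K * (2 * c₂ / (1 - r)) / (x ^ 2 * 4 ^ k) := by
    refine (measureReal_biUnion_finset_le _ _).trans ?_
    refine (Finset.sum_le_card_nsmul _ _ _ fun b _ => bN b).trans ?_
    simp only [Finset.card_univ, Fintype.card_fin, nsmul_eq_mul]
    apply le_of_eq
    ring
  have sZ : P.real (⋃ w ∈ Finset.range W, ⋃ j ∈ Finset.range J, ⋃ b ∈ Finset.univ, Z w j b) ≤
      (A + 3 * K) * A * (∑ b, cw b) / (x ^ 2 * 4 ^ k) := by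
    refine (measureReal_biUnion_finset_le _ _).trans ?_
    refine (Finset.sum_le_card_nsmul _ _ (J * ((∑ b, cw b) / (x ^ 4 * 4 ^ k))) fun w _ => ?_).trans
        ?_
    · refine (measureReal_biUnion_finset_le _ _).trans ?_
      refine (Finset.sum_le_card_nsmul _ _ ((∑ b, cw b) / (x ^ 4 * 4 ^ k)) fun j hj => ?_).trans ?_
      · refine (measureReal_biUnion_finset_le _ _).trans ?_
        rw [Finset.sum_div]
        exact Finset.sum_le_sum fun b _ => bZ w j hj b
      · simp
    · rw [Finset.card_range, nsmul_eq_mul]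
      have eW : (W : ℝ) = (A + 3 * K) * x := by rw [hW, hx]; push_cast; ring
      have eJ : (J : ℝ) = A * x := by rw [hJ, hx]; push_cast; ring
      rw [eW, eJ]
      apply le_of_eq
      field_simp
  refine (measureReal_mono hcover (measure_ne_top _ _)).trans ((measureReal_union_le _ _).trans
    ((add_le_add ((measureReal_union_le _ _).trans (add_le_add sM sN)) sZ).trans ?_))
  rw [← add_div, ← add_div]
  have : 0 ≤ (k₁ + 1 : ℝ) ^ 2 * 4 ^ k₁ := by positivity
  exact div_le_div_of_nonneg_right (by linarith) (by positivity)

/-! ### Counting the pulls of a suboptimal arm -/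

section Count

variable {K : ℕ} [NeZero K] {y : Fin K → ℕ → ℝ} {u : ℕ → Fin K → ℝ}

/-- A pull at count `n ≥ F` is charged to a round of `A` or to the value `n` itself. Each value is
charged once, as the count increases strictly from pull to pull. -/
theorem pullCount_le_card_add (k : Fin K) (T F : ℕ) (A B : ℕ → Prop) [DecidablePred A]
    [DecidablePred B]
    (h : ∀ t < T, k ∈ sel y u t → F ≤ pullCount y u t k → A t ∨ B (pullCount y u t k)) :
    pullCount y u T k ≤ F + ((Finset.range T).filter A).card +
      ((Finset.Ico F T).filter B).card := by
  classical
  rw [pullCount_eq_card]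
  have h1 : (Finset.range T).filter (fun t => k ∈ sel y u t) ⊆
      ((Finset.range T).filter (fun t => k ∈ sel y u t ∧ pullCount y u t k < F) ∪
        (Finset.range T).filter A) ∪ (Finset.range T).filter
          (fun t => k ∈ sel y u t ∧ F ≤ pullCount y u t k ∧ B (pullCount y u t k)) := by
    intro t ht
    simp only [Finset.mem_filter, Finset.mem_union, Finset.mem_range] at ht ⊢
    rcases lt_or_ge (pullCount y u t k) F with hF | hF
    · exact Or.inl (Or.inl ⟨ht.1, ht.2, hF⟩)
    · rcases h t ht.1 ht.2 hF with h' | h'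
      · exact Or.inl (Or.inr ⟨ht.1, h'⟩)
      · exact Or.inr ⟨ht.1, ht.2, hF, h'⟩
  refine (Finset.card_le_card h1).trans ((Finset.card_union_le _ _).trans
    (add_le_add ((Finset.card_union_le _ _).trans
      (Nat.add_le_add_right (card_pulled_lt_le T F k) _)) ?_))
  refine Finset.card_le_card_of_injOn (fun t => pullCount y u t k) (fun t ht => ?_)
    ((injOn_pullCount k).mono fun t ht => ?_)
  · simp only [Finset.coe_filter, Finset.mem_range, Set.mem_ofPred_eq, Finset.mem_Ico] at ht ⊢
    exact ⟨⟨ht.2.2.1, pullCount_le.trans_lt ht.1⟩, ht.2.2.2⟩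
  · simp only [Finset.coe_filter, Finset.mem_range, Set.mem_ofPred_eq] at ht ⊢
    exact ht.2.1

end Count

/-- The `3 * 4^k` rounds of scale `k` cancel the factor `4^k`, leaving a convergent series. -/
theorem sum_range_four_pow_le {f : ℕ → ℝ} {c : ℝ} (hf : f 0 ≤ 1)
    (h : ∀ k t : ℕ, 4 ^ k ≤ t → t < 4 ^ (k + 1) → f t ≤ c / (((k : ℝ) + 1) ^ 2 * 4 ^ k)) (n : ℕ) :
    ∑ t ∈ Finset.range (4 ^ n), f t ≤ 1 + 3 * c * ∑ k ∈ Finset.range n, 1 / ((k : ℝ) + 1) ^ 2 := by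
  induction n with
  | zero => simpa using hf
  | succ n ih =>
    rw [Finset.sum_range_succ, mul_add, ← Finset.sum_range_add_sum_Ico f
      (Nat.pow_le_pow_right (by norm_num) (Nat.le_succ n)), ← add_assoc]
    refine add_le_add ih ((Finset.sum_le_card_nsmul _ _ _ fun t ht =>
      h n t (Finset.mem_Ico.1 ht).1 (Finset.mem_Ico.1 ht).2).trans (le_of_eq ?_))
    rw [Nat.card_Ico, nsmul_eq_mul, pow_succ, show 4 ^ n * 4 - 4 ^ n = 3 * 4 ^ n by omega]
    push_cast
    field_simp

/-- By the inequality of arithmetic and geometric means, the forced pulls cost only an additive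
constant beyond the logarithmic main term. -/
theorem sqrt_le_mul_add {a L L' : ℝ} (ha : 0 < a) (hL : 0 ≤ L) (hLL : L ≤ L') :
    Real.sqrt L ≤ a * L' + 1 / (4 * a) := by
  have h1 := Real.sq_sqrt hL
  have h2 : a * L + 1 / (4 * a) - Real.sqrt L = a * (Real.sqrt L - 1 / (2 * a)) ^ 2 := by
    have e : a * (Real.sqrt L - 1 / (2 * a)) ^ 2 =
      a * Real.sqrt L ^ 2 + 1 / (4 * a) - Real.sqrt L := by field_simp; ring
    rw [e, h1]
  have h3 : 0 ≤ a * (Real.sqrt L - 1 / (2 * a)) ^ 2 := by positivity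
  have h4 : a * L ≤ a * L' := mul_le_mul_of_nonneg_left hLL ha.le
  linarith

theorem sum_Ico_pow_le {r : ℝ} (hr0 : 0 ≤ r) (hr1 : r < 1) (F T : ℕ) :
    ∑ n ∈ Finset.Ico F T, r ^ n ≤ r ^ F / (1 - r) := by
  have h1 := (hasSum_geometric_of_lt_one hr0 hr1).mul_left (r ^ F)
  rw [Finset.sum_Ico_eq_sum_range]
  simp_rw [pow_add]
  rw [div_eq_mul_inv]
  exact sum_le_hasSum _ (fun i _ => by positivity) h1

/-- The number of pulls of a suboptimal arm `k` is logarithmic, with the rate at which the sums of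
the rewards of the best arms stay above the line of slope `d`. -/
theorem exists_integral_pullCount_le {K : ℕ} [NeZero K] {ν : Fin K → Measure ℝ}
    (h : IsTiltFamily ν) {s k : Fin K} (hs : ∀ i, mean (ν i) ≤ mean (ν s))
    (hk : mean (ν k) < mean (ν s)) {d lam a : ℝ}
    (hp : Pair (ν k) d lam) (htilt : ν s = (ν k).tilted fun x => lam * x) (ha : 0 < a)
    (haI : 1 ≤ a * Real.log (expMom (ν k) d lam)) :
    ∃ C : ℝ, ∀ (Ω : Type u) [MeasurableSpace Ω] (P : Measure Ω)
      [IsProbabilityMeasure P] (Y : Fin K → ℕ → Ω → ℝ) (U : ℕ → Fin K → Ω → ℝ),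
      IsBandit P ν Y U → ∀ T : ℕ,
      ∫ ω, (pullCount (env Y U ω).1 (env Y U ω).2 T k : ℝ) ∂P ≤ a * Real.log T + C := by
  classical
  have hprob := h.prob
  obtain ⟨c, hc0, hc⟩ := exists_measure_lead_le.{u} h s
  obtain ⟨s₀, hs₀, hs₀l, hρ1⟩ := exists_expMom_lt_one hp.integrable_id hp.mean_lt hp.lam_pos
    hp.integrable_exp
  have hints₀ := integrable_exp_of_le hs₀.le hs₀l hp.integrable_exp
  have hρ0 : 0 < expMom (ν k) d s₀ := expMom_pos hints₀
  have hM : 0 < expMom (ν k) d lam := expMom_pos hp.integrable_exp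
  set ρ := expMom (ν k) d s₀ with hρ
  set M := expMom (ν k) d lam with hMdef
  set q := M⁻¹ with hq
  have hq0 : 0 < q := inv_pos.2 hM
  have hq1 : q < 1 := inv_lt_one_of_one_lt₀ hp.one_lt
  have h1q : 0 < 1 - q := by linarith
  have h1ρ : 0 < 1 - ρ := by linarith
  have bρ : ∀ n, (seqLaw (ν k)).real {x | 0 ≤ walk d x n} ≤ ρ ^ n := fun n => by
    simpa using measure_le_walk_le (d := d) hs₀.le hints₀ n 0
  have bq : ∀ i, mean (ν i) = mean (ν s) → ∀ n,
      (seqLaw (ν i)).real {x | walk d x n ≤ 0} ≤ q ^ n := fun i hi n => by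
    have h1 := measure_walk_tilted_le (d := d) hp.lam_pos.le hp.integrable_exp n
      (V := Set.Iic 0) measurableSet_Iic (σ := 0) fun v hv => hv
    rw [h.ext i s hi, htilt]
    refine h1.trans ((mul_le_of_le_one_right (by positivity) measureReal_le_one).trans ?_)
    rw [mul_zero, Real.exp_zero, one_div, ← inv_pow]
  have hsum : Summable fun k : ℕ => 1 / ((k : ℝ) + 1) ^ 2 := by
    have := (summable_nat_add_iff 1).2 (Real.summable_one_div_nat_pow.2 (by norm_num : 1 < 2))
    exact_mod_cast this
  set S := ∑' k : ℕ, 1 / ((k : ℝ) + 1) ^ 2 with hS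
  have hS0 : 0 ≤ S := tsum_nonneg fun k => by positivity
  refine ⟨1 / (4 * a) + 2 + (1 + 3 * c * S) + (1 / (1 - ρ) + K * 2 / (1 - q)), ?_⟩
  intro Ω _ P _ Y U hban T
  rcases Nat.eq_zero_or_pos T with rfl | hT
  · have : 0 ≤ 1 / (4 * a) + 2 + (1 + 3 * c * S) + (1 / (1 - ρ) + K * 2 / (1 - q)) := by positivity
    simpa [pullCount] using this
  have hT1 : (1 : ℝ) ≤ T := by exact_mod_cast hT
  have hlogT : 0 ≤ Real.log T := Real.log_nonneg hT1
  -- From `F` pulls on no pull is forced, and `q ^ F ≤ 1 / T` pays for the union over the positions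
  -- of the leader's block.
  set F : ℕ := ⌈a * Real.log T + 1 / (4 * a)⌉₊ + 1 with hF
  have hF1 : a * Real.log T + 1 / (4 * a) < F := by
    rw [hF]; push_cast
    linarith [Nat.le_ceil (a * Real.log T + 1 / (4 * a))]
  have hF2 : (F : ℝ) ≤ a * Real.log T + 1 / (4 * a) + 2 := by
    rw [hF]; push_cast
    linarith [Nat.ceil_lt_add_one (show 0 ≤ a * Real.log T + 1 / (4 * a) by positivity)]
  have hqF : q ^ F ≤ 1 / T := by
    have e1 : Real.log T ≤ F * Real.log M := by
      have e2 : 0 < Real.log M := Real.log_pos hp.one_lt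
      have e3 : Real.log T ≤ Real.log T * (a * Real.log M) := le_mul_of_one_le_right hlogT haI
      have e4 : a * Real.log T ≤ F := by
        have : 0 < 1 / (4 * a) := by positivity
        linarith
      have e5 := mul_le_mul_of_nonneg_right e4 e2.le
      linarith
    rw [hq, inv_pow, one_div]
    refine inv_anti₀ (by positivity) ?_
    rw [← Real.log_le_log_iff (by positivity) (by positivity), Real.log_pow]
    exact e1
  set A : ℕ → Set Ω := fun t => {ω | mean (ν (lead (env Y U ω).1 (env Y U ω).2 t)) < mean (ν s)}
    with hA
  -- Deviations that can make the arm win a duel at count `n` against an optimal leader: its own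
  -- mean is at least `d`, or some block of an optimal arm has mean at most `d`.
  set B : ℕ → Set Ω := fun n => {ω | walk d (window k 0 (env Y U ω)) n ∈ Set.Ici 0} ∪
    ⋃ i ∈ Finset.univ.filter (fun i => mean (ν i) = mean (ν s)), ⋃ m ∈ Finset.range (T + 1),
      {ω | walk d (window i (m - n) (env Y U ω)) n ∈ Set.Iic 0} with hB
  have mA : ∀ t, MeasurableSet (A t) := fun t => by
    have : MeasurableSet {i : Fin K | mean (ν i) < mean (ν s)} := .of_discrete
    exact ((measurable_lead t).comp (measurable_env hban)) this
  have mW : ∀ i m n, ∀ V : Set ℝ, MeasurableSet V →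
      MeasurableSet {ω | walk d (window i m (env Y U ω)) n ∈ V} := fun i m n V hV =>
    ((measurable_walk n).comp ((measurable_window i m).comp (measurable_env hban))) hV
  have mB : ∀ n, MeasurableSet (B n) := fun n =>
    (mW k 0 n _ measurableSet_Ici).union (Finset.measurableSet_biUnion _ fun i _ =>
      Finset.measurableSet_biUnion _ fun m _ => mW i _ n _ measurableSet_Iic)
  have hpt : ∀ ω, (pullCount (env Y U ω).1 (env Y U ω).2 T k : ℝ) ≤
      F + (∑ t ∈ Finset.range T, (A t).indicator 1 ω) +
        ∑ n ∈ Finset.Ico F T, (B n).indicator 1 ω := by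
    intro ω
    have h1 := pullCount_le_card_add (y := (env Y U ω).1) (u := (env Y U ω).2) k T F
      (fun t => ω ∈ A t) (fun n => ω ∈ B n) ?_
    · refine (Nat.cast_le (α := ℝ).2 h1).trans (le_of_eq ?_)
      have e : ∀ (I : Finset ℕ) (D : ℕ → Set Ω) [DecidablePred fun n => ω ∈ D n],
          ((I.filter fun n => ω ∈ D n).card : ℝ) = ∑ n ∈ I, (D n).indicator 1 ω := fun I D _ => by
        simp [Set.indicator_apply]
      rw [Nat.cast_add, Nat.cast_add, e, e _ B]
    · intro t ht hsel hFt
      by_contra hcon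
      rw [not_or] at hcon
      obtain ⟨hcA, hcB⟩ := hcon
      have ht1 : 1 ≤ t := by
        by_contra h0
        have : t = 0 := by omega
        rw [this] at hFt
        simp only [pullCount] at hFt
        omega
      set n := pullCount (env Y U ω).1 (env Y U ω).2 t k with hn
      set l := lead (env Y U ω).1 (env Y U ω).2 t with hl
      set m := top (env Y U ω).1 (env Y U ω).2 t with hm
      have hlead : mean (ν l) = mean (ν s) := le_antisymm (hs l) (not_lt.1 hcA)
      have hne : k ≠ l := by
        rintro hkl
        rw [← hkl] at hlead
        exact hk.ne hlead
      have hch : Chal (env Y U ω).1 (env Y U ω).2 t k := by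
        rcases (mem_sel ht1).1 hsel with h' | h'
        · exact absurd h'.1 hne
        · exact h'.2
      rcases (chal_iff ht1).1 hch with h' | h'
      · have e1 : (F : ℝ) ≤ n := by exact_mod_cast hFt
        have e2 := sqrt_le_mul_add ha (L := Real.log (t + 1 : ℕ)) (L' := Real.log T)
          (Real.log_nonneg (by exact_mod_cast Nat.le_add_left 1 t))
          (Real.log_le_log (by positivity) (by exact_mod_cast ht))
        have e3 : (n : ℝ) ≤ Real.sqrt (Real.log (t + 1 : ℕ)) := h'
        linarith
      · rw [Set.mem_union, not_or] at hcB
        have hnm : n ≤ m := pullCount_le_top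
        have hmT : m < T + 1 := by
          have : m ≤ t := top_le_self
          omega
        have e1 : walk d (window k 0 (env Y U ω)) n < 0 := not_le.1 hcB.1
        have e2 : 0 < walk d (window l (m - n) (env Y U ω)) n := by
          by_contra h0
          exact hcB.2 (Set.mem_iUnion₂.2 ⟨l, by simpa using hlead,
            Set.mem_iUnion₂.2 ⟨m, Finset.mem_range.2 hmT, not_lt.1 h0⟩⟩)
        have e3 := psum_add_walk d (env Y U ω) l (m - n) n
        rw [Nat.sub_add_cancel hnm] at e3
        have e4 : psum (env Y U ω).1 l m - psum (env Y U ω).1 l (m - n) ≤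
          psum (env Y U ω).1 k n := h'
        rw [psum_eq_walk d _ k, e3] at e4
        linarith
  have iA : ∀ t, Integrable (fun ω => (A t).indicator (1 : Ω → ℝ) ω) P := fun t =>
    (integrable_const 1).indicator (mA t)
  have iB : ∀ n, Integrable (fun ω => (B n).indicator (1 : Ω → ℝ) ω) P := fun n =>
    (integrable_const 1).indicator (mB n)
  have sA : Integrable (fun ω => ∑ t ∈ Finset.range T, (A t).indicator (1 : Ω → ℝ) ω) P :=
    integrable_finsetSum _ fun t _ => iA t
  have sB : Integrable (fun ω => ∑ n ∈ Finset.Ico F T, (B n).indicator (1 : Ω → ℝ) ω) P :=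
    integrable_finsetSum _ fun n _ => iB n
  have hE : ∫ ω, (pullCount (env Y U ω).1 (env Y U ω).2 T k : ℝ) ∂P ≤
      F + ∑ t ∈ Finset.range T, P.real (A t) + ∑ n ∈ Finset.Ico F T, P.real (B n) := by
    refine (integral_mono_of_nonneg (ae_of_all _ fun ω => Nat.cast_nonneg _)
      (((integrable_const _).add sA).add sB) (ae_of_all _ hpt)).trans (le_of_eq ?_)
    rw [integral_add' ((integrable_const _).add sA) sB, integral_add' (integrable_const _) sA,
      integral_finsetSum _ fun t _ => iA t, integral_finsetSum _ fun t _ => iB t]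
    simp only [integral_const, probReal_univ, one_smul, integral_indicator_one, mA, mB]
  have hAle : ∑ t ∈ Finset.range T, P.real (A t) ≤ 1 + 3 * c * S := by
    have e1 : ∑ t ∈ Finset.range T, P.real (A t) ≤ ∑ t ∈ Finset.range (4 ^ T), P.real (A t) :=
      Finset.sum_le_sum_of_subset_of_nonneg (Finset.range_mono
        (Nat.lt_pow_self (by norm_num)).le) fun _ _ _ => measureReal_nonneg
    refine e1.trans ((sum_range_four_pow_le (c := c) measureReal_le_one
      (fun j t h1 h2 => ?_) T).trans ?_)
    · refine le_trans (measureReal_mono fun ω hω => ?_) (hc Ω P Y U hban j)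
      exact ⟨t, h1, h2, hω⟩
    · have := hsum.sum_le_tsum (Finset.range T) fun i _ => by positivity
      gcongr
  have hBle : ∀ n, P.real (B n) ≤ ρ ^ n + K * (T + 1) * q ^ n := by
    intro n
    refine (measureReal_union_le _ _).trans (add_le_add ?_ ?_)
    · rw [measure_walk_window hban k d 0 n measurableSet_Ici]
      exact bρ n
    · refine (measureReal_biUnion_finset_le _ _).trans ?_
      refine (Finset.sum_le_card_nsmul _ _ ((T + 1) * q ^ n) fun i hi => ?_).trans ?_
      · refine (measureReal_biUnion_finset_le _ _).trans ?_
        refine (Finset.sum_le_card_nsmul _ _ (q ^ n) fun m _ => ?_).trans (by simp)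
        rw [measure_walk_window hban i d _ n measurableSet_Iic]
        exact bq i (Finset.mem_filter.1 hi).2 n
      · rw [nsmul_eq_mul, mul_assoc]
        refine mul_le_mul_of_nonneg_right ?_ (by positivity)
        have := Finset.card_filter_le (Finset.univ : Finset (Fin K))
          (fun i => mean (ν i) = mean (ν s))
        rw [Finset.card_univ, Fintype.card_fin] at this
        exact_mod_cast this
  have hBsum : ∑ n ∈ Finset.Ico F T, P.real (B n) ≤ 1 / (1 - ρ) + K * 2 / (1 - q) := by
    refine (Finset.sum_le_sum fun n _ => hBle n).trans ?_
    rw [Finset.sum_add_distrib, ← Finset.mul_sum]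
    refine add_le_add ((sum_Ico_pow_le hρ0.le hρ1 F T).trans ?_) ?_
    · gcongr
      exact pow_le_one₀ hρ0.le hρ1.le
    · have e1 : (T + 1) * q ^ F ≤ 2 := by
        calc (T + 1) * q ^ F ≤ (T + 1) * (1 / T) := by gcongr
          _ ≤ 2 := by rw [mul_one_div, div_le_iff₀ (by linarith)]; linarith
      calc K * (T + 1) * ∑ n ∈ Finset.Ico F T, q ^ n
          ≤ K * (T + 1) * (q ^ F / (1 - q)) := by
            gcongr
            exact sum_Ico_pow_le hq0.le hq1 F T
        _ = K * ((T + 1) * q ^ F) / (1 - q) := by ring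
        _ ≤ _ := by gcongr
  linarith

/-! ### Tilts and Kullback–Leibler divergence -/

section Tilt

variable {ν : Measure ℝ} [IsProbabilityMeasure ν] {lam : ℝ}

theorem klDiv_tilted (hid : Integrable (fun x : ℝ => x) ν)
    (he : Integrable (fun x => Real.exp (lam * x)) ν) :
    InformationTheory.klDiv ν (ν.tilted fun x => lam * x) ≠ ⊤ ∧
      kl ν (ν.tilted fun x => lam * x) =
        Real.log (∫ x, Real.exp (lam * x) ∂ν) - lam * mean ν := by
  have := isProbabilityMeasure_tilted he
  have hac : ν ≪ ν := Measure.AbsolutelyContinuous.rfl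
  have hself : Integrable (llr ν ν) ν := (integrable_congr (llr_self ν)).2 (integrable_zero _ _ _)
  have h0 : ∫ x, llr ν ν x ∂ν = 0 := by
    rw [integral_congr_ae (llr_self ν)]
    simp
  have hact := absolutelyContinuous_tilted he
  refine ⟨InformationTheory.klDiv_ne_top hact
    (integrable_llr_tilted_right hac (hid.const_mul lam) hself he), ?_⟩
  rw [kl, InformationTheory.toReal_klDiv_of_measure_eq hact (by simp),
    integral_llr_tilted_right hac (hid.const_mul lam) he hself, h0, integral_const_mul, mean]
  ring

/-- `ν` is the tilt of its tilt by `-lam`. Adding the two formulas of `klDiv_tilted`, the logarithms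
of the normalising constants cancel. The identity fixes the sign of `lam` and shows that equal means
force equal laws. -/
theorem mul_mean_sub_mean (hid : Integrable (fun x : ℝ => x) ν)
    (he : Integrable (fun x => Real.exp (lam * x)) ν)
    (hid' : Integrable (fun x : ℝ => x) (ν.tilted fun x => lam * x)) :
    lam * (mean (ν.tilted fun x => lam * x) - mean ν) =
      kl ν (ν.tilted fun x => lam * x) + kl (ν.tilted fun x => lam * x) ν := by
  have := isProbabilityMeasure_tilted he
  have hneg : (ν.tilted fun x => lam * x).tilted (fun x => -lam * x) = ν := by
    rw [tilted_tilted he]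
    convert tilted_zero ν using 2
    ext x
    simp
  have hM := integral_exp_pos he
  have he' : Integrable (fun x => Real.exp (-lam * x)) (ν.tilted fun x => lam * x) := by
    rw [integrable_tilted_iff he]
    refine (integrable_const (1 : ℝ)).congr (ae_of_all _ fun x => ?_)
    simp [← Real.exp_add]
  have h2 := (klDiv_tilted hid' he').2
  rw [hneg, integral_exp_tilted] at h2
  have e : ∫ x, Real.exp (((fun x => lam * x) + fun x => -lam * x) x) ∂ν = 1 := by simp
  rw [e, Real.log_div one_ne_zero hM.ne', Real.log_one] at h2
  rw [(klDiv_tilted hid he).2, h2]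
  ring

theorem eq_tilted_of_kl_eq_zero (hid : Integrable (fun x : ℝ => x) ν)
    (he : Integrable (fun x => Real.exp (lam * x)) ν)
    (h : kl ν (ν.tilted fun x => lam * x) = 0) : ν.tilted (fun x => lam * x) = ν := by
  have := isProbabilityMeasure_tilted he
  have h1 := (klDiv_tilted hid he).1
  rw [kl, ENNReal.toReal_eq_zero_iff, or_iff_left h1] at h
  exact (InformationTheory.klDiv_eq_zero_iff.1 h).symm

theorem eq_tilted_of_mean_eq (hid : Integrable (fun x : ℝ => x) ν)
    (he : Integrable (fun x => Real.exp (lam * x)) ν)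
    (hid' : Integrable (fun x : ℝ => x) (ν.tilted fun x => lam * x))
    (h : mean (ν.tilted fun x => lam * x) = mean ν) : ν.tilted (fun x => lam * x) = ν := by
  have h1 := mul_mean_sub_mean hid he hid'
  rw [h, sub_self, mul_zero] at h1
  have h2 : 0 ≤ kl ν (ν.tilted fun x => lam * x) := ENNReal.toReal_nonneg
  have h3 : 0 ≤ kl (ν.tilted fun x => lam * x) ν := ENNReal.toReal_nonneg
  exact eq_tilted_of_kl_eq_zero hid he (by linarith)

/-- Lines of slope `d` close to the mean of `ν` separate `ν` from a tilt of larger mean, at a rate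
close to the Kullback-Leibler divergence. -/
theorem exists_pair (hid : Integrable (fun x : ℝ => x) ν)
    (he : Integrable (fun x => Real.exp (lam * x)) ν)
    (hid' : Integrable (fun x : ℝ => x) (ν.tilted fun x => lam * x))
    (h : mean ν < mean (ν.tilted fun x => lam * x)) {ε : ℝ} (hε : 0 < ε) :
    0 < kl ν (ν.tilted fun x => lam * x) ∧ ∃ d, Pair ν d lam ∧
      (1 + ε) / kl ν (ν.tilted fun x => lam * x) * Real.log (expMom ν d lam) = 1 := by
  have h1 := mul_mean_sub_mean hid he hid'
  have h2 : 0 ≤ kl ν (ν.tilted fun x => lam * x) := ENNReal.toReal_nonneg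
  have h3 : 0 ≤ kl (ν.tilted fun x => lam * x) ν := ENNReal.toReal_nonneg
  have hpos : 0 < kl ν (ν.tilted fun x => lam * x) := by
    refine lt_of_le_of_ne h2 fun h0 => h.ne ?_
    rw [eq_tilted_of_kl_eq_zero hid he h0.symm]
  have hlam : 0 < lam := by
    by_contra hc
    nlinarith [mul_nonneg (neg_nonneg.2 (not_lt.1 hc)) (sub_nonneg.2 h.le)]
  have hM := integral_exp_pos he
  have hkl := (klDiv_tilted hid he).2
  set k := kl ν (ν.tilted fun x => lam * x) with hk
  -- `log (expMom ν d lam) = k - lam * (d - mean ν)`; the slope is chosen so that this equals `k /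
  -- (1 + ε)`.
  refine ⟨hpos, mean ν + k * ε / ((1 + ε) * lam), ?_⟩
  set d := mean ν + k * ε / ((1 + ε) * lam) with hd
  have hexp : expMom ν d lam = Real.exp (-(lam * d)) * ∫ x, Real.exp (lam * x) ∂ν := by
    rw [expMom, ← integral_const_mul]
    refine integral_congr_ae (ae_of_all _ fun x => ?_)
    change Real.exp (lam * (x - d)) = Real.exp (-(lam * d)) * Real.exp (lam * x)
    rw [← Real.exp_add]
    congr 1; ring
  have hlog : Real.log (expMom ν d lam) = k / (1 + ε) := by
    rw [hexp, Real.log_mul (Real.exp_ne_zero _) hM.ne', Real.log_exp]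
    have e : Real.log (∫ x, Real.exp (lam * x) ∂ν) = k + lam * mean ν := by linarith
    rw [e, hd]
    field_simp
    ring
  refine ⟨⟨hid, ?_, hlam, he, ?_, hid'⟩, ?_⟩
  · have : 0 < k * ε / ((1 + ε) * lam) := by positivity
    linarith
  · rw [← Real.log_pos_iff (by rw [hexp]; positivity), hlog]
    positivity
  · rw [hlog]
    field_simp

end Tilt

theorem tilted_expFamily {ρ : Measure ℝ} {a b : ℝ}
    (hb : Integrable (fun x : ℝ => Real.exp (b * x)) ρ) :
    (expFamily ρ b).tilted (fun x => (a - b) * x) = expFamily ρ a := by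
  rw [expFamily, tilted_tilted hb, expFamily]
  congr 1
  ext x
  simp only [Pi.add_apply]
  ring

theorem integrable_exp_expFamily {ρ : Measure ℝ} {a b : ℝ}
    (hb : Integrable (fun x : ℝ => Real.exp (b * x)) ρ)
    (ha : Integrable (fun x : ℝ => Real.exp (a * x)) ρ) :
    Integrable (fun x : ℝ => Real.exp ((a - b) * x)) (expFamily ρ b) := by
  rw [expFamily, integrable_tilted_iff hb]
  refine ha.congr (ae_of_all _ fun x => ?_)
  simp only [smul_eq_mul, ← Real.exp_add]
  congr 1; ring

section Family

variable {K : ℕ} {ρ : Measure ℝ} {θ : Fin K → ℝ} {ν : Fin K → Measure ℝ}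

theorem isTiltFamily_expFamily (hρ : ρ ≠ 0)
    (hθ : ∀ k, Integrable (fun x : ℝ => Real.exp (θ k * x)) ρ)
    (hν : ∀ k, ν k = expFamily ρ (θ k)) (hmean : ∀ k, Integrable (fun x : ℝ => x) (ν k)) :
    IsTiltFamily ν := by
  have : NeZero ρ := ⟨hρ⟩
  have hprob : ∀ k, IsProbabilityMeasure (ν k) := fun k => by
    rw [hν k]
    exact isProbabilityMeasure_tilted (hθ k)
  have htilt : ∀ b a, (ν b).tilted (fun x => (θ a - θ b) * x) = ν a := fun b a => by
    rw [hν b, hν a, tilted_expFamily (hθ b)]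
  have he : ∀ b a, Integrable (fun x : ℝ => Real.exp ((θ a - θ b) * x)) (ν b) := fun b a => by
    rw [hν b]
    exact integrable_exp_expFamily (hθ b) (hθ a)
  refine ⟨hprob, fun b a hba => ?_, fun a b hab => ?_⟩
  · have := hprob b
    -- Only the existence of a separating slope matters here, so `ε = 1` will do.
    obtain ⟨-, d, hp, -⟩ := exists_pair (hmean b) (he b a) (by rw [htilt]; exact hmean a)
      (by rwa [htilt]) one_pos
    exact ⟨d, _, hp, (htilt b a).symm⟩
  · have := hprob b
    rw [← htilt b a]
    exact eq_tilted_of_mean_eq (hmean b) (he b a) (by rw [htilt]; exact hmean a) (by rwa [htilt])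

end Family

/-! ### From pull counts to regret -/

section Regret

variable {K : ℕ} [NeZero K]

theorem history_succ (y : Fin K → ℕ → ℝ) (u : ℕ → Fin K → ℝ) (T : ℕ) :
    history y u (T + 1) = history y u T ++ (sel y u T).sort (· ≤ ·) := by
  rw [history, List.range_succ, List.flatMap_append]
  simp [history, pulled, sel]

theorem sum_map_history (gap : Fin K → ℝ) (y : Fin K → ℕ → ℝ) (u : ℕ → Fin K → ℝ) (T : ℕ) :
    ((history y u T).map gap).sum = roundRegret gap y u T := by
  induction T with
  | zero => simp [history, roundRegret, pullCount]
  | succ T ih =>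
    have h1 : (((sel y u T).sort (· ≤ ·)).map gap).sum = ∑ k ∈ sel y u T, gap k := by
      rw [Finset.sum, ← Finset.sort_eq (sel y u T) (· ≤ ·), Multiset.map_coe, Multiset.sum_coe]
    rw [history_succ, List.map_append, List.sum_append, ih, h1, roundRegret, roundRegret]
    simp only [pullCount_succ]
    push_cast
    simp [mul_add, Finset.sum_add_distrib]

theorem timeRegret_nonneg {gap : Fin K → ℝ} (hgap : ∀ k, 0 ≤ gap k) (y : Fin K → ℕ → ℝ)
    (u : ℕ → Fin K → ℝ) (T : ℕ) : 0 ≤ timeRegret gap y u T :=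
  List.sum_nonneg fun x hx => by
    obtain ⟨k, -, rfl⟩ := List.mem_map.1 hx
    exact hgap k

/-- The first `T` pulls are a prefix of those made in the first `T` rounds, and the gaps are
nonnegative. -/
theorem timeRegret_le_roundRegret {gap : Fin K → ℝ} (hgap : ∀ k, 0 ≤ gap k) (y : Fin K → ℕ → ℝ)
    (u : ℕ → Fin K → ℝ) (T : ℕ) : timeRegret gap y u T ≤ roundRegret gap y u T := by
  rw [← sum_map_history, timeRegret]
  conv_rhs => rw [← List.take_append_drop T (history y u T)]
  rw [List.map_append, List.sum_append]
  refine le_add_of_nonneg_right (List.sum_nonneg fun x hx => ?_)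
  obtain ⟨k, -, rfl⟩ := List.mem_map.1 hx
  exact hgap k

theorem measurable_comp_history (g : List (Fin K) → ℝ) (T : ℕ) :
    Measurable fun e : Env K => g (history e.1 e.2 T) := by
  let _ : MeasurableSpace (List (Fin K)) := ⊤
  let _ : MeasurableSpace (Finset (Fin K)) := ⊤
  have : DiscreteMeasurableSpace (List (Fin K)) := ⟨fun _ => trivial⟩
  have : DiscreteMeasurableSpace (Finset (Fin K)) := ⟨fun _ => trivial⟩
  have hsel : ∀ t, Measurable fun e : Env K => sel e.1 e.2 t := fun t => by
    refine measurable_to_countable' fun s => ?_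
    have : (fun e : Env K => sel e.1 e.2 t) ⁻¹' {s} =
        {e | ∀ k, k ∈ sel e.1 e.2 t ↔ k ∈ s} := by
      ext e
      simp [Finset.ext_iff]
    rw [this]
    exact measurableSet_setOfPred.2 (Measurable.forall fun k =>
      (measurable_sel t k).iff measurable_const)
  have hhist : Measurable fun e : Env K => history e.1 e.2 T := by
    induction T with
    | zero => simpa only [history, List.range_zero, List.flatMap_nil] using measurable_const
    | succ T ih =>
      simp only [history_succ]
      exact (Measurable.of_discrete (f := fun p : List (Fin K) × Finset (Fin K) =>
        p.1 ++ p.2.sort (· ≤ ·))).comp (ih.prodMk (hsel T))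
  exact (Measurable.of_discrete (f := g)).comp hhist

variable {Ω : Type u} [MeasurableSpace Ω] {P : Measure Ω} [IsProbabilityMeasure P]
  {ν : Fin K → Measure ℝ} {Y : Fin K → ℕ → Ω → ℝ} {U : ℕ → Fin K → Ω → ℝ}

theorem integrable_pullCount (hban : IsBandit P ν Y U) (T : ℕ) (k : Fin K) :
    Integrable (fun ω => (pullCount (env Y U ω).1 (env Y U ω).2 T k : ℝ)) P := by
  refine (integrable_const (T : ℝ)).mono' ?_ (ae_of_all _ fun ω => ?_)
  · exact ((Measurable.of_discrete (f := fun N : Fin K → ℕ => (N k : ℝ))).comp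
      ((measurable_pullCount T).comp (measurable_env hban))).aestronglyMeasurable
  · rw [Real.norm_eq_abs, abs_of_nonneg (Nat.cast_nonneg _)]
    exact_mod_cast pullCount_le

theorem integrable_roundRegret (hban : IsBandit P ν Y U) (gap : Fin K → ℝ) (T : ℕ) :
    Integrable (fun ω => roundRegret gap (env Y U ω).1 (env Y U ω).2 T) P :=
  integrable_finsetSum _ fun k _ => (integrable_pullCount hban T k).const_mul (gap k)

theorem integral_roundRegret (hban : IsBandit P ν Y U) (gap : Fin K → ℝ) (T : ℕ) :
    ∫ ω, roundRegret gap (env Y U ω).1 (env Y U ω).2 T ∂P =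
      ∑ k, gap k * ∫ ω, (pullCount (env Y U ω).1 (env Y U ω).2 T k : ℝ) ∂P := by
  simp only [roundRegret]
  rw [integral_finsetSum _ fun k _ => (integrable_pullCount hban T k).const_mul (gap k)]
  simp only [integral_const_mul]

theorem integrable_timeRegret (hban : IsBandit P ν Y U) {gap : Fin K → ℝ} (hgap : ∀ k, 0 ≤ gap k)
    (T : ℕ) : Integrable (fun ω => timeRegret gap (env Y U ω).1 (env Y U ω).2 T) P := by
  refine (integrable_roundRegret hban gap T).mono' ?_ (ae_of_all _ fun ω => ?_)
  · exact ((measurable_comp_history (fun l => ((l.take T).map gap).sum) T).comp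
      (measurable_env hban)).aestronglyMeasurable
  · rw [Real.norm_eq_abs, abs_of_nonneg (timeRegret_nonneg hgap _ _ T)]
    exact timeRegret_le_roundRegret hgap _ _ T

end Regret

end LBSDA
end

theorem theorem1 {K : ℕ} [NeZero K] (ρ : Measure ℝ) (hρ : ρ ≠ 0) (θ : Fin K → ℝ)
    (hθ : ∀ k, Integrable (fun x : ℝ => Real.exp (θ k * x)) ρ)
    (ν : Fin K → Measure ℝ) (hν : ∀ k, ν k = LBSDA.expFamily ρ (θ k))
    (hmean : ∀ k, Integrable (fun x : ℝ => x) (ν k))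
    (kstar : Fin K) (hstar : ∀ k, LBSDA.mean (ν k) ≤ LBSDA.mean (ν kstar))
    (gap : Fin K → ℝ) (hgap : ∀ k, gap k = LBSDA.mean (ν kstar) - LBSDA.mean (ν k))
    (ε : ℝ) (hε : 0 < ε) :
    ∃ C : ℝ, ∀ (Ω : Type u) [MeasurableSpace Ω] (P : Measure Ω) [IsProbabilityMeasure P]
      (Y : Fin K → ℕ → Ω → ℝ) (U : ℕ → Fin K → Ω → ℝ), LBSDA.IsBandit P ν Y U → ∀ T : ℕ,
      (Integrable (fun ω => LBSDA.timeRegret gap (fun k i => Y k i ω) (fun r k => U r k ω) T) P ∧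
        ∫ ω, LBSDA.timeRegret gap (fun k i => Y k i ω) (fun r k => U r k ω) T ∂P ≤
          (∑ k with LBSDA.mean (ν k) < LBSDA.mean (ν kstar),
            (1 + ε) * gap k / LBSDA.kl (ν k) (ν kstar)) * Real.log T + C) ∧
      (Integrable (fun ω => LBSDA.roundRegret gap (fun k i => Y k i ω) (fun r k => U r k ω) T) P ∧
        ∫ ω, LBSDA.roundRegret gap (fun k i => Y k i ω) (fun r k => U r k ω) T ∂P ≤
          (∑ k with LBSDA.mean (ν k) < LBSDA.mean (ν kstar),
            (1 + ε) * gap k / LBSDA.kl (ν k) (ν kstar)) * Real.log T + C) := by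
  have hgap0 : ∀ k, 0 ≤ gap k := fun k => by
    rw [hgap]
    exact sub_nonneg.2 (hstar k)
  have htf := LBSDA.isTiltFamily_expFamily hρ hθ hν hmean
  have hcount : ∀ k, ∃ C : ℝ, LBSDA.mean (ν k) < LBSDA.mean (ν kstar) →
      ∀ (Ω : Type u) [MeasurableSpace Ω] (P : Measure Ω) [IsProbabilityMeasure P]
        (Y : Fin K → ℕ → Ω → ℝ) (U : ℕ → Fin K → Ω → ℝ), LBSDA.IsBandit P ν Y U → ∀ T : ℕ,
        ∫ ω, (LBSDA.pullCount (LBSDA.env Y U ω).1 (LBSDA.env Y U ω).2 T k : ℝ) ∂P ≤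
          (1 + ε) / LBSDA.kl (ν k) (ν kstar) * Real.log T + C := fun k => by
    by_cases hk : LBSDA.mean (ν k) < LBSDA.mean (ν kstar)
    · have := htf.prob k
      have htilt : (ν k).tilted (fun x => (θ kstar - θ k) * x) = ν kstar := by
        rw [hν k, hν kstar, LBSDA.tilted_expFamily (hθ k)]
      have he : Integrable (fun x : ℝ => Real.exp ((θ kstar - θ k) * x)) (ν k) := by
        rw [hν k]
        exact LBSDA.integrable_exp_expFamily (hθ k) (hθ kstar)
      obtain ⟨hkl, d, hp, hd⟩ := LBSDA.exists_pair (hmean k) he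
        (by rw [htilt]; exact hmean kstar) (by rwa [htilt]) hε
      rw [htilt] at hkl hd
      obtain ⟨C, hC⟩ := LBSDA.exists_integral_pullCount_le.{u} htf hstar hk hp htilt.symm
        (show 0 < (1 + ε) / LBSDA.kl (ν k) (ν kstar) by positivity) hd.ge
      exact ⟨C, fun _ => hC⟩
    · exact ⟨0, fun h => absurd h hk⟩
  choose C hC using hcount
  refine ⟨∑ k with LBSDA.mean (ν k) < LBSDA.mean (ν kstar), gap k * C k,
    fun Ω _ P _ Y U hban T => ?_⟩
  have hint := LBSDA.integrable_roundRegret hban gap T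
  have hround : ∫ ω, LBSDA.roundRegret gap (LBSDA.env Y U ω).1 (LBSDA.env Y U ω).2 T ∂P ≤
      (∑ k with LBSDA.mean (ν k) < LBSDA.mean (ν kstar),
        (1 + ε) * gap k / LBSDA.kl (ν k) (ν kstar)) * Real.log T +
        ∑ k with LBSDA.mean (ν k) < LBSDA.mean (ν kstar), gap k * C k := by
    rw [LBSDA.integral_roundRegret hban, Finset.sum_mul, ← Finset.sum_add_distrib,
      ← Finset.sum_filter_of_ne (p := fun k => LBSDA.mean (ν k) < LBSDA.mean (ν kstar))]
    · refine Finset.sum_le_sum fun k hk => ?_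
      refine (mul_le_mul_of_nonneg_left (hC k (Finset.mem_filter.1 hk).2 Ω P Y U hban T)
        (hgap0 k)).trans (le_of_eq ?_)
      ring
    -- Arms of maximal mean have zero gap, so the sum reduces to suboptimal arms.
    · intro k _ hne
      by_contra hk
      refine hne ?_
      rw [hgap, le_antisymm (not_lt.1 hk) (hstar k), sub_self, zero_mul]
  exact ⟨⟨LBSDA.integrable_timeRegret hban hgap0 T,
    (integral_mono (LBSDA.integrable_timeRegret hban hgap0 T) hint fun ω =>
      LBSDA.timeRegret_le_roundRegret hgap0 _ _ T).trans hround⟩, hint, hround⟩
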